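/- **Setting.** Let $\Omega\subset\mathbb R^2$ be a polygonal domain, $\mathbf a=[a_{ij}]$ a symmetric $2\times2$ matrix function with (continuous representatives of) entries in $W^{1,\infty}(\Omega)$ and $\sum_{i,j} a_{ij}(x)\xi_i\xi_j\ge r|\xi|^2$ on $\Omega$ for some $r>0$, and $b\ge 0$ a function that is smooth on $\overline\Omega$. For $f\in L^2(\Omega)$ consider $$-\nabla\cdot(\mathbf a\nabla u)+bu=f\ \text{ in }\Omega,\qquad u=0\ \text{ on }\partial\Omega. \tag{1}$$ Let $\mathscr T$ be a family of primary partitions $\mathcal T$ of $\Omega$. Each $\mathcal T$ is a finite triangulation or rectangle partition of $\overline\Omega$ whose elements have non-overlapping interiors and in which no vertex of an element lies in the interior of an edge of another. With each $\mathcal T$ is associated a dual partition $\mathcal T^*$ of $\overline\Omega$ into finitely many closed polygons $K^*$ with non-overlapping interiors. For $K\in\mathcal T$ let $L_K^*$ be the set of dual gridlines in $K$, i.e. the maximal segments in $K$ that run along the common boundary of two different dual elements and meet $\operatorname{int}K$; assume that the number of elements of $L^*_K$ is bounded by a constant independent of $K$ and $\mathcal T$. Let $h_K=\operatorname{diam}K$,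 let $h$ be the supremum of $h_K$ over all $K\in\mathcal T$, $\mathcal T\in\mathscr T$, and let $\varrho_K$ be the diameter of the largest circle contained in $K$. The family is *regular* if there is $\varrho>0$ with $\varrho_K\ge\varrho h_K$ for all $K\in\mathcal T$, $\mathcal T\in\mathscr T$. For $w\in\mathbb H^2_{\mathcal T}(\Omega)=\{w\in L^2(\Omega): w|_K\in H^2(K)\ \forall K\in\mathcal T\}$ put $\|w\|_{1,\mathcal T}=(\sum_K|w|_{1,K}^2)^{1/2}$ and $|w|_{2,\mathcal T}=(\sum_K|w|_{2,K}^2)^{1/2}$. For such $w$, and for $v$ that is a polynomial on each $K\cap K^*$, put $$a_{\mathcal T}(w,v)=\sum_{K\in\mathcal T}\sum_{K^*\in\mathcal T^*}\Big\{\int_{K\cap K^*}\big(\nabla w^T\mathbf a\nabla v+bwv\big)-\int_{\partial K^*\cap\operatorname{int}K}v\,(\mathbf a\nabla w)\cdot\mathbf n\Big\},$$ where $\mathbf n$ is the outward unit normal on $\partial K^*$ and, in the line integral, $v$ and $\nabla w$ are traces, that of $v$ being taken from inside $K\cap K^*$; and, with $[v]$ the jump of $v$ across $\ell^*$, $$|v|_{1,\mathbb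 V_{\mathcal T^*}}=\Big(\sum_{K\in\mathcal T}\Big(\sum_{K^*\in\mathcal T^*}|v|^2_{1,K\cap K^*}+\sum_{\ell^*\in L_K^*}|\ell^*|^{-1}\int_{\ell^*}[v]^2\Big)\Big)^{1/2}.$$ For each $\mathcal T\in\mathscr T$ let $\mathbb U_{\mathcal T}\subset\mathbb H^2_{\mathcal T}(\Omega)$ be a finite-dimensional trial space, let $\mathbb V_{\mathcal T^*}\subset L^2(\Omega)$ be a test space of the same dimension whose functions are polynomials on each $K\cap K^*$, and let $\Pi_{\mathcal T^*}:\mathbb U_{\mathcal T}\to\mathbb V_{\mathcal T^*}$ be linear and onto. The FVM equation is to find $u_{\mathcal T}\in\mathbb U_{\mathcal T}$ with $$a_{\mathcal T}(u_{\mathcal T},v)=(f,v)\quad\text{for all }v\in\mathbb V_{\mathcal T^*}. \tag{2}$$ **Theorem.** Assume that $\mathscr T$ is regular and that there are positive constants $C_1,C_2,\sigma$ such that for all $\mathcal T\in\mathscr T$ and all $v\in\mathbb U_{\mathcal T}$ $$|\Pi_{\mathcal T^*}v|_{1,\mathbb V_{\mathcal T^*}}\le C_1\|v\|_{1,\mathcal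 T},\qquad \|\Pi_{\mathcal T^*}v\|_{0,\Omega}\le C_2\|v\|_{1,\mathcal T},\qquad a_{\mathcal T}(v,\Pi_{\mathcal T^*}v)\ge\sigma\|v\|_{1,\mathcal T}^2 .$$ Then for every $f\in L^2(\Omega)$ and every $\mathcal T\in\mathscr T$ the FVM equation (2) has a unique solution $u_{\mathcal T}\in\mathbb U_{\mathcal T}$. Moreover, there is a positive constant $C$, independent of $\mathcal T$, $f$ and $u$, such that whenever $u\in H^1_0(\Omega)\cap H^2(\Omega)$ is a solution of (1), for all $\mathcal T\in\mathscr T$ $$\|u-u_{\mathcal T}\|_{1,\mathcal T}\le C\Big(\inf_{w\in\mathbb U_{\mathcal T}}\big(\|u-w\|_{0,\Omega}+\|u-w\|_{1,\mathcal T}+h|u-w|_{2,\mathcal T}\big)+\sup_{v\in\mathbb U_{\mathcal T}}\frac{E_{\mathcal T}(u,v)}{\|v\|_{1,\mathcal T}}\Big),$$ where the supremum is finite (the quotient for $v=0$ being read as $0$) and $$E_{\mathcal T}(u,v):=a_{\mathcal T}(u-u_{\mathcal T},\Pi_{\mathcal T^*}v)=a_{\mathcal T}(u,\Pi_{\mathcal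 T^*}v)-(f,\Pi_{\mathcal T^*}v).$$ -/

import Mathlib

open MeasureTheory Filter Topology
open scoped ContDiff ENNReal

noncomputable section

namespace FVM

/-- The Euclidean plane. -/
abbrev Plane : Type := EuclideanSpace ℝ (Fin 2)

/-- `L²(Ω)`, as a space of classes modulo equality almost everywhere on `Ω`. -/
abbrev L2 (Ω : Set Plane) : Type := Lp ℝ 2 ((volume : Measure Plane).restrict Ω)

/-! ### Sobolev spaces -/

/-- Classical partial derivative in the `i`-th coordinate direction. -/
def partialDeriv (i : Fin 2) (φ : Plane → ℝ) (x : Plane) : ℝ :=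
  fderiv ℝ φ x (EuclideanSpace.single i 1)

/-- `C_c^∞(D)`. -/
def IsTestFunction (D : Set Plane) (φ : Plane → ℝ) : Prop :=
  ContDiff ℝ ∞ φ ∧ HasCompactSupport φ ∧ tsupport φ ⊆ D

/-- `g'` is the weak partial derivative `∂ᵢ g` on the open set `D`
(meant for `g`, `g'` in some `Lᵖ(D)`, so that both integrals are proper). -/
def IsWeakPartial (D : Set Plane) (i : Fin 2) (g g' : Plane → ℝ) : Prop :=
  ∀ φ : Plane → ℝ, IsTestFunction D φ →
    ∫ x in D, g x * partialDeriv i φ x = -∫ x in D, g' x * φ x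

/-- `g` has a weak partial derivative `∂ᵢ g` in `L²(D)`. -/
def HasL2Partial (D : Set Plane) (i : Fin 2) (g : Plane → ℝ) : Prop :=
  ∃ g' : Plane → ℝ, MemLp g' 2 (volume.restrict D) ∧ IsWeakPartial D i g g'

open Classical in
/-- The weak partial derivative `∂ᵢ g ∈ L²(D)` (unique almost everywhere on `D`). -/
def weakPartial (D : Set Plane) (i : Fin 2) (g : Plane → ℝ) : Plane → ℝ :=
  if h : HasL2Partial D i g then h.choose else 0

/-- The weak gradient on `D`, as a vector of coordinates. -/
def weakGrad (D : Set Plane) (g : Plane → ℝ) (x : Plane) : Fin 2 → ℝ :=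
  fun i => weakPartial D i g x

/-- `g ∈ H¹(D)`. -/
def MemH1 (D : Set Plane) (g : Plane → ℝ) : Prop :=
  MemLp g 2 (volume.restrict D) ∧ ∀ i, HasL2Partial D i g

/-- `g ∈ H²(D)`. -/
def MemH2 (D : Set Plane) (g : Plane → ℝ) : Prop :=
  MemH1 D g ∧ ∀ i, MemH1 D (weakPartial D i g)

/-- `g ∈ H¹₀(D)`, the closure of `C_c^∞(D)` in `H¹(D)`. -/
def MemH10 (D : Set Plane) (g : Plane → ℝ) : Prop :=
  MemH1 D g ∧ ∃ φ : ℕ → Plane → ℝ, (∀ n, IsTestFunction D (φ n)) ∧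
    Tendsto (fun n => eLpNorm (φ n - g) 2 (volume.restrict D)) atTop (𝓝 0) ∧
    ∀ i, Tendsto (fun n => eLpNorm (partialDeriv i (φ n) - weakPartial D i g) 2
      (volume.restrict D)) atTop (𝓝 0)

/-- `g ∈ W^{1,∞}(D)`, where `g` is the continuous representative of its class. (The values of
such a coefficient on line segments are used, and these are those of that representative.) -/
def MemW1Infty (D : Set Plane) (g : Plane → ℝ) : Prop :=
  ContinuousOn g D ∧ MemLp g ∞ (volume.restrict D) ∧
    ∀ i, ∃ g' : Plane → ℝ, MemLp g' ∞ (volume.restrict D) ∧ IsWeakPartial D i g g'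

/-- `|g|²_{1,D} = ∫_D |∇g|²`. -/
def semi1Sq (D : Set Plane) (g : Plane → ℝ) : ℝ :=
  ∫ x in D, ∑ i, weakPartial D i g x ^ 2

/-- `|g|²_{2,D}`, the integral of the sum of the squares of the partial derivatives
`∂^α g`, over the multi-indices `α` of order two. -/
def semi2Sq (D : Set Plane) (g : Plane → ℝ) : ℝ :=
  ∫ x in D, (weakPartial D 0 (weakPartial D 0 g) x ^ 2 +
    weakPartial D 1 (weakPartial D 0 g) x ^ 2 +
    weakPartial D 1 (weakPartial D 1 g) x ^ 2)

/-- `τ ∈ L²(s)` (arc length) is the trace on the one-dimensional set `s ⊆ closure D` of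
`g ∈ H¹(D)`: some smooth functions converge to `g` in `H¹(D)` and to `τ` in `L²(s)`. -/
def IsTrace (D s : Set Plane) (g τ : Plane → ℝ) : Prop :=
  MemLp τ 2 ((μH[1] : Measure Plane).restrict s) ∧
  ∃ φ : ℕ → Plane → ℝ, (∀ n, ContDiff ℝ ∞ (φ n)) ∧
    Tendsto (fun n => eLpNorm (φ n - g) 2 (volume.restrict D)) atTop (𝓝 0) ∧
    (∀ i, Tendsto (fun n => eLpNorm (partialDeriv i (φ n) - weakPartial D i g) 2
      (volume.restrict D)) atTop (𝓝 0)) ∧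
    Tendsto (fun n => eLpNorm (φ n - τ) 2 ((μH[1] : Measure Plane).restrict s)) atTop (𝓝 0)

open Classical in
/-- The trace on `s` of `g ∈ H¹(D)`. -/
def traceOn (D s : Set Plane) (g : Plane → ℝ) : Plane → ℝ :=
  if h : ∃ τ, IsTrace D s g τ then h.choose else 0

/-! ### Polygons and partitions -/

/-- A polygonal domain: a bounded domain, lying locally on one side of its boundary, whose
boundary consists of finitely many line segments. -/
def IsPolygonalDomain (Ω : Set Plane) : Prop :=
  IsOpen Ω ∧ IsConnected Ω ∧ Bornology.IsBounded Ω ∧ interior (closure Ω) = Ω ∧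
    ∃ S : Finset (Plane × Plane), frontier Ω = ⋃ p ∈ S, segment ℝ p.1 p.2

/-- A closed polygon. -/
def IsPolygon (P : Set Plane) : Prop :=
  ∃ G, IsPolygonalDomain G ∧ P = closure G

/-- A closed nondegenerate triangle. -/
def IsTriangle (K : Set Plane) : Prop :=
  ∃ p : Fin 3 → Plane, AffineIndependent ℝ p ∧ K = convexHull ℝ (Set.range p)

/-- A closed nondegenerate rectangle. -/
def IsRectangle (K : Set Plane) : Prop :=
  ∃ p e₁ e₂ : Plane, e₁ ≠ 0 ∧ e₂ ≠ 0 ∧ inner ℝ e₁ e₂ = 0 ∧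
    K = convexHull ℝ {p, p + e₁, p + e₂, p + e₁ + e₂}

/-- A finite family of closed sets covers `closure Ω` without overlapping interiors. -/
def IsPartition (Ω : Set Plane) (T : Finset (Set Plane)) : Prop :=
  closure Ω = ⋃ K ∈ T, K ∧
    ∀ K ∈ T, ∀ L ∈ T, K ≠ L → Disjoint (interior K) (interior L)

/-- A primary partition: a triangulation or a rectangle partition such that no vertex of an
element lies in the interior of an edge of another element. (For triangles and rectangles the
vertices are the extreme points, and the edges without their endpoints make up the rest of
the boundary.) -/
def IsPrimaryPartition (Ω : Set Plane) (T : Finset (Set Plane)) : Prop :=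
  IsPartition Ω T ∧ ((∀ K ∈ T, IsTriangle K) ∨ (∀ K ∈ T, IsRectangle K)) ∧
    ∀ K ∈ T, ∀ L ∈ T, K ≠ L →
      ∀ p ∈ K.extremePoints ℝ, p ∉ frontier L \ L.extremePoints ℝ

/-- A dual partition: a partition into polygons, the control volumes. -/
def IsDualPartition (Ω : Set Plane) (Ts : Finset (Set Plane)) : Prop :=
  IsPartition Ω Ts ∧ ∀ Ks ∈ Ts, IsPolygon Ks

/-- Diameter of the largest circle contained in `K`. -/
def inDiam (K : Set Plane) : ℝ :=
  sSup {d | ∃ (c : Plane) (r : ℝ), 0 ≤ r ∧ d = 2 * r ∧ Metric.closedBall c r ⊆ K}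

/-- A family of partitions is regular. -/
def IsRegularFamily {ι : Type*} (T : ι → Finset (Set Plane)) : Prop :=
  ∃ ϱ : ℝ, 0 < ϱ ∧ ∀ i, ∀ K ∈ T i, ϱ * Metric.diam K ≤ inDiam K

/-- The mesh size of the family: the supremum of the diameters of all elements of all its
members. -/
def meshSize {ι : Type*} (T : ι → Finset (Set Plane)) : ℝ :=
  sSup {d | ∃ i, ∃ K ∈ T i, d = Metric.diam K}

/-- The dual gridlines in `K`: the maximal line segments in `K` which run along the common
boundary of two different control volumes and pass through the interior of `K`. -/
def dualGridlines (Ts : Finset (Set Plane)) (K : Set Plane) : Set (Set Plane) :=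
  {l | ∃ K₁ ∈ Ts, ∃ K₂ ∈ Ts, K₁ ≠ K₂ ∧
    ∃ p q : Plane, p ≠ q ∧ l = segment ℝ p q ∧ l ⊆ K₁ ∩ K₂ ∩ K ∧ (l ∩ interior K).Nonempty ∧
      ∀ p' q' : Plane, l ⊆ segment ℝ p' q' → segment ℝ p' q' ⊆ K₁ ∩ K₂ ∩ K →
        segment ℝ p' q' = l}

/-- `ν` is the outward unit normal of the polygon `P` at `x`: near `x`, the polygon is the
half-plane through `x` with outward unit normal `ν`. -/
def IsOuterNormal (P : Set Plane) (x ν : Plane) : Prop :=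
  ‖ν‖ = 1 ∧ ∃ ε > 0, P ∩ Metric.ball x ε = {y ∈ Metric.ball x ε | inner ℝ (y - x) ν ≤ 0}

open Classical in
/-- The outward unit normal of `P` at `x`; it is `0` where there is none, in particular off the
boundary of `P` and at its corners. -/
def outerNormal (P : Set Plane) (x : Plane) : Plane :=
  if h : ∃ ν, IsOuterNormal P x ν then h.choose else 0

/-! ### Discrete norms and forms -/

/-- The part of the boundaries of the control volumes that lies inside `K`. -/
def dualSkeleton (Ts : Finset (Set Plane)) (K : Set Plane) : Set Plane :=
  (⋃ Ks ∈ Ts, frontier Ks) ∩ interior K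

/-- The trace on `∂K* ∩ int K` of `v`, taken from inside `K ∩ K*`. -/
def innerTrace (K Ks : Set Plane) (v : Plane → ℝ) : Plane → ℝ :=
  traceOn (interior K ∩ interior Ks) (frontier Ks ∩ interior K) v

/-- The jump `[v]` across the dual gridlines in `K`, in the (vector) form
`v₁ n₁ + v₂ n₂ = (v₁ - v₂) n₁` with the traces `v₁`, `v₂` from the two sides and the outward unit
normals `n₁ = -n₂`. Only the two control volumes adjacent to `x` contribute. -/
def jump (Ts : Finset (Set Plane)) (K : Set Plane) (v : Plane → ℝ) (x : Plane) : Plane :=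
  ∑ Ks ∈ Ts, innerTrace K Ks v x • outerNormal Ks x

/-- The trace on the dual gridlines in `K` of the gradient of `w ∈ H²(K)`. -/
def gradTrace (Ts : Finset (Set Plane)) (K : Set Plane) (w : Plane → ℝ) (x : Plane) :
    Fin 2 → ℝ :=
  fun i => traceOn (interior K) (dualSkeleton Ts K) (weakPartial (interior K) i w) x

/-- `w|_K ∈ H²(K)` for all `K ∈ T`. -/
def MemBrokenH2 (T : Finset (Set Plane)) (w : Plane → ℝ) : Prop :=
  ∀ K ∈ T, MemH2 (interior K) w

/-- `‖w‖_{1,T}`. -/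
def broken1 (T : Finset (Set Plane)) (w : Plane → ℝ) : ℝ :=
  √(∑ K ∈ T, semi1Sq (interior K) w)

/-- `|w|_{2,T}`. -/
def broken2 (T : Finset (Set Plane)) (w : Plane → ℝ) : ℝ :=
  √(∑ K ∈ T, semi2Sq (interior K) w)

/-- The discrete norm of test functions. -/
def testNorm (T Ts : Finset (Set Plane)) (v : Plane → ℝ) : ℝ :=
  √(∑ K ∈ T, (∑ Ks ∈ Ts, semi1Sq (interior K ∩ interior Ks) v +
    ∑ᶠ l ∈ dualGridlines Ts K,
      ((μH[1] : Measure Plane).real l)⁻¹ *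
        ∫ x in l, ‖jump Ts K v x‖ ^ 2 ∂(μH[1] : Measure Plane)))

/-- `v` is a polynomial on each `K ∩ K*`. -/
def IsPiecewisePolynomial (T Ts : Finset (Set Plane)) (v : Plane → ℝ) : Prop :=
  ∀ K ∈ T, ∀ Ks ∈ Ts, ∃ p : MvPolynomial (Fin 2) ℝ,
    ∀ᵐ x ∂((volume : Measure Plane).restrict (interior K ∩ interior Ks)),
      v x = MvPolynomial.eval (fun i => x i) p

/-- The discrete bilinear form `a_T(w, v)`. -/
def form (a : Plane → Matrix (Fin 2) (Fin 2) ℝ) (b : Plane → ℝ) (T Ts : Finset (Set Plane))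
    (w v : Plane → ℝ) : ℝ :=
  ∑ K ∈ T, ∑ Ks ∈ Ts,
    ((∫ x in interior K ∩ interior Ks,
        (weakGrad (interior K) w x ⬝ᵥ (a x).mulVec (weakGrad (interior K ∩ interior Ks) v x) +
          b x * w x * v x)) -
      ∫ x in frontier Ks ∩ interior K,
        innerTrace K Ks v x * ((a x).mulVec (gradTrace Ts K w x) ⬝ᵥ fun i => outerNormal Ks x i)
          ∂(μH[1] : Measure Plane))

/-- The `L²(Ω)` inner product `(f, v)`. -/
def pairing (Ω : Set Plane) (f v : Plane → ℝ) : ℝ := ∫ x in Ω, f x * v x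

/-- The coefficients of the elliptic problem: `a` is symmetric with entries in `W^{1,∞}(Ω)` and
uniformly elliptic, `b` is smooth up to the boundary and nonnegative. -/
def IsEllipticData (Ω : Set Plane) (a : Plane → Matrix (Fin 2) (Fin 2) ℝ) (b : Plane → ℝ) :
    Prop :=
  (∀ x ∈ Ω, (a x).IsSymm) ∧ (∀ i j, MemW1Infty Ω fun x => a x i j) ∧
    (∃ r : ℝ, 0 < r ∧ ∀ x ∈ Ω, ∀ ξ : Fin 2 → ℝ,
      r * ∑ j, ξ j ^ 2 ≤ ∑ i, ∑ j, a x i j * ξ i * ξ j) ∧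
    ContDiffOn ℝ ∞ b (closure Ω) ∧ ∀ x ∈ Ω, 0 ≤ b x

/-- `u ∈ H¹₀(Ω) ∩ H²(Ω)` solves `-∇·(a∇u) + bu = f` in `Ω`, `u = 0` on `∂Ω`, where the equation
is understood in the sense of distributions. -/
def IsSolution (Ω : Set Plane) (a : Plane → Matrix (Fin 2) (Fin 2) ℝ) (b f u : Plane → ℝ) :
    Prop :=
  MemH10 Ω u ∧ MemH2 Ω u ∧ ∀ φ, IsTestFunction Ω φ →
    ∫ x in Ω, ((a x).mulVec (weakGrad Ω u x) ⬝ᵥ (fun i => partialDeriv i φ x) +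
      b x * u x * φ x) = ∫ x in Ω, f x * φ x

/-- The nonconforming error `E_T(u, v) = a_T(u, Πv) - (f, Πv)`, as a function of `v' = Πv`. -/
def nonconformingError (Ω : Set Plane) (a : Plane → Matrix (Fin 2) (Fin 2) ℝ) (b : Plane → ℝ)
    (T Ts : Finset (Set Plane)) (f u v' : Plane → ℝ) : ℝ :=
  form a b T Ts u v' - pairing Ω f v'

/-- `uT` solves the FVM equation `a_T(uT, v) = (f, v)` for all `v` in the test space `V`. -/
def IsFVMSolution (Ω : Set Plane) (a : Plane → Matrix (Fin 2) (Fin 2) ℝ) (b : Plane → ℝ)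
    (T Ts : Finset (Set Plane)) (V : Submodule ℝ (L2 Ω)) (f uT : L2 Ω) : Prop :=
  ∀ v ∈ V, form a b T Ts uT v = pairing Ω f v

end FVM

end

open FVM

namespace FVM

/-! ### Test functions and partial derivatives -/

/-! The theorem is Strang's second lemma for a Petrov-Galerkin method. For `w` in the trial space
put `d = w - u_T`. Coercivity and linearity give `σ‖d‖² ≤ a_T(d, Πd) = a_T(u - u_T, Πd) - a_T(u - w,
Πd)`. The first term is at most the supremum of the nonconforming quotient times `‖d‖`. The second
is controlled by boundedness of `a_T` together with the two bounds on `Π`. Dividing by `‖d‖` and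
splitting `u - u_T = (u - w) + d` gives the estimate. The identity with the nonconforming error is
linearity plus the discrete equation. Unique solvability is linear algebra: a trial function
annihilated by the form has vanishing seminorm by coercivity, hence zero image under `Π` by the L²
bound, hence is zero since `Π` is bijective; equality of dimensions then turns injectivity into
surjectivity onto the dual of the test space.

The analytic work is the boundedness of `a_T` (`AdmissibleMesh.abs_form_le`), with a constant
depending only on the coefficient bound `M`, the number `N` of gridlines per element and the shape
constant `ϱ`. Volume terms need only Young's inequality. The boundary terms of all control volumes
in an element combine into one integral of `a∇w` against the jump of `v` over the dual skeleton
(`sum_boundaryPart_eq`), and up to finitely many points the skeleton is covered by the gridlines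
(`dualSkeleton_subset`). On a gridline `l` the factor `|l|⁻¹` in the test norm is balanced by the
scaled trace inequality `|l| ‖∇w‖²_l ≤ (24/ϱ)(|w|₁² + h_K² |w|₂²)` of `gradTrace_gridline_le`. It
comes from an elementary inequality on the triangle over `l` whose apex is taken in a disc inside
`K`, at a distance from the line of at least half the radius of that disc. All bounds are kept in
the quadratic form `t X² + Y²/t` with a free `t`, so that they add up over elements and gridlines;
`t` is optimised once at the end.

Weak derivatives and traces are chosen functions, so linearity rests on uniqueness. For gradients on
`K`, traces exist because smooth functions are dense in `H¹` of a convex domain (contract, then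
mollify), and they are unique because the trace bound survives the limit. The sets `K ∩ K*` need not
be convex, but test functions are smooth there. A local trace bound on a half disc identifies their
trace wherever the control volume has a normal, and elsewhere the normal is `0`, so the integrand
vanishes. -/

theorem contDiff_partialDeriv {φ : Plane → ℝ} (hφ : ContDiff ℝ ∞ φ) (i : Fin 2) :
    ContDiff ℝ ∞ (partialDeriv i φ) := by
  unfold partialDeriv
  exact (hφ.fderiv_right (m := ∞) (by simp)).clm_apply contDiff_const

theorem continuous_partialDeriv {φ : Plane → ℝ} (hφ : ContDiff ℝ ∞ φ) (i : Fin 2) :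
    Continuous (partialDeriv i φ) :=
  (contDiff_partialDeriv hφ i).continuous

theorem partialDeriv_add_smul {φ ψ : Plane → ℝ} (hφ : ContDiff ℝ ∞ φ) (hψ : ContDiff ℝ ∞ ψ)
    (c : ℝ) (i : Fin 2) :
    partialDeriv i (φ + c • ψ) = partialDeriv i φ + c • partialDeriv i ψ := by
  funext x
  have h1 : DifferentiableAt ℝ φ x := hφ.differentiable (by simp) x
  have h2 : DifferentiableAt ℝ ψ x := hψ.differentiable (by simp) x
  simp only [partialDeriv, Pi.add_apply, Pi.smul_apply]
  rw [fderiv_add h1 (h2.const_smul c), fderiv_const_smul h2]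
  simp

namespace IsTestFunction

variable {D D' : Set Plane} {φ : Plane → ℝ}

theorem mono (h : D' ⊆ D) (hφ : IsTestFunction D' φ) : IsTestFunction D φ :=
  ⟨hφ.1, hφ.2.1, hφ.2.2.trans h⟩

theorem hasCompactSupport_partialDeriv (hφ : IsTestFunction D φ) (i : Fin 2) :
    HasCompactSupport (partialDeriv i φ) :=
  hφ.2.1.fderiv_apply ℝ _

theorem memLp (hφ : IsTestFunction D φ) (μ : Measure Plane) [IsFiniteMeasureOnCompacts μ]
    (p : ℝ≥0∞) : MemLp φ p μ :=
  hφ.1.continuous.memLp_of_hasCompactSupport hφ.2.1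

theorem memLp_partialDeriv (hφ : IsTestFunction D φ) (i : Fin 2) (μ : Measure Plane)
    [IsFiniteMeasureOnCompacts μ] (p : ℝ≥0∞) : MemLp (partialDeriv i φ) p μ :=
  (continuous_partialDeriv hφ.1 i).memLp_of_hasCompactSupport
    (hφ.hasCompactSupport_partialDeriv i)

theorem eq_zero_of_notMem (hφ : IsTestFunction D φ) {x : Plane} (hx : x ∉ D) : φ x = 0 :=
  image_eq_zero_of_notMem_tsupport fun h => hx (hφ.2.2 h)

theorem partialDeriv_eq_zero_of_notMem (hφ : IsTestFunction D φ) (i : Fin 2) {x : Plane}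
    (hx : x ∉ D) : partialDeriv i φ x = 0 := by
  have : fderiv ℝ φ x = 0 := image_eq_zero_of_notMem_tsupport fun h =>
    hx (hφ.2.2 (tsupport_fderiv_subset ℝ h))
  simp [partialDeriv, this]

end IsTestFunction

/-! ### Weak partial derivatives -/

section WeakPartial

variable {D D' : Set Plane} {i : Fin 2} {g g₁ g₂ g' g₁' g₂' : Plane → ℝ}

theorem integrable_mul_of_memLp_two {α : Type*} [MeasurableSpace α] {μ : Measure α}
    {f g : α → ℝ} (hf : MemLp f 2 μ) (hg : MemLp g 2 μ) : Integrable (fun x => f x * g x) μ :=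
  hf.integrable_mul hg

theorem IsWeakPartial.congr (h : IsWeakPartial D i g g') (h1 : g =ᵐ[volume.restrict D] g₁)
    (h2 : g' =ᵐ[volume.restrict D] g₁') : IsWeakPartial D i g₁ g₁' := by
  intro φ hφ
  have e1 : ∫ x in D, g₁ x * partialDeriv i φ x = ∫ x in D, g x * partialDeriv i φ x :=
    integral_congr_ae (by filter_upwards [h1] with x hx; rw [hx])
  have e2 : ∫ x in D, g₁' x * φ x = ∫ x in D, g' x * φ x :=
    integral_congr_ae (by filter_upwards [h2] with x hx; rw [hx])
  rw [e1, e2, h φ hφ]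

theorem IsWeakPartial.add_smul (h1 : IsWeakPartial D i g₁ g₁') (h2 : IsWeakPartial D i g₂ g₂')
    (m1 : MemLp g₁ 2 (volume.restrict D)) (m2 : MemLp g₂ 2 (volume.restrict D))
    (m1' : MemLp g₁' 2 (volume.restrict D)) (m2' : MemLp g₂' 2 (volume.restrict D)) (c : ℝ) :
    IsWeakPartial D i (g₁ + c • g₂) (g₁' + c • g₂') := by
  intro φ hφ
  have hφ2 := hφ.memLp (volume.restrict D) 2
  have hφ2' := hφ.memLp_partialDeriv i (volume.restrict D) 2
  have e1 : ∫ x in D, (g₁ + c • g₂) x * partialDeriv i φ x =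
      (∫ x in D, g₁ x * partialDeriv i φ x) + c * ∫ x in D, g₂ x * partialDeriv i φ x := by
    rw [← integral_const_mul, ← integral_add (integrable_mul_of_memLp_two m1 hφ2')
      ((integrable_mul_of_memLp_two m2 hφ2').const_mul c)]
    congr 1; funext x; simp; ring
  have e2 : ∫ x in D, (g₁' + c • g₂') x * φ x =
      (∫ x in D, g₁' x * φ x) + c * ∫ x in D, g₂' x * φ x := by
    rw [← integral_const_mul, ← integral_add (integrable_mul_of_memLp_two m1' hφ2)
      ((integrable_mul_of_memLp_two m2' hφ2).const_mul c)]
    congr 1; funext x; simp; ring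
  rw [e1, e2, h1 φ hφ, h2 φ hφ]
  ring

theorem setIntegral_eq_of_eq_zero_off {f : Plane → ℝ} (hD : MeasurableSet D)
    (h : D' ⊆ D) (hf : ∀ x, x ∉ D' → f x = 0) : ∫ x in D, f x = ∫ x in D', f x := by
  exact setIntegral_eq_of_subset_of_forall_sdiff_eq_zero hD h fun x hx => hf x hx.2

theorem IsWeakPartial.mono (h : IsWeakPartial D i g g') (hD : MeasurableSet D) (hs : D' ⊆ D) :
    IsWeakPartial D' i g g' := by
  intro φ hφ
  have := h φ (hφ.mono hs)
  rwa [setIntegral_eq_of_eq_zero_off hD hs fun x hx => by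
      rw [hφ.partialDeriv_eq_zero_of_notMem i hx, mul_zero],
    setIntegral_eq_of_eq_zero_off hD hs fun x hx => by
      rw [hφ.eq_zero_of_notMem hx, mul_zero]] at this

/-- Fundamental lemma of the calculus of variations, applied to `g₁' - g₂'`. Every rule for the
chosen function `weakPartial` is derived from this uniqueness. -/
theorem IsWeakPartial.ae_unique (hD : IsOpen D) (h1 : IsWeakPartial D i g g₁')
    (h2 : IsWeakPartial D i g g₂') (m1 : MemLp g₁' 2 (volume.restrict D))
    (m2 : MemLp g₂' 2 (volume.restrict D)) : g₁' =ᵐ[volume.restrict D] g₂' := by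
  have key : ∀ᵐ x ∂(volume : Measure Plane), x ∈ D → (g₁' - g₂') x = 0 := by
    refine hD.ae_eq_zero_of_integral_contDiff_smul_eq_zero ?_ ?_
    · have : LocallyIntegrable (g₁' - g₂') (volume.restrict D) :=
        (m1.sub m2).locallyIntegrable (by norm_num)
      exact locallyIntegrableOn_of_locallyIntegrable_restrict this
    · intro φ h h' h''
      have hφ : IsTestFunction D φ := ⟨h, h', h''⟩
      have e : ∫ x, φ x • (g₁' - g₂') x = ∫ x in D, φ x • (g₁' - g₂') x :=
        (setIntegral_eq_integral_of_forall_compl_eq_zero fun x hx => by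
          rw [hφ.eq_zero_of_notMem hx, zero_smul]).symm
      have hφ2 := hφ.memLp (volume.restrict D) 2
      have e' : ∫ x in D, φ x • (g₁' - g₂') x =
          (∫ x in D, g₁' x * φ x) - ∫ x in D, g₂' x * φ x := by
        rw [← integral_sub (integrable_mul_of_memLp_two m1 hφ2)
          (integrable_mul_of_memLp_two m2 hφ2)]
        congr 1; funext x; simp; ring
      have a1 := h1 φ hφ
      have a2 := h2 φ hφ
      rw [e, e']
      linarith
  rw [Filter.EventuallyEq, ae_restrict_iff' hD.measurableSet]
  filter_upwards [key] with x hx hxD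
  have := hx hxD
  simp only [Pi.sub_apply] at this
  linarith

theorem HasL2Partial.memLp_weakPartial (h : HasL2Partial D i g) :
    MemLp (weakPartial D i g) 2 (volume.restrict D) := by
  rw [weakPartial, dif_pos h]; exact h.choose_spec.1

theorem HasL2Partial.isWeakPartial (h : HasL2Partial D i g) :
    IsWeakPartial D i g (weakPartial D i g) := by
  rw [weakPartial, dif_pos h]; exact h.choose_spec.2

theorem IsWeakPartial.weakPartial_ae_eq (hD : IsOpen D) (h : IsWeakPartial D i g g')
    (m : MemLp g' 2 (volume.restrict D)) : weakPartial D i g =ᵐ[volume.restrict D] g' :=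
  have h' : HasL2Partial D i g := ⟨g', m, h⟩
  h'.isWeakPartial.ae_unique hD h h'.memLp_weakPartial m

theorem HasL2Partial.congr (h : HasL2Partial D i g) (e : g =ᵐ[volume.restrict D] g₁) :
    HasL2Partial D i g₁ :=
  ⟨_, h.memLp_weakPartial, h.isWeakPartial.congr e (ae_eq_refl _)⟩

theorem HasL2Partial.weakPartial_congr (hD : IsOpen D) (h : HasL2Partial D i g)
    (e : g =ᵐ[volume.restrict D] g₁) :
    weakPartial D i g₁ =ᵐ[volume.restrict D] weakPartial D i g :=
  (h.isWeakPartial.congr e (ae_eq_refl _)).weakPartial_ae_eq hD h.memLp_weakPartial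

theorem HasL2Partial.mono (hD : MeasurableSet D) (hs : D' ⊆ D) (h : HasL2Partial D i g) :
    HasL2Partial D' i g :=
  ⟨_, h.memLp_weakPartial.mono_measure (Measure.restrict_mono hs le_rfl),
    h.isWeakPartial.mono hD hs⟩

theorem HasL2Partial.weakPartial_mono (hD : IsOpen D) (hD' : IsOpen D') (hs : D' ⊆ D)
    (h : HasL2Partial D i g) :
    weakPartial D' i g =ᵐ[volume.restrict D'] weakPartial D i g :=
  (h.isWeakPartial.mono hD.measurableSet hs).weakPartial_ae_eq hD'
    (h.memLp_weakPartial.mono_measure (Measure.restrict_mono hs le_rfl))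

end WeakPartial

/-! ### `H¹` and `H²` -/

section Sobolev

variable {D D' : Set Plane} {i : Fin 2} {g g₁ g₂ : Plane → ℝ}

theorem MemH1.add_smul (h1 : MemH1 D g₁) (h2 : MemH1 D g₂) (c : ℝ) : MemH1 D (g₁ + c • g₂) :=
  ⟨h1.1.add (h2.1.const_smul c), fun i =>
    ⟨_, (h1.2 i).memLp_weakPartial.add ((h2.2 i).memLp_weakPartial.const_smul c),
      (h1.2 i).isWeakPartial.add_smul (h2.2 i).isWeakPartial h1.1 h2.1
        (h1.2 i).memLp_weakPartial (h2.2 i).memLp_weakPartial c⟩⟩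

theorem MemH1.weakPartial_add_smul (hD : IsOpen D) (h1 : MemH1 D g₁) (h2 : MemH1 D g₂) (c : ℝ)
    (i : Fin 2) : weakPartial D i (g₁ + c • g₂) =ᵐ[volume.restrict D]
      weakPartial D i g₁ + c • weakPartial D i g₂ :=
  ((h1.2 i).isWeakPartial.add_smul (h2.2 i).isWeakPartial h1.1 h2.1
    (h1.2 i).memLp_weakPartial (h2.2 i).memLp_weakPartial c).weakPartial_ae_eq hD
    ((h1.2 i).memLp_weakPartial.add ((h2.2 i).memLp_weakPartial.const_smul c))

theorem MemH1.congr (h : MemH1 D g) (e : g =ᵐ[volume.restrict D] g₁) : MemH1 D g₁ :=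
  ⟨(memLp_congr_ae e).1 h.1, fun i => (h.2 i).congr e⟩

theorem MemH1.mono (hD : MeasurableSet D) (hs : D' ⊆ D) (h : MemH1 D g) : MemH1 D' g :=
  ⟨h.1.mono_measure (Measure.restrict_mono hs le_rfl), fun i => (h.2 i).mono hD hs⟩

theorem MemH2.congr (hD : IsOpen D) (h : MemH2 D g) (e : g =ᵐ[volume.restrict D] g₁) :
    MemH2 D g₁ :=
  ⟨h.1.congr e, fun i => (h.2 i).congr ((h.1.2 i).weakPartial_congr hD e).symm⟩

theorem MemH2.add_smul (hD : IsOpen D) (h1 : MemH2 D g₁) (h2 : MemH2 D g₂) (c : ℝ) :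
    MemH2 D (g₁ + c • g₂) :=
  ⟨h1.1.add_smul h2.1 c, fun i => ((h1.2 i).add_smul (h2.2 i) c).congr
    (h1.1.weakPartial_add_smul hD h2.1 c i).symm⟩

theorem MemH2.mono (hD : IsOpen D) (hD' : IsOpen D') (hs : D' ⊆ D) (h : MemH2 D g) :
    MemH2 D' g :=
  ⟨h.1.mono hD.measurableSet hs, fun i => ((h.2 i).mono hD.measurableSet hs).congr
    ((h.1.2 i).weakPartial_mono hD hD' hs).symm⟩

/-- Integration by parts on the whole plane; the test function vanishes off `D`, so no boundary of
`D` enters. -/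
theorem isWeakPartial_of_contDiff {φ : Plane → ℝ} (hφ : ContDiff ℝ ∞ φ) (i : Fin 2) :
    IsWeakPartial D i φ (partialDeriv i φ) := by
  intro ψ hψ
  have e1 : ∫ x in D, φ x * partialDeriv i ψ x = ∫ x, φ x * partialDeriv i ψ x :=
    setIntegral_eq_integral_of_forall_compl_eq_zero fun x hx => by
      rw [hψ.partialDeriv_eq_zero_of_notMem i hx, mul_zero]
  have e2 : ∫ x in D, partialDeriv i φ x * ψ x = ∫ x, partialDeriv i φ x * ψ x :=
    setIntegral_eq_integral_of_forall_compl_eq_zero fun x hx => by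
      rw [hψ.eq_zero_of_notMem hx, mul_zero]
  rw [e1, e2]
  have c1 := hφ.continuous
  have c2 := continuous_partialDeriv hφ i
  have c3 := hψ.1.continuous
  have c4 := continuous_partialDeriv hψ.1 i
  refine integral_mul_fderiv_eq_neg_fderiv_mul_of_integrable ?_ ?_ ?_ ?_ ?_
  · exact (c2.mul c3).integrable_of_hasCompactSupport hψ.2.1.mul_left
  · exact (c1.mul c4).integrable_of_hasCompactSupport
      (hψ.hasCompactSupport_partialDeriv i).mul_left
  · exact (c1.mul c3).integrable_of_hasCompactSupport hψ.2.1.mul_left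
  · exact fun x _ => hφ.differentiable (by simp) x
  · exact fun x _ => hψ.1.differentiable (by simp) x

/-- The measure is arbitrary because the lemma serves both area on domains and arc length on
segments. -/
theorem memLp_restrict_of_continuous {φ : Plane → ℝ} (hφ : Continuous φ) {μ : Measure Plane}
    {s : Set Plane} (hb : Bornology.IsBounded s) (hμ : μ s ≠ ⊤) (p : ℝ≥0∞) :
    MemLp φ p (μ.restrict s) := by
  have : IsFiniteMeasure (μ.restrict s) := ⟨by simpa using hμ.lt_top⟩
  obtain ⟨C, hC⟩ := hb.isCompact_closure.exists_bound_of_continuousOn hφ.continuousOn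
  have hall : ∀ᵐ x ∂(μ.restrict (closure s)), ‖φ x‖ ≤ C :=
    ae_restrict_of_forall_mem isClosed_closure.measurableSet hC
  exact MemLp.of_bound hφ.aestronglyMeasurable C
    (ae_mono (Measure.restrict_mono subset_closure le_rfl) hall)

theorem memH1_of_contDiff {φ : Plane → ℝ} (hφ : ContDiff ℝ ∞ φ)
    (hb : Bornology.IsBounded D) : MemH1 D φ :=
  ⟨memLp_restrict_of_continuous hφ.continuous hb hb.measure_lt_top.ne 2, fun i =>
    ⟨_, memLp_restrict_of_continuous (continuous_partialDeriv hφ i) hb hb.measure_lt_top.ne 2,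
      isWeakPartial_of_contDiff hφ i⟩⟩

theorem weakPartial_of_contDiff {φ : Plane → ℝ} (hφ : ContDiff ℝ ∞ φ) (hD : IsOpen D)
    (hb : Bornology.IsBounded D) (i : Fin 2) :
    weakPartial D i φ =ᵐ[volume.restrict D] partialDeriv i φ :=
  (isWeakPartial_of_contDiff hφ i).weakPartial_ae_eq hD
    (memLp_restrict_of_continuous (continuous_partialDeriv hφ i) hb hb.measure_lt_top.ne 2)

end Sobolev

/-! ### Integrals over line segments and triangles -/

theorem isometry_line {e : Plane} (he : ‖e‖ = 1) (p : Plane) :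
    Isometry fun s : ℝ => p + s • e := by
  refine Isometry.of_dist_eq fun s t => ?_
  rw [dist_add_left, dist_eq_norm, ← sub_smul, norm_smul, he, mul_one, Real.dist_eq,
    Real.norm_eq_abs]

theorem segment_eq_image_line {e : Plane} (p : Plane) {L : ℝ} (hL : 0 ≤ L) :
    segment ℝ p (p + L • e) = (fun s : ℝ => p + s • e) '' Set.Icc 0 L := by
  rw [segment_eq_image']
  ext x
  simp only [Set.mem_image, Set.mem_Icc, add_sub_cancel_left]
  constructor
  · rintro ⟨θ, ⟨h0, h1⟩, rfl⟩
    exact ⟨θ * L, ⟨by positivity, by nlinarith⟩, by rw [mul_smul]⟩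
  · rintro ⟨s, ⟨h0, h1⟩, rfl⟩
    rcases hL.eq_or_lt with rfl | hL
    · exact ⟨0, by simp, by simp [le_antisymm h1 h0]⟩
    · exact ⟨s / L, ⟨by positivity, (div_le_one hL).2 h1⟩, by
        rw [smul_smul, div_mul_cancel₀ _ hL.ne']⟩

/-- A unit-speed line is an isometric embedding of `ℝ`, and isometries carry the one-dimensional
Hausdorff measure, which is Lebesgue measure on `ℝ`, to that of the image. -/
theorem setLIntegral_segment {e : Plane} (he : ‖e‖ = 1) (p : Plane) {L : ℝ} (hL : 0 ≤ L)
    (f : Plane → ℝ≥0∞) :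
    ∫⁻ x in segment ℝ p (p + L • e), f x ∂(μH[1] : Measure Plane) =
      ∫⁻ s in Set.Icc 0 L, f (p + s • e) := by
  have hi := isometry_line he p
  have hm : MeasurableEmbedding fun s : ℝ => p + s • e := hi.isClosedEmbedding.measurableEmbedding
  have hsub : segment ℝ p (p + L • e) ⊆ Set.range fun s : ℝ => p + s • e := by
    rw [segment_eq_image_line p hL]; exact Set.image_subset_range _ _
  have hmap := hi.map_hausdorffMeasure (d := 1) (Or.inl zero_le_one)
  rw [← Measure.restrict_restrict_of_subset hsub, ← hmap, hm.restrict_map, hm.lintegral_map,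
    hausdorffMeasure_real, segment_eq_image_line p hL, Set.preimage_image_eq _ hi.injective]

/-- The Jacobian of the base direction `e` and the vector from the apex `c` to `p`: the
signed distance of `c` from the line through `p` with unit direction `e`. -/
noncomputable def lineDist (c p e : Plane) : ℝ := e 0 * (p 1 - c 1) - e 1 * (p 0 - c 0)

/-- The polar-type parametrisation of the triangle with apex `c` and base on the line through `p`
with direction `e`. -/
noncomputable def coneMap (c p e : Plane) (z : Plane) : Plane := c + z 1 • (p - c + z 0 • e)

/-- The open triangle with apex `c` and base from `p` to `p + L • e`. -/
noncomputable def openTriangle (c p e : Plane) (L : ℝ) : Set Plane :=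
  coneMap c p e '' {z | z 0 ∈ Set.Ioo 0 L ∧ z 1 ∈ Set.Ioo (0 : ℝ) 1}

/-- The derivative of `coneMap`. -/
noncomputable def coneMapDeriv (c p e : Plane) (z : Plane) : Plane →L[ℝ] Plane :=
  z 1 • (EuclideanSpace.proj (0 : Fin 2) : Plane →L[ℝ] ℝ).smulRight e +
    (EuclideanSpace.proj (1 : Fin 2) : Plane →L[ℝ] ℝ).smulRight (p - c + z 0 • e)

theorem hasFDerivAt_coneMap (c p e z : Plane) :
    HasFDerivAt (coneMap c p e) (coneMapDeriv c p e z) z := by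
  have h0 : HasFDerivAt (fun z : Plane => z 0) (EuclideanSpace.proj (0 : Fin 2) : Plane →L[ℝ] ℝ) z :=
    (EuclideanSpace.proj (0 : Fin 2) : Plane →L[ℝ] ℝ).hasFDerivAt
  have h1 : HasFDerivAt (fun z : Plane => z 1) (EuclideanSpace.proj (1 : Fin 2) : Plane →L[ℝ] ℝ) z :=
    (EuclideanSpace.proj (1 : Fin 2) : Plane →L[ℝ] ℝ).hasFDerivAt
  have h2 := (h0.smul_const e).const_add (p - c)
  exact (h1.fun_smul h2).const_add c

theorem det_coneMapDeriv (c p e z : Plane) :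
    (coneMapDeriv c p e z).det = z 1 * lineDist c p e := by
  rw [ContinuousLinearMap.det,
    ← LinearMap.det_toMatrix (EuclideanSpace.basisFun (Fin 2) ℝ).toBasis, Matrix.det_fin_two]
  simp [LinearMap.toMatrix_apply, coneMapDeriv, lineDist]
  ring

theorem injOn_coneMap {c p e : Plane} (h : lineDist c p e ≠ 0) (L : ℝ) :
    Set.InjOn (coneMap c p e) {z | z 0 ∈ Set.Ioo 0 L ∧ z 1 ∈ Set.Ioo (0 : ℝ) 1} := by
  rintro z ⟨-, hz1, -⟩ w ⟨-, hw1, -⟩ hzw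
  have e0 := congrArg (fun x : Plane => x 0) hzw
  have e1 := congrArg (fun x : Plane => x 1) hzw
  simp only [coneMap, PiLp.add_apply, PiLp.smul_apply, PiLp.sub_apply, smul_eq_mul] at e0 e1
  -- The cross product with `e` removes the component along the base and leaves the radial parameter
  -- alone.
  have k1 : (z 1 - w 1) * lineDist c p e = 0 := by
    unfold lineDist; linear_combination e 0 * e1 - e 1 * e0
  have hz : z 1 = w 1 := by
    have := (mul_eq_zero.1 k1).resolve_right h
    linarith
  rw [hz] at e0 e1
  have f0 : (z 0 - w 0) * e 0 = 0 := by
    have : w 1 * ((z 0 - w 0) * e 0) = 0 := by linear_combination e0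
    exact (mul_eq_zero.1 this).resolve_left hw1.ne'
  have f1 : (z 0 - w 0) * e 1 = 0 := by
    have : w 1 * ((z 0 - w 0) * e 1) = 0 := by linear_combination e1
    exact (mul_eq_zero.1 this).resolve_left hw1.ne'
  have hz0 : z 0 = w 0 := by
    by_contra hne
    have hne' : z 0 - w 0 ≠ 0 := sub_ne_zero.2 hne
    exact h (by
      rw [lineDist, (mul_eq_zero.1 f0).resolve_left hne', (mul_eq_zero.1 f1).resolve_left hne']
      ring)
  ext i
  fin_cases i
  · exact hz0
  · exact hz

/-- Change of variables by `coneMap` followed by Tonelli. The Jacobian contributes the factor `t`,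
which the estimate along each ray has to carry as a weight. -/
theorem setLIntegral_openTriangle {c p e : Plane} (h : lineDist c p e ≠ 0) (L : ℝ)
    {F : Plane → ℝ≥0∞} (hF : Measurable F) :
    ∫⁻ x in openTriangle c p e L, F x =
      ∫⁻ s in Set.Ioo 0 L, ∫⁻ t in Set.Ioo (0 : ℝ) 1,
        ENNReal.ofReal (t * |lineDist c p e|) * F (c + t • (p + s • e - c)) := by
  let Φ : Plane ≃ᵐ ℝ × ℝ := (MeasurableEquiv.toLp 2 (Fin 2 → ℝ)).symm.trans
    MeasurableEquiv.finTwoArrow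
  have hΦ : MeasurePreserving Φ volume volume :=
    (EuclideanSpace.volume_preserving_symm_measurableEquiv_toLp (Fin 2)).trans
      (volume_preserving_finTwoArrow ℝ)
  have hΦ0 : ∀ z : Plane, Φ z = (z 0, z 1) := fun z => rfl
  let G : ℝ × ℝ → ℝ≥0∞ := fun y =>
    ENNReal.ofReal (y.2 * |lineDist c p e|) * F (c + y.2 • (p + y.1 • e - c))
  have hG : Measurable G := by
    refine Measurable.mul (by fun_prop) (hF.comp ?_)
    have : Continuous fun y : ℝ × ℝ => c + y.2 • (p + y.1 • e - c) := by fun_prop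
    exact this.measurable
  have hbox : {z : Plane | z 0 ∈ Set.Ioo 0 L ∧ z 1 ∈ Set.Ioo (0 : ℝ) 1} =
      Φ ⁻¹' (Set.Ioo 0 L ×ˢ Set.Ioo (0 : ℝ) 1) := by
    ext z; simp [hΦ0]
  have hmeas : MeasurableSet {z : Plane | z 0 ∈ Set.Ioo 0 L ∧ z 1 ∈ Set.Ioo (0 : ℝ) 1} := by
    rw [hbox]; exact Φ.measurable (measurableSet_Ioo.prod measurableSet_Ioo)
  rw [openTriangle, lintegral_image_eq_lintegral_abs_det_fderiv_mul volume hmeas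
    (fun z _ => (hasFDerivAt_coneMap c p e z).hasFDerivWithinAt) (injOn_coneMap h L)]
  have e1 : ∀ z ∈ {z : Plane | z 0 ∈ Set.Ioo 0 L ∧ z 1 ∈ Set.Ioo (0 : ℝ) 1},
      ENNReal.ofReal |(coneMapDeriv c p e z).det| * F (coneMap c p e z) = G (Φ z) := by
    rintro z ⟨-, hz, -⟩
    simp only [G, hΦ0, det_coneMapDeriv, abs_mul, abs_of_pos hz, coneMap]
    congr 4
    abel
  rw [setLIntegral_congr_fun hmeas e1, hbox,
    hΦ.setLIntegral_comp_preimage_emb Φ.measurableEmbedding, Measure.volume_eq_prod,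
    setLIntegral_prod _ hG.aemeasurable]

/-! ### The trace inequality on a triangle -/

theorem fderiv_apply_eq (φ : Plane → ℝ) (x v : Plane) :
    fderiv ℝ φ x v = v 0 * partialDeriv 0 φ x + v 1 * partialDeriv 1 φ x := by
  have : v = v 0 • EuclideanSpace.single 0 (1 : ℝ) + v 1 • EuclideanSpace.single 1 (1 : ℝ) := by
    ext i; fin_cases i <;> simp
  conv_lhs => rw [this]
  simp only [map_add, map_smul, partialDeriv, smul_eq_mul]

/-- The integrand `3 φ² + H² |∇φ|²` of the trace inequality. -/
noncomputable def traceIntegrand (φ : Plane → ℝ) (H : ℝ) (x : Plane) : ℝ :=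
  3 * φ x ^ 2 + H ^ 2 * ∑ i, partialDeriv i φ x ^ 2

theorem continuous_traceIntegrand {φ : Plane → ℝ} (hφ : ContDiff ℝ ∞ φ) (H : ℝ) :
    Continuous (traceIntegrand φ H) := by
  have := hφ.continuous
  have := fun i => continuous_partialDeriv hφ i
  unfold traceIntegrand
  fun_prop

theorem traceIntegrand_nonneg (φ : Plane → ℝ) (H : ℝ) (x : Plane) : 0 ≤ traceIntegrand φ H x := by
  unfold traceIntegrand
  positivity

/-- Integrate the derivative of `t² φ²` along the ray from `c` to `y`. The factor `t²` removes the
contribution of the apex, and its derivative produces the weight `t` of the polar Jacobian. -/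
theorem sq_le_integral_traceIntegrand {φ : Plane → ℝ} (hφ : ContDiff ℝ ∞ φ) {c y : Plane} {H : ℝ}
    (hy : ‖y - c‖ ≤ H) :
    φ y ^ 2 ≤ ∫ t in (0 : ℝ)..1, t * traceIntegrand φ H (c + t • (y - c)) := by
  have hline : Continuous fun t : ℝ => c + t • (y - c) := by fun_prop
  have cG := (continuous_traceIntegrand hφ H).comp hline
  have cφ := hφ.continuous.comp hline
  have cd : Continuous fun t : ℝ => fderiv ℝ φ (c + t • (y - c)) (y - c) :=
    ((hφ.continuous_fderiv (by simp)).comp hline).clm_apply continuous_const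
  have hder : ∀ t : ℝ, HasDerivAt (fun t : ℝ => t ^ 2 * φ (c + t • (y - c)) ^ 2)
      (2 * t * φ (c + t • (y - c)) ^ 2 + t ^ 2 * (2 * φ (c + t • (y - c)) *
        fderiv ℝ φ (c + t • (y - c)) (y - c))) t := by
    intro t
    have h1 : HasDerivAt (fun t : ℝ => c + t • (y - c)) (y - c) t := by
      simpa using ((hasDerivAt_id t).smul_const (y - c)).const_add c
    have h2 := ((hφ.differentiable (by simp)) (c + t • (y - c))).hasFDerivAt.comp_hasDerivAt t h1
    have h3 := (hasDerivAt_pow 2 t).mul (h2.pow 2)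
    exact h3.congr_deriv (by simp)
  have hcont : Continuous fun t : ℝ => (2 * t * φ (c + t • (y - c)) ^ 2 + t ^ 2 *
      (2 * φ (c + t • (y - c)) * fderiv ℝ φ (c + t • (y - c)) (y - c))) := by
    simp only [Function.comp_def] at cφ
    fun_prop
  have ftc := intervalIntegral.integral_eq_sub_of_hasDerivAt (a := 0) (b := 1)
    (fun t _ => hder t) (hcont.intervalIntegrable 0 1)
  have e : φ y ^ 2 = (1 : ℝ) ^ 2 * φ (c + (1 : ℝ) • (y - c)) ^ 2 -
      (0 : ℝ) ^ 2 * φ (c + (0 : ℝ) • (y - c)) ^ 2 := by simp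
  rw [e, ← ftc]
  have cG' : Continuous fun t : ℝ => t * traceIntegrand φ H (c + t • (y - c)) :=
    continuous_id.mul cG
  refine intervalIntegral.integral_mono_on zero_le_one (hcont.intervalIntegrable 0 1)
    (cG'.intervalIntegrable 0 1) fun t ht => ?_
  set x := c + t • (y - c)
  have hH : (y - c) 0 ^ 2 + (y - c) 1 ^ 2 ≤ H ^ 2 := by
    have := EuclideanSpace.real_norm_sq_eq (y - c)
    rw [Fin.sum_univ_two] at this
    rw [← this]
    exact pow_le_pow_left₀ (norm_nonneg _) hy 2
  -- Cauchy-Schwarz in the plane, with Lagrange's identity supplying the missing square.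
  have hd : (fderiv ℝ φ x (y - c)) ^ 2 ≤
      H ^ 2 * (partialDeriv 0 φ x ^ 2 + partialDeriv 1 φ x ^ 2) := by
    rw [fderiv_apply_eq]
    have h1 : 0 ≤ partialDeriv 0 φ x ^ 2 + partialDeriv 1 φ x ^ 2 := by positivity
    nlinarith [mul_le_mul_of_nonneg_right hH h1,
      sq_nonneg ((y - c) 0 * partialDeriv 1 φ x - (y - c) 1 * partialDeriv 0 φ x)]
  have hab : 2 * φ x * fderiv ℝ φ x (y - c) ≤ φ x ^ 2 + (fderiv ℝ φ x (y - c)) ^ 2 := by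
    nlinarith [sq_nonneg (φ x - fderiv ℝ φ x (y - c))]
  rw [traceIntegrand, Fin.sum_univ_two]
  have t2 : t ^ 2 ≤ t := by nlinarith [ht.1, ht.2]
  have hpos : 0 ≤ φ x ^ 2 + H ^ 2 * (partialDeriv 0 φ x ^ 2 + partialDeriv 1 φ x ^ 2) := by
    positivity
  calc _ ≤ 2 * t * φ x ^ 2 + t ^ 2 * (φ x ^ 2 +
        H ^ 2 * (partialDeriv 0 φ x ^ 2 + partialDeriv 1 φ x ^ 2)) := by
        gcongr; linarith
    _ ≤ 2 * t * φ x ^ 2 + t * (φ x ^ 2 +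
        H ^ 2 * (partialDeriv 0 φ x ^ 2 + partialDeriv 1 φ x ^ 2)) := by gcongr
    _ = _ := by ring

theorem ofReal_sq_le_setLIntegral {φ : Plane → ℝ} (hφ : ContDiff ℝ ∞ φ) {c y : Plane} {H : ℝ}
    (hy : ‖y - c‖ ≤ H) :
    ENNReal.ofReal (φ y ^ 2) ≤ ∫⁻ t in Set.Ioo (0 : ℝ) 1,
      ENNReal.ofReal (t * traceIntegrand φ H (c + t • (y - c))) := by
  have hline : Continuous fun t : ℝ => c + t • (y - c) := by fun_prop
  have cG : Continuous fun t : ℝ => t * traceIntegrand φ H (c + t • (y - c)) :=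
    continuous_id.mul ((continuous_traceIntegrand hφ H).comp hline)
  have h := sq_le_integral_traceIntegrand hφ hy
  rw [intervalIntegral.integral_of_le zero_le_one, integral_Ioc_eq_integral_Ioo] at h
  rw [← ofReal_integral_eq_lintegral_ofReal]
  · exact ENNReal.ofReal_le_ofReal h
  · exact (cG.integrableOn_Icc (a := 0) (b := 1)).mono_set Set.Ioo_subset_Icc_self
  · exact ae_restrict_of_forall_mem measurableSet_Ioo fun t ht =>
      mul_nonneg ht.1.le (traceIntegrand_nonneg _ _ _)

/-- The ray estimate is integrated over the base; the weight `t` and the height `|lineDist c p e|`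
together are the Jacobian, so the right-hand side becomes an area integral. -/
theorem trace_inequality_lintegral {φ : Plane → ℝ} (hφ : ContDiff ℝ ∞ φ) {c p e : Plane}
    {L H : ℝ} (he : ‖e‖ = 1) (hL : 0 ≤ L) (hd : lineDist c p e ≠ 0)
    (hH : ∀ s ∈ Set.Ioo 0 L, ‖p + s • e - c‖ ≤ H) :
    ENNReal.ofReal |lineDist c p e| *
      ∫⁻ x in segment ℝ p (p + L • e), ENNReal.ofReal (φ x ^ 2) ∂(μH[1] : Measure Plane) ≤
      ∫⁻ x in openTriangle c p e L, ENNReal.ofReal (traceIntegrand φ H x) := by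
  have hG : Measurable fun x => ENNReal.ofReal (traceIntegrand φ H x) :=
    (continuous_traceIntegrand hφ H).measurable.ennreal_ofReal
  rw [setLIntegral_segment he p hL, setLIntegral_openTriangle hd L hG,
    ← lintegral_const_mul' _ _ ENNReal.ofReal_ne_top,
    setLIntegral_congr (Ioo_ae_eq_Icc (a := (0 : ℝ)) (b := L)).symm]
  refine setLIntegral_mono' measurableSet_Ioo fun s hs => ?_
  calc _ ≤ ENNReal.ofReal |lineDist c p e| * ∫⁻ t in Set.Ioo (0 : ℝ) 1,
          ENNReal.ofReal (t * traceIntegrand φ H (c + t • (p + s • e - c))) := by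
        gcongr; exact ofReal_sq_le_setLIntegral hφ (hH s hs)
    _ = _ := by
        rw [← lintegral_const_mul' _ _ ENNReal.ofReal_ne_top]
        refine setLIntegral_congr_fun measurableSet_Ioo fun t ht => ?_
        rw [← ENNReal.ofReal_mul (abs_nonneg _), ← ENNReal.ofReal_mul
          (mul_nonneg ht.1.le (abs_nonneg _))]
        congr 1; ring

/-! ### Trace bounds -/

theorem eLpNorm_two_sq {α : Type*} [MeasurableSpace α] (f : α → ℝ) (μ : Measure α) :
    eLpNorm f 2 μ ^ 2 = ∫⁻ x, ENNReal.ofReal (f x ^ 2) ∂μ := by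
  have := eLpNorm_nnreal_pow_eq_lintegral (μ := μ) (f := f) (p := 2) (by norm_num)
  norm_num at this
  rw [this]
  refine lintegral_congr fun x => ?_
  rw [← ofReal_norm, ← ENNReal.ofReal_pow (norm_nonneg _), Real.norm_eq_abs, sq_abs]

/-- The estimate `‖φ‖²_s ≤ A ‖φ‖²_D + B |φ|²_{1,D}` for smooth functions. -/
def TraceBound (D s : Set Plane) (A B : ℝ≥0∞) : Prop :=
  ∀ φ : Plane → ℝ, ContDiff ℝ ∞ φ →
    eLpNorm φ 2 ((μH[1] : Measure Plane).restrict s) ^ 2 ≤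
      A * eLpNorm φ 2 (volume.restrict D) ^ 2 +
        B * ∑ i, eLpNorm (partialDeriv i φ) 2 (volume.restrict D) ^ 2

namespace TraceBound

variable {D D' s s' : Set Plane} {A B A' B' : ℝ≥0∞}

theorem mono_set (h : TraceBound D s A B) (hs : s' ⊆ s) : TraceBound D s' A B := fun φ hφ =>
  (pow_le_pow_left₀ (by simp) (eLpNorm_mono_measure φ (Measure.restrict_mono hs le_rfl)) 2).trans
    (h φ hφ)

theorem mono_domain (h : TraceBound D' s A B) (hD : D' ⊆ D) : TraceBound D s A B := fun φ hφ =>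
  (h φ hφ).trans (by gcongr)

theorem of_null (h : (μH[1] : Measure Plane) s = 0) : TraceBound D s 0 0 := fun φ _ => by
  rw [Measure.restrict_eq_zero.2 h]; simp

theorem union (h : TraceBound D s A B) (h' : TraceBound D s' A' B') :
    TraceBound D (s ∪ s') (A + A') (B + B') := fun φ hφ => by
  have h1 := h φ hφ
  have h2 := h' φ hφ
  have : eLpNorm φ 2 ((μH[1] : Measure Plane).restrict (s ∪ s')) ^ 2 ≤
      eLpNorm φ 2 ((μH[1] : Measure Plane).restrict s) ^ 2 +
        eLpNorm φ 2 ((μH[1] : Measure Plane).restrict s') ^ 2 := by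
    simp only [eLpNorm_two_sq]
    exact lintegral_union_le _ _ _
  refine (this.trans (add_le_add h1 h2)).trans (le_of_eq ?_)
  ring

theorem biUnion_finset {β : Type*} (F : Finset β) (l : β → Set Plane)
    (h : ∀ j ∈ F, ∃ A B : ℝ≥0∞, A ≠ ⊤ ∧ B ≠ ⊤ ∧ TraceBound D (l j) A B) :
    ∃ A B : ℝ≥0∞, A ≠ ⊤ ∧ B ≠ ⊤ ∧ TraceBound D (⋃ j ∈ F, l j) A B := by
  classical
  induction F using Finset.induction_on with
  | empty => exact ⟨0, 0, by simp, by simp, of_null (by simp)⟩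
  | insert j F _ ih =>
    obtain ⟨A, B, hA, hB, hAB⟩ := h j (Finset.mem_insert_self _ _)
    obtain ⟨A', B', hA', hB', hAB'⟩ := ih fun k hk => h k (Finset.mem_insert_of_mem hk)
    refine ⟨A + A', B + B', ENNReal.add_ne_top.2 ⟨hA, hA'⟩, ENNReal.add_ne_top.2 ⟨hB, hB'⟩, ?_⟩
    rw [Finset.set_biUnion_insert]
    exact hAB.union hAB'

/-- Division of the trace inequality by the height. A lower bound `d` of the height suffices, so the
constants can be made independent of the exact position of the apex. -/
theorem of_triangle {c p e : Plane} {L H d : ℝ} (he : ‖e‖ = 1) (hL : 0 ≤ L) (hd : 0 < d)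
    (hcd : d ≤ |lineDist c p e|) (hH : ∀ s ∈ Set.Ioo 0 L, ‖p + s • e - c‖ ≤ H) :
    TraceBound (openTriangle c p e L) (segment ℝ p (p + L • e)) (ENNReal.ofReal (3 / d))
      (ENNReal.ofReal (H ^ 2 / d)) := by
  intro φ hφ
  have hne : lineDist c p e ≠ 0 := abs_pos.1 (hd.trans_le hcd)
  have key := trace_inequality_lintegral hφ he hL hne hH
  rw [← eLpNorm_two_sq] at key
  have hm : Measurable fun x => ENNReal.ofReal (φ x ^ 2) :=
    (hφ.continuous.pow 2).measurable.ennreal_ofReal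
  have hm' : ∀ i, Measurable fun x => ENNReal.ofReal (partialDeriv i φ x ^ 2) := fun i =>
    ((continuous_partialDeriv hφ i).pow 2).measurable.ennreal_ofReal
  have e1 : ∫⁻ x in openTriangle c p e L, ENNReal.ofReal (traceIntegrand φ H x) =
      ENNReal.ofReal 3 * eLpNorm φ 2 (volume.restrict (openTriangle c p e L)) ^ 2 +
        ENNReal.ofReal (H ^ 2) *
          ∑ i, eLpNorm (partialDeriv i φ) 2 (volume.restrict (openTriangle c p e L)) ^ 2 := by
    simp only [eLpNorm_two_sq]
    rw [← lintegral_finsetSum _ fun i _ => hm' i, ← lintegral_const_mul _ hm,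
      ← lintegral_const_mul _ (Finset.measurable_fun_sum _ fun i _ => hm' i),
      ← lintegral_add_left (hm.const_mul _)]
    refine lintegral_congr fun x => ?_
    rw [traceIntegrand, ENNReal.ofReal_add (by positivity) (by positivity),
      ENNReal.ofReal_mul (by norm_num), ENNReal.ofReal_mul (by positivity),
      ENNReal.ofReal_sum_of_nonneg fun i _ => sq_nonneg _]
  rw [e1] at key
  have hd0 : ENNReal.ofReal d ≠ 0 := by simpa using hd
  have key' := (mul_le_mul_left (ENNReal.ofReal_le_ofReal hcd) _).trans key
  rw [ENNReal.ofReal_div_of_pos hd, ENNReal.ofReal_div_of_pos hd]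
  calc _ = (ENNReal.ofReal d * eLpNorm φ 2 ((μH[1] : Measure Plane).restrict
        (segment ℝ p (p + L • e))) ^ 2) / ENNReal.ofReal d := by
        rw [mul_comm, ENNReal.mul_div_cancel_right hd0 ENNReal.ofReal_ne_top]
    _ ≤ _ := ENNReal.div_le_div_right key' _
    _ = _ := by simp only [div_eq_mul_inv]; ring

end TraceBound

/-! ### Traces -/

theorem tendsto_eLpNorm_of_tendsto_sub {α : Type*} [MeasurableSpace α] {μ : Measure α}
    {φ : ℕ → α → ℝ} {g : α → ℝ} (hφ : ∀ n, AEStronglyMeasurable (φ n) μ) (hg : MemLp g 2 μ)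
    (h : Tendsto (fun n => eLpNorm (φ n - g) 2 μ) atTop (𝓝 0)) :
    Tendsto (fun n => eLpNorm (φ n) 2 μ) atTop (𝓝 (eLpNorm g 2 μ)) := by
  have hl : Tendsto (fun n => eLpNorm g 2 μ - eLpNorm (φ n - g) 2 μ) atTop
      (𝓝 (eLpNorm g 2 μ)) := by
    have := ENNReal.Tendsto.sub (tendsto_const_nhds (x := eLpNorm g 2 μ)) h (Or.inr (by simp))
    simpa using this
  have hu : Tendsto (fun n => eLpNorm g 2 μ + eLpNorm (φ n - g) 2 μ) atTop
      (𝓝 (eLpNorm g 2 μ)) := by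
    simpa using (tendsto_const_nhds (x := eLpNorm g 2 μ)).add h
  refine tendsto_of_tendsto_of_tendsto_of_le_of_le hl hu (fun n => ?_) fun n => ?_
  · rw [tsub_le_iff_right]
    have : g = φ n - (φ n - g) := by abel
    calc eLpNorm g 2 μ = eLpNorm (φ n - (φ n - g)) 2 μ := by rw [← this]
      _ ≤ _ := eLpNorm_sub_le (hφ n) ((hφ n).sub hg.1) (by norm_num)
  · have : φ n = g + (φ n - g) := by abel
    calc eLpNorm (φ n) 2 μ = eLpNorm (g + (φ n - g)) 2 μ := by rw [← this]
      _ ≤ _ := eLpNorm_add_le hg.1 ((hφ n).sub hg.1) (by norm_num)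

/-- The limit `k` is prescribed only almost everywhere because the chosen weak derivative of a
linear combination is known only in that sense. -/
theorem tendsto_eLpNorm_add_smul {α : Type*} [MeasurableSpace α] {μ : Measure α}
    {φ ψ : ℕ → α → ℝ} {f g k : α → ℝ} (hφ : ∀ n, AEStronglyMeasurable (φ n) μ)
    (hψ : ∀ n, AEStronglyMeasurable (ψ n) μ) (hf : AEStronglyMeasurable f μ)
    (hg : AEStronglyMeasurable g μ) (c : ℝ) (hk : k =ᵐ[μ] f + c • g)
    (h1 : Tendsto (fun n => eLpNorm (φ n - f) 2 μ) atTop (𝓝 0))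
    (h2 : Tendsto (fun n => eLpNorm (ψ n - g) 2 μ) atTop (𝓝 0)) :
    Tendsto (fun n => eLpNorm (φ n + c • ψ n - k) 2 μ) atTop (𝓝 0) := by
  have hu : Tendsto (fun n => eLpNorm (φ n - f) 2 μ + ‖c‖ₑ * eLpNorm (ψ n - g) 2 μ) atTop
      (𝓝 0) := by
    have := h1.add (ENNReal.Tendsto.const_mul h2 (Or.inr (enorm_ne_top (x := c))))
    simpa using this
  refine tendsto_of_tendsto_of_tendsto_of_le_of_le tendsto_const_nhds hu (fun _ => zero_le)
    fun n => ?_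
  have e : φ n + c • ψ n - k =ᵐ[μ] (φ n - f) + c • (ψ n - g) := by
    filter_upwards [hk] with x hx
    simp only [Pi.sub_apply, Pi.add_apply, Pi.smul_apply, hx, smul_eq_mul]
    ring
  rw [eLpNorm_congr_ae e]
  refine (eLpNorm_add_le ((hφ n).sub hf) (((hψ n).sub hg).const_smul c) (by norm_num)).trans ?_
  rw [eLpNorm_const_smul]

section Trace

variable {D s s' : Set Plane} {g g₁ g₂ τ τ₁ τ₂ : Plane → ℝ} {A B : ℝ≥0∞}

theorem IsTrace.mono (h : IsTrace D s g τ) (hs : s' ⊆ s) : IsTrace D s' g τ := by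
  obtain ⟨hτ, φ, h1, h2, h3, h4⟩ := h
  exact ⟨hτ.mono_measure (Measure.restrict_mono hs le_rfl), φ, h1, h2, h3,
    tendsto_of_tendsto_of_tendsto_of_le_of_le tendsto_const_nhds h4 (fun _ => zero_le)
      fun n => eLpNorm_mono_measure _ (Measure.restrict_mono hs le_rfl)⟩

/-- The inequality for the smooth approximants passes to the limit; finiteness of `A` and `B` makes
multiplication by them continuous in `ℝ≥0∞`. -/
theorem IsTrace.bound (h : IsTrace D s g τ) (hg : MemH1 D g) (hAB : TraceBound D s A B)
    (hA : A ≠ ⊤) (hB : B ≠ ⊤) :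
    eLpNorm τ 2 ((μH[1] : Measure Plane).restrict s) ^ 2 ≤
      A * eLpNorm g 2 (volume.restrict D) ^ 2 +
        B * ∑ i, eLpNorm (weakPartial D i g) 2 (volume.restrict D) ^ 2 := by
  obtain ⟨hτ, φ, h1, h2, h3, h4⟩ := h
  have t1 := tendsto_eLpNorm_of_tendsto_sub
    (fun n => (h1 n).continuous.aestronglyMeasurable) hτ h4
  have t2 := tendsto_eLpNorm_of_tendsto_sub
    (fun n => (h1 n).continuous.aestronglyMeasurable) hg.1 h2
  have t3 := fun i => tendsto_eLpNorm_of_tendsto_sub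
    (fun n => (continuous_partialDeriv (h1 n) i).aestronglyMeasurable)
    (hg.2 i).memLp_weakPartial (h3 i)
  refine le_of_tendsto_of_tendsto' (ENNReal.Tendsto.pow t1) ?_ fun n => hAB (φ n) (h1 n)
  exact (ENNReal.Tendsto.const_mul (ENNReal.Tendsto.pow t2) (Or.inr hA)).add
    (ENNReal.Tendsto.const_mul (tendsto_finsetSum _ fun i _ => ENNReal.Tendsto.pow (t3 i))
      (Or.inr hB))

theorem IsTrace.add_smul (hD : IsOpen D) (h1 : IsTrace D s g₁ τ₁) (h2 : IsTrace D s g₂ τ₂)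
    (m1 : MemH1 D g₁) (m2 : MemH1 D g₂) (c : ℝ) :
    IsTrace D s (g₁ + c • g₂) (τ₁ + c • τ₂) := by
  obtain ⟨hτ1, φ, a1, a2, a3, a4⟩ := h1
  obtain ⟨hτ2, ψ, b1, b2, b3, b4⟩ := h2
  have ma : ∀ n (μ : Measure Plane), AEStronglyMeasurable (φ n) μ :=
    fun n μ => (a1 n).continuous.aestronglyMeasurable
  have mb : ∀ n (μ : Measure Plane), AEStronglyMeasurable (ψ n) μ :=
    fun n μ => (b1 n).continuous.aestronglyMeasurable
  have ma' : ∀ n i (μ : Measure Plane), AEStronglyMeasurable (partialDeriv i (φ n)) μ :=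
    fun n i μ => (continuous_partialDeriv (a1 n) i).aestronglyMeasurable
  have mb' : ∀ n i (μ : Measure Plane), AEStronglyMeasurable (partialDeriv i (ψ n)) μ :=
    fun n i μ => (continuous_partialDeriv (b1 n) i).aestronglyMeasurable
  refine ⟨hτ1.add (hτ2.const_smul c), fun n => φ n + c • ψ n,
    fun n => (a1 n).add (contDiff_const.smul (b1 n)),
    tendsto_eLpNorm_add_smul (fun n => ma n _) (fun n => mb n _) m1.1.1 m2.1.1 c (ae_eq_refl _)
      a2 b2, fun i => ?_,
    tendsto_eLpNorm_add_smul (fun n => ma n _) (fun n => mb n _) hτ1.1 hτ2.1 c (ae_eq_refl _)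
      a4 b4⟩
  simp only [fun n => partialDeriv_add_smul (a1 n) (b1 n) c i]
  exact tendsto_eLpNorm_add_smul (fun n => ma' n i _) (fun n => mb' n i _)
    (m1.2 i).memLp_weakPartial.1 (m2.2 i).memLp_weakPartial.1 c
    (m1.weakPartial_add_smul hD m2 c i) (a3 i) (b3 i)

theorem IsTrace.congr (hD : IsOpen D) (h : IsTrace D s g₁ τ) (m : MemH1 D g₁)
    (e : g₁ =ᵐ[volume.restrict D] g₂) : IsTrace D s g₂ τ := by
  obtain ⟨hτ, φ, a1, a2, a3, a4⟩ := h
  refine ⟨hτ, φ, a1, ?_, fun i => ?_, a4⟩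
  · simpa only [eLpNorm_congr_ae ((ae_eq_refl (φ _)).sub e)] using a2
  · have e' := (m.2 i).weakPartial_congr hD e
    simpa only [eLpNorm_congr_ae ((ae_eq_refl (partialDeriv i (φ _))).sub e'.symm)] using a3 i

/-- The trace is unique almost everywhere wherever a trace bound holds. -/
theorem IsTrace.ae_unique (hD : IsOpen D) (h1 : IsTrace D s g τ₁) (h2 : IsTrace D s g τ₂)
    (m : MemH1 D g) (hAB : TraceBound D s A B) (hA : A ≠ ⊤) (hB : B ≠ ⊤) :
    τ₁ =ᵐ[(μH[1] : Measure Plane).restrict s] τ₂ := by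
  -- The difference of the two traces is a trace of `g - g = 0`, so the bound forces it to vanish.
  have h := (h1.add_smul hD h2 m m (-1)).bound (m.add_smul m (-1)) hAB hA hB
  have e0 : g + (-1 : ℝ) • g = 0 := by simp
  have z1 : eLpNorm (g + (-1 : ℝ) • g) 2 (volume.restrict D) = 0 := by rw [e0]; simp
  have z2 : ∀ i, eLpNorm (weakPartial D i (g + (-1 : ℝ) • g)) 2 (volume.restrict D) = 0 := by
    intro i
    rw [eLpNorm_congr_ae (m.weakPartial_add_smul hD m (-1) i)]
    simp
  simp only [z1, z2] at h
  have h0 : eLpNorm (τ₁ + (-1 : ℝ) • τ₂) 2 ((μH[1] : Measure Plane).restrict s) = 0 := by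
    simpa using h
  rw [eLpNorm_eq_zero_iff (h1.1.1.add (h2.1.1.const_smul _)) (by norm_num)] at h0
  filter_upwards [h0] with x hx
  simp only [Pi.add_apply, Pi.smul_apply, smul_eq_mul, Pi.zero_apply] at hx
  linarith

theorem isTrace_traceOn (h : ∃ τ, IsTrace D s g τ) : IsTrace D s g (traceOn D s g) := by
  rw [traceOn, dif_pos h]; exact h.choose_spec

/-- Existence of the trace is not needed: the default value `0` is also square integrable. -/
theorem memLp_traceOn (D s : Set Plane) (g : Plane → ℝ) :
    MemLp (traceOn D s g) 2 ((μH[1] : Measure Plane).restrict s) := by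
  by_cases h : ∃ τ, IsTrace D s g τ
  · exact (isTrace_traceOn h).1
  · rw [traceOn, dif_neg h]; exact MemLp.zero

end Trace

/-! ### Mollification combined with a contraction -/

/-- The average of `f` around `z` with the weight given by a bump function. -/
noncomputable def mollify (B : ContDiffBump (0 : Plane)) (f : Plane → ℝ) (z : Plane) : ℝ :=
  ∫ y, B.normed volume y * f (z - y)

theorem mollify_eq_convolution (B : ContDiffBump (0 : Plane)) (f : Plane → ℝ) :
    mollify B f = convolution (B.normed volume) f (ContinuousLinearMap.lsmul ℝ ℝ) volume := rfl

/-- The contraction with centre `x₀` and ratio `r`. -/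
def shrink (x₀ : Plane) (r : ℝ) (x : Plane) : Plane := x₀ + r • (x - x₀)

theorem contDiff_shrink (x₀ : Plane) (r : ℝ) : ContDiff ℝ ∞ (shrink x₀ r) := by
  unfold shrink; fun_prop

/-- Jensen's inequality: the normalised bump is the density of a probability measure, for which the
L¹ norm is at most the L² norm. -/
theorem enorm_mollify_sq_le (B : ContDiffBump (0 : Plane)) {f : Plane → ℝ} (hf : Measurable f)
    (z : Plane) : ‖mollify B f z‖ₑ ^ 2 ≤
      ∫⁻ y, ENNReal.ofReal (B.normed volume y) * ‖f (z - y)‖ₑ ^ 2 := by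
  have hB : Measurable fun y => ENNReal.ofReal (B.normed volume y) :=
    B.continuous_normed.measurable.ennreal_ofReal
  have hfz : Measurable fun y => f (z - y) := hf.comp (measurable_const.sub measurable_id)
  let ν : Measure Plane := (volume : Measure Plane).withDensity
    fun y => ENNReal.ofReal (B.normed volume y)
  have hν : IsProbabilityMeasure ν := ⟨by
    rw [withDensity_apply _ MeasurableSet.univ, setLIntegral_univ,
      ← ofReal_integral_eq_lintegral_ofReal B.integrable_normed
        (ae_of_all _ B.nonneg_normed), B.integral_normed, ENNReal.ofReal_one]⟩
  have h1 : ‖mollify B f z‖ₑ ≤ eLpNorm (fun y => f (z - y)) 1 ν := by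
    rw [eLpNorm_one_eq_lintegral_enorm, lintegral_withDensity_eq_lintegral_mul _ hB hfz.enorm]
    refine (enorm_integral_le_lintegral_enorm _).trans (le_of_eq (lintegral_congr fun y => ?_))
    rw [Pi.mul_apply, enorm_mul, Real.enorm_of_nonneg (B.nonneg_normed y)]
  have h2 := h1.trans (eLpNorm_le_eLpNorm_of_exponent_le (μ := ν) (p := 1) (q := 2) (by norm_num)
    hfz.aestronglyMeasurable)
  have h3 := eLpNorm_nnreal_pow_eq_lintegral (μ := ν) (f := fun y => f (z - y)) (p := 2)
    (by norm_num)
  norm_num at h3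
  refine (pow_le_pow_left₀ (by simp) h2 2).trans (le_of_eq ?_)
  rw [h3, lintegral_withDensity_eq_lintegral_mul _ hB (hfz.enorm.pow_const 2)]
  rfl

theorem lintegral_comp_shrink {F : Plane → ℝ≥0∞} (hF : Measurable F) (x₀ y : Plane) {r : ℝ}
    (hr : 0 < r) : ∫⁻ x, F (shrink x₀ r x - y) = ENNReal.ofReal (r ^ 2)⁻¹ * ∫⁻ x, F x := by
  have e : ∀ x, F (shrink x₀ r x - y) = (fun w => F (w + (x₀ - r • x₀ - y))) (r • x) := by
    intro x
    simp only [shrink, smul_sub]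
    congr 1; abel
  have hm : Measurable fun w => F (w + (x₀ - r • x₀ - y)) := hF.comp (measurable_add_const _)
  simp_rw [e]
  rw [← lintegral_map hm (measurable_const_smul r), Measure.map_addHaar_smul _ hr.ne',
    lintegral_smul_measure, lintegral_add_right_eq_self F]
  simp [abs_of_pos hr]

/-- After Jensen and Tonelli, each translate contributes the same integral, scaled by the Jacobian
`r⁻²` of the contraction, and the bump integrates to one. -/
theorem lintegral_mollify_shrink_sq_le (B : ContDiffBump (0 : Plane)) {f : Plane → ℝ}
    (hf : Measurable f) (x₀ : Plane) {r : ℝ} (hr : 0 < r) :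
    ∫⁻ x, ‖mollify B f (shrink x₀ r x)‖ₑ ^ 2 ≤
      ENNReal.ofReal (r ^ 2)⁻¹ * ∫⁻ x, ‖f x‖ₑ ^ 2 := by
  have hB : Measurable fun y => ENNReal.ofReal (B.normed volume y) :=
    B.continuous_normed.measurable.ennreal_ofReal
  have hF : Measurable fun x => ‖f x‖ₑ ^ 2 := hf.enorm.pow_const 2
  have hs : Measurable (shrink x₀ r) := (contDiff_shrink x₀ r).continuous.measurable
  refine (lintegral_mono fun x => enorm_mollify_sq_le B hf _).trans ?_
  rw [lintegral_lintegral_swap]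
  · refine le_of_eq ?_
    calc _ = ∫⁻ y, ENNReal.ofReal (B.normed volume y) *
          (ENNReal.ofReal (r ^ 2)⁻¹ * ∫⁻ x, ‖f x‖ₑ ^ 2) := by
          refine lintegral_congr fun y => ?_
          rw [lintegral_const_mul' _ _ ENNReal.ofReal_ne_top]
          exact congrArg _ (lintegral_comp_shrink hF x₀ y hr)
      _ = _ := by
          rw [lintegral_mul_const _ hB, ← ofReal_integral_eq_lintegral_ofReal B.integrable_normed
            (ae_of_all _ B.nonneg_normed), B.integral_normed, ENNReal.ofReal_one, one_mul]
  · refine Measurable.aemeasurable ?_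
    exact (hB.comp measurable_snd).mul (hF.comp ((hs.comp measurable_fst).sub measurable_snd))

theorem eLpNorm_mollify_shrink_le (B : ContDiffBump (0 : Plane)) {f : Plane → ℝ}
    (hf : Measurable f) (x₀ : Plane) {r : ℝ} (hr : 1 / 2 ≤ r) :
    eLpNorm (fun x => mollify B f (shrink x₀ r x)) 2 volume ≤ 2 * eLpNorm f 2 volume := by
  have h := lintegral_mollify_shrink_sq_le B hf x₀ (by linarith : 0 < r)
  have h1 := eLpNorm_nnreal_pow_eq_lintegral (μ := (volume : Measure Plane))
    (f := fun x => mollify B f (shrink x₀ r x)) (p := 2) (by norm_num)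
  have h2 := eLpNorm_nnreal_pow_eq_lintegral (μ := (volume : Measure Plane))
    (f := f) (p := 2) (by norm_num)
  norm_num at h1 h2
  rw [← h1, ← h2] at h
  have h4 : ENNReal.ofReal (r ^ 2)⁻¹ ≤ 2 ^ 2 := by
    have : (r ^ 2)⁻¹ ≤ 4 := by
      rw [inv_le_comm₀ (by positivity) (by norm_num)]
      nlinarith
    calc _ ≤ ENNReal.ofReal 4 := ENNReal.ofReal_le_ofReal this
      _ = 2 ^ 2 := by norm_num
  have h5 := h.trans (mul_le_mul_left h4 _)
  rw [← mul_pow] at h5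
  exact (ENNReal.pow_right_strictMono two_ne_zero).le_iff_le.1 h5

theorem mollify_sub (B : ContDiffBump (0 : Plane)) {f g : Plane → ℝ}
    (hf : LocallyIntegrable f volume) (hg : LocallyIntegrable g volume) (z : Plane) :
    mollify B (f - g) z = mollify B f z - mollify B g z := by
  have hi : ∀ {f : Plane → ℝ}, LocallyIntegrable f volume →
      Integrable (fun y => B.normed volume y * f (z - y)) := fun hf =>
    B.hasCompactSupport_normed.convolutionExists_left (ContinuousLinearMap.lsmul ℝ ℝ)
      B.continuous_normed hf z
  rw [mollify, mollify, mollify, ← integral_sub (hi hf) (hi hg)]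
  congr 1; funext y
  simp only [Pi.sub_apply]; ring

theorem contDiff_mollify (B : ContDiffBump (0 : Plane)) {f : Plane → ℝ}
    (hf : LocallyIntegrable f volume) : ContDiff ℝ ∞ (mollify B f) :=
  B.hasCompactSupport_normed.contDiff_convolution_left (ContinuousLinearMap.lsmul ℝ ℝ)
    B.contDiff_normed hf

/-- The bump function of radius `ρ / (n + 2)`. -/
noncomputable def mollifierBump {ρ : ℝ} (hρ : 0 < ρ) (n : ℕ) : ContDiffBump (0 : Plane) where
  rIn := ρ / (n + 2) / 2
  rOut := ρ / (n + 2)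
  rIn_pos := by positivity
  rIn_lt_rOut := half_lt_self (by positivity)

theorem tendsto_one_div_add_two : Tendsto (fun n : ℕ => 1 / ((n : ℝ) + 2)) atTop (𝓝 0) := by
  have := (tendsto_add_atTop_iff_nat 1).2 (tendsto_one_div_add_atTop_nhds_zero_nat (𝕜 := ℝ))
  refine this.congr fun n => ?_
  push_cast; ring

/-- Density argument. Replace `f` by a continuous compactly supported `k`: the operators are
uniformly bounded on L², which controls `f - k`, and on `k` the convergence is uniform on the
bounded set `D`. -/
theorem tendsto_eLpNorm_mollify {D : Set Plane} (hD : Bornology.IsBounded D) {f : Plane → ℝ}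
    (hf : Measurable f) (hf2 : MemLp f 2 volume) (x₀ : Plane) {ρ : ℝ} (hρ : 0 < ρ) :
    Tendsto (fun n : ℕ => eLpNorm (fun x => mollify (mollifierBump hρ n) f
      (shrink x₀ (1 - 1 / ((n : ℝ) + 2)) x) - f x) 2 (volume.restrict D)) atTop (𝓝 0) := by
  rw [ENNReal.tendsto_nhds_zero]
  intro ε hε
  wlog hεt : ε ≠ ⊤ generalizing ε
  · push Not at hεt; simp [hεt]
  -- The error splits into mollified `f - k` (operator bound `2`), mollified `k` minus `k`, and `k -
  -- f`, with total `2·ε/8 + ε/8 + ε/8 = ε/2`.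
  have hε8 : ε / 8 ≠ 0 := (ENNReal.div_pos hε.ne' (by norm_num)).ne'
  obtain ⟨k, hkc, hfk, hk, hk2⟩ := hf2.exists_hasCompactSupport_eLpNorm_sub_le (by norm_num) hε8
  -- a uniform bound that makes the middle term small
  obtain ⟨η, hη, hηε⟩ : ∃ η : ℝ, 0 < η ∧
      (volume.restrict D) Set.univ ^ ((2 : ℝ≥0∞).toReal)⁻¹ * ENNReal.ofReal (2 * η) ≤ ε / 8 := by
    have hV : (volume.restrict D) Set.univ ^ ((2 : ℝ≥0∞).toReal)⁻¹ ≠ ⊤ := by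
      rw [Measure.restrict_apply_univ]
      exact ENNReal.rpow_ne_top_of_nonneg (by simp) hD.measure_lt_top.ne
    have ht : Tendsto (fun η : ℝ => (volume.restrict D) Set.univ ^ ((2 : ℝ≥0∞).toReal)⁻¹ *
        ENNReal.ofReal (2 * η)) (𝓝[>] 0) (𝓝 0) := by
      have h1 : Tendsto (fun η : ℝ => ENNReal.ofReal (2 * η)) (𝓝[>] 0) (𝓝 0) := by
        have : Tendsto (fun η : ℝ => ENNReal.ofReal (2 * η)) (𝓝 0) (𝓝 (ENNReal.ofReal (2 * 0))) :=
          (ENNReal.continuous_ofReal.comp (continuous_const.mul continuous_id)).tendsto 0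
        rw [mul_zero, ENNReal.ofReal_zero] at this
        exact this.mono_left nhdsWithin_le_nhds
      simpa using ENNReal.Tendsto.const_mul h1 (Or.inr hV)
    have h2 := (ht.eventually (ge_mem_nhds (pos_iff_ne_zero.2 hε8))).and self_mem_nhdsWithin
    obtain ⟨η, h3, h4⟩ := h2.exists
    exact ⟨η, h4, h3⟩
  obtain ⟨δ, hδ, hkδ⟩ := Metric.uniformContinuous_iff.1
    (hkc.uniformContinuous_of_continuous hk) η hη
  obtain ⟨R, hR⟩ := hD.subset_closedBall x₀
  -- One condition makes both the bump radius `ρ/(n+2)` and the displacement by the contraction, at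
  -- most `|R|/(n+2)`, smaller than `δ`.
  have hsmall : ∀ᶠ n : ℕ in atTop, 1 / ((n : ℝ) + 2) * (ρ + |R|) < δ := by
    have := tendsto_one_div_add_two.mul_const (ρ + |R|)
    rw [zero_mul] at this
    exact this.eventually (gt_mem_nhds hδ)
  filter_upwards [hsmall] with n hn
  set B := mollifierBump hρ n
  set r : ℝ := 1 - 1 / ((n : ℝ) + 2)
  have hn2 : (2 : ℝ) ≤ (n : ℝ) + 2 := by linarith [n.cast_nonneg (α := ℝ)]
  have hn0 : 0 < 1 / ((n : ℝ) + 2) := by positivity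
  have hr : 1 / 2 ≤ r := by
    have : 1 / ((n : ℝ) + 2) ≤ 1 / 2 := one_div_le_one_div_of_le (by norm_num) hn2
    simp only [r]; linarith
  have hfl : LocallyIntegrable f volume := hf2.locallyIntegrable (by norm_num)
  have hkl : LocallyIntegrable k volume := hk.locallyIntegrable
  have hB : B.rOut = 1 / ((n : ℝ) + 2) * ρ := by simp only [B, mollifierBump]; ring
  have split : (fun x => mollify B f (shrink x₀ r x) - f x) =
      (fun x => mollify B (f - k) (shrink x₀ r x)) +
        ((fun x => mollify B k (shrink x₀ r x) - k x) + (k - f)) := by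
    funext x
    simp only [Pi.add_apply, Pi.sub_apply, mollify_sub B hfl hkl]
    ring
  have hs := (contDiff_shrink x₀ r).continuous
  have m1 : AEStronglyMeasurable (fun x => mollify B (f - k) (shrink x₀ r x))
      (volume.restrict D) :=
    ((contDiff_mollify B (hfl.sub hkl)).continuous.comp hs).aestronglyMeasurable
  have m2 : AEStronglyMeasurable (fun x => mollify B k (shrink x₀ r x) - k x)
      (volume.restrict D) :=
    (((contDiff_mollify B hkl).continuous.comp hs).sub hk).aestronglyMeasurable
  have m3 : AEStronglyMeasurable (k - f) (volume.restrict D) :=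
    hk.aestronglyMeasurable.sub hf.aestronglyMeasurable
  have b1 : eLpNorm (fun x => mollify B (f - k) (shrink x₀ r x)) 2 (volume.restrict D) ≤
      2 * (ε / 8) :=
    (eLpNorm_mono_measure _ Measure.restrict_le_self).trans
      ((eLpNorm_mollify_shrink_le B (hf.sub hk.measurable) x₀ hr).trans (by gcongr))
  have b3 : eLpNorm (k - f) 2 (volume.restrict D) ≤ ε / 8 := by
    rw [eLpNorm_sub_comm]
    exact (eLpNorm_mono_measure _ Measure.restrict_le_self).trans hfk
  have b2 : eLpNorm (fun x => mollify B k (shrink x₀ r x) - k x) 2 (volume.restrict D) ≤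
      ε / 8 := by
    refine (eLpNorm_le_of_ae_bound (C := 2 * η) ?_).trans hηε
    have hmem : ∀ᵐ x ∂(volume.restrict (Metric.closedBall x₀ R)),
        ‖mollify B k (shrink x₀ r x) - k x‖ ≤ 2 * η := by
      refine ae_restrict_of_forall_mem measurableSet_closedBall fun x hx => ?_
      have hxR : ‖x - x₀‖ ≤ |R| := by
        rw [← dist_eq_norm]; exact (Metric.mem_closedBall.1 hx).trans (le_abs_self R)
      have d1 : dist (mollify B k (shrink x₀ r x)) (k (shrink x₀ r x)) ≤ η := by
        rw [mollify_eq_convolution]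
        refine ContDiffBump.dist_normed_convolution_le hk.aestronglyMeasurable fun w hw => ?_
        refine (hkδ ?_).le
        have : dist w (shrink x₀ r x) < B.rOut := hw
        nlinarith [abs_nonneg R]
      have d2 : dist (k (shrink x₀ r x)) (k x) ≤ η := by
        refine (hkδ ?_).le
        have : shrink x₀ r x - x = -((1 / ((n : ℝ) + 2)) • (x - x₀)) := by
          simp only [shrink, r, sub_smul, one_smul]; abel
        rw [dist_eq_norm, this, norm_neg, norm_smul, Real.norm_of_nonneg hn0.le]
        nlinarith
      rw [← dist_eq_norm]
      linarith [dist_triangle (mollify B k (shrink x₀ r x)) (k (shrink x₀ r x)) (k x)]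
    exact ae_mono (Measure.restrict_mono hR le_rfl) hmem
  rw [split]
  refine (eLpNorm_add_le m1 (m2.add m3) (by norm_num)).trans ?_
  refine (add_le_add b1 ((eLpNorm_add_le m2 m3 (by norm_num)).trans (add_le_add b2 b3))).trans ?_
  calc 2 * (ε / 8) + (ε / 8 + ε / 8) = 4 / 8 * ε := by simp only [div_eq_mul_inv]; ring
    _ ≤ 1 * ε := by
      gcongr
      rw [ENNReal.div_le_iff (by norm_num) (by norm_num)]; norm_num
    _ = ε := one_mul _

/-! ### Density of smooth functions and existence of traces -/

theorem partialDeriv_mollify (B : ContDiffBump (0 : Plane)) {f : Plane → ℝ}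
    (hf : LocallyIntegrable f volume) (i : Fin 2) (z : Plane) :
    partialDeriv i (mollify B f) z = ∫ w, partialDeriv i (B.normed volume) (z - w) * f w := by
  have hc : HasCompactSupport (B.normed volume) := B.hasCompactSupport_normed
  have h := hc.hasFDerivAt_convolution_left (ContinuousLinearMap.lsmul ℝ ℝ)
    (B.contDiff_normed (n := 1)) hf z
  rw [← mollify_eq_convolution] at h
  have hcd : Continuous (fderiv ℝ (B.normed volume)) :=
    (B.contDiff_normed (n := 1)).continuous_fderiv (by simp)
  have hex := (hc.fderiv ℝ).convolutionExists_left
    ((ContinuousLinearMap.lsmul ℝ ℝ : ℝ →L[ℝ] ℝ →L[ℝ] ℝ).precompL Plane) hcd hf z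
  rw [partialDeriv, h.fderiv, convolution_def, ContinuousLinearMap.integral_apply hex,
    ← integral_sub_left_eq_self _ volume z]
  congr 1; funext w
  simp [partialDeriv]

theorem isTestFunction_bump {D : Set Plane} (B : ContDiffBump (0 : Plane)) {z : Plane}
    (hz : Metric.closedBall z B.rOut ⊆ D) :
    IsTestFunction D fun w => B.normed volume (z - w) := by
  have hsupp : tsupport (fun w => B.normed volume (z - w)) ⊆ Metric.closedBall z B.rOut := by
    refine closure_minimal (fun w hw => ?_) Metric.isClosed_closedBall
    have : z - w ∈ Function.support (B.normed volume) := hw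
    rw [B.support_normed_eq, Metric.mem_ball, dist_zero_right] at this
    rw [Metric.mem_closedBall, dist_comm, dist_eq_norm]
    exact this.le
  refine ⟨(B.contDiff_normed (n := ⊤)).comp (contDiff_const.sub contDiff_id), ?_, hsupp.trans hz⟩
  exact HasCompactSupport.of_support_subset_isCompact (isCompact_closedBall z B.rOut)
    (subset_closure.trans hsupp)

/-- The kernel centred at `z` is a test function on `D` because its ball lies in `D`.
Differentiating in `w` instead of `z` changes the sign, which cancels the sign in the definition of
a weak derivative. -/
theorem partialDeriv_mollify_of_isWeakPartial {D : Set Plane} (hD : MeasurableSet D)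
    (B : ContDiffBump (0 : Plane)) {f f' : Plane → ℝ} {i : Fin 2}
    (hf : LocallyIntegrable f volume) (h : IsWeakPartial D i f f') {z : Plane}
    (hz : Metric.closedBall z B.rOut ⊆ D) :
    partialDeriv i (mollify B f) z = mollify B (D.indicator f') z := by
  have ht := isTestFunction_bump B hz
  have hd : ∀ w, partialDeriv i (fun w => B.normed volume (z - w)) w =
      -partialDeriv i (B.normed volume) (z - w) := by
    intro w
    have h1 : HasFDerivAt (B.normed volume) (fderiv ℝ (B.normed volume) (z - w)) (z - w) :=
      ((B.contDiff_normed (n := 1)).differentiable (by simp) _).hasFDerivAt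
    have h2 : HasFDerivAt (fun w : Plane => z - w) (-ContinuousLinearMap.id ℝ Plane) w :=
      (hasFDerivAt_id w).const_sub z
    have h3 := (h1.comp w h2).fderiv
    simp only [Function.comp_def] at h3
    rw [partialDeriv, h3]
    simp [partialDeriv]
  have hw := h _ ht
  rw [partialDeriv_mollify B hf, mollify,
    ← integral_sub_left_eq_self (fun y => B.normed volume y * D.indicator f' (z - y)) volume z]
  have e1 : ∫ w in D, f w * partialDeriv i (fun w => B.normed volume (z - w)) w =
      -∫ w, partialDeriv i (B.normed volume) (z - w) * f w := by
    rw [setIntegral_eq_integral_of_forall_compl_eq_zero fun x hx => by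
      rw [ht.partialDeriv_eq_zero_of_notMem i hx, mul_zero], ← integral_neg]
    congr 1; funext w
    rw [hd]; ring
  have e2 : ∫ w in D, f' w * B.normed volume (z - w) =
      ∫ w, B.normed volume (z - w) * D.indicator f' (z - (z - w)) := by
    rw [← integral_indicator hD]
    congr 1; funext w
    rw [sub_sub_cancel]
    by_cases hw : w ∈ D
    · simp [hw, mul_comm]
    · simp [hw]
  rw [e1, e2] at hw
  linarith

theorem partialDeriv_comp_shrink {φ : Plane → ℝ} (hφ : ContDiff ℝ ∞ φ) (x₀ : Plane) (r : ℝ)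
    (i : Fin 2) (x : Plane) :
    partialDeriv i (fun x => φ (shrink x₀ r x)) x = r * partialDeriv i φ (shrink x₀ r x) := by
  have h1 := (hφ.differentiable (by simp) (shrink x₀ r x)).hasFDerivAt
  have h2 : HasFDerivAt (shrink x₀ r) (r • ContinuousLinearMap.id ℝ Plane) x :=
    (((hasFDerivAt_id x).sub_const x₀).const_smul r).const_add x₀
  have h3 := (h1.comp x h2).fderiv
  simp only [Function.comp_def] at h3
  rw [partialDeriv, h3]
  simp [partialDeriv]

/-- The ball consists of the points `(1 - t)x + t y` with `y` in the ball of radius `ρ` about `x₀`,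
so convexity applies. Contracting by `1 - t` thus makes room exactly for a mollifier of radius `tρ`.
-/
theorem closedBall_shrink_subset {D : Set Plane} (hc : Convex ℝ D) {x₀ x : Plane}
    {ρ t : ℝ} (hρ : Metric.closedBall x₀ ρ ⊆ D) (ht : 0 < t) (ht1 : t ≤ 1) (hx : x ∈ D) :
    Metric.closedBall (shrink x₀ (1 - t) x) (t * ρ) ⊆ D := by
  intro w hw
  have hy : x₀ + t⁻¹ • (w - shrink x₀ (1 - t) x) ∈ D := by
    refine hρ ?_
    rw [Metric.mem_closedBall, dist_eq_norm, add_sub_cancel_left, norm_smul, norm_inv,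
      Real.norm_of_nonneg ht.le, ← dist_eq_norm, inv_mul_le_iff₀ ht]
    exact hw
  have := hc hy hx ht.le (sub_nonneg.2 ht1) (by ring)
  convert this using 1
  rw [smul_add, smul_smul, mul_inv_cancel₀ ht.ne']
  simp only [shrink, smul_sub, sub_smul, one_smul]
  abel

/-- Smooth functions are dense in `H¹(D)` for a bounded convex open set `D`. -/
theorem MemH1.exists_contDiff_tendsto {D : Set Plane} (hD : IsOpen D) (hc : Convex ℝ D)
    (hb : Bornology.IsBounded D) {g : Plane → ℝ} (hg : MemH1 D g) :
    ∃ φ : ℕ → Plane → ℝ, (∀ n, ContDiff ℝ ∞ (φ n)) ∧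
      Tendsto (fun n => eLpNorm (φ n - g) 2 (volume.restrict D)) atTop (𝓝 0) ∧
      ∀ i, Tendsto (fun n => eLpNorm (partialDeriv i (φ n) - weakPartial D i g) 2
        (volume.restrict D)) atTop (𝓝 0) := by
  rcases D.eq_empty_or_nonempty with rfl | ⟨x₀, hx₀⟩
  · exact ⟨fun _ => 0, fun _ => contDiff_const, by simp, by simp⟩
  obtain ⟨ρ, hρ, hρD⟩ := Metric.nhds_basis_closedBall.mem_iff.1 (hD.mem_nhds hx₀)
  -- measurable representatives, extended by zero
  have key : ∀ k : Plane → ℝ, MemLp k 2 (volume.restrict D) → ∃ f : Plane → ℝ, Measurable f ∧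
      MemLp f 2 volume ∧ D.indicator f = f ∧ f =ᵐ[volume.restrict D] k := by
    intro k hk
    refine ⟨D.indicator (hk.1.mk k), hk.1.stronglyMeasurable_mk.measurable.indicator
      hD.measurableSet, ?_, by simp, ?_⟩
    · rw [memLp_indicator_iff_restrict hD.measurableSet]
      exact (memLp_congr_ae hk.1.ae_eq_mk).1 hk
    · exact (indicator_ae_eq_restrict hD.measurableSet).trans hk.1.ae_eq_mk.symm
  obtain ⟨f, fm, f2, -, fg⟩ := key g hg.1
  choose f' fm' f2' fi' fg' using fun i => key _ (hg.2 i).memLp_weakPartial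
  have hfl : LocallyIntegrable f volume := f2.locallyIntegrable (by norm_num)
  have hwp : ∀ i, IsWeakPartial D i f (f' i) := fun i =>
    (hg.2 i).isWeakPartial.congr fg.symm (fg' i).symm
  refine ⟨fun n x => mollify (mollifierBump hρ n) f (shrink x₀ (1 - 1 / ((n : ℝ) + 2)) x),
    fun n => (contDiff_mollify _ hfl).comp (contDiff_shrink _ _), ?_, fun i => ?_⟩
  · refine (tendsto_eLpNorm_mollify hb fm f2 x₀ hρ).congr fun n => eLpNorm_congr_ae ?_
    filter_upwards [fg] with x hx
    simp [hx]
  · have ht := tendsto_eLpNorm_mollify hb (fm' i) (f2' i) x₀ hρ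
    have hu : Tendsto (fun n : ℕ => eLpNorm (fun x => mollify (mollifierBump hρ n) (f' i)
        (shrink x₀ (1 - 1 / ((n : ℝ) + 2)) x) - f' i x) 2 (volume.restrict D) +
        ENNReal.ofReal (1 / ((n : ℝ) + 2)) * eLpNorm (f' i) 2 (volume.restrict D)) atTop
        (𝓝 0) := by
      have h1 : Tendsto (fun n : ℕ => ENNReal.ofReal (1 / ((n : ℝ) + 2)) *
          eLpNorm (f' i) 2 (volume.restrict D)) atTop (𝓝 0) := by
        have := ENNReal.Tendsto.mul_const (b := eLpNorm (f' i) 2 (volume.restrict D))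
          ((ENNReal.continuous_ofReal.tendsto 0).comp tendsto_one_div_add_two)
          (Or.inr ((f2' i).mono_measure Measure.restrict_le_self).2.ne)
        simpa using this
      simpa using ht.add h1
    refine tendsto_of_tendsto_of_tendsto_of_le_of_le tendsto_const_nhds hu (fun _ => zero_le)
      fun n => ?_
    dsimp only
    set B := mollifierBump hρ n
    set t : ℝ := 1 / ((n : ℝ) + 2)
    have ht0 : 0 < t := by positivity
    have ht1 : t ≤ 1 := by
      simp only [t]
      rw [div_le_one (by positivity)]
      linarith [n.cast_nonneg (α := ℝ)]
    have hB : B.rOut = t * ρ := by simp only [B, mollifierBump, t]; ring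
    -- The chain rule contributes the factor `1 - t`; the defect `-t f'` tends to zero along with
    -- the mollification error.
    have hdec : partialDeriv i (fun x => mollify B f (shrink x₀ (1 - t) x)) - weakPartial D i g
        =ᵐ[volume.restrict D] (1 - t) • (fun x => mollify B (f' i) (shrink x₀ (1 - t) x) - f' i x)
          + (-t) • f' i := by
      filter_upwards [fg' i, ae_restrict_mem hD.measurableSet] with x hx hxD
      simp only [Pi.sub_apply, Pi.add_apply, Pi.smul_apply, smul_eq_mul]
      rw [partialDeriv_comp_shrink (contDiff_mollify B hfl),
        partialDeriv_mollify_of_isWeakPartial hD.measurableSet B hfl (hwp i)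
          (by rw [hB]; exact closedBall_shrink_subset hc hρD ht0 ht1 hxD), fi' i, ← hx]
      ring
    have m0 : AEStronglyMeasurable (f' i) (volume.restrict D) := (fm' i).aestronglyMeasurable
    have m1 : AEStronglyMeasurable (fun x => mollify B (f' i) (shrink x₀ (1 - t) x) - f' i x)
        (volume.restrict D) :=
      (((contDiff_mollify B ((f2' i).locallyIntegrable (by norm_num))).continuous.comp
        (contDiff_shrink x₀ (1 - t)).continuous).aestronglyMeasurable).sub m0
    rw [eLpNorm_congr_ae hdec]
    refine (eLpNorm_add_le (m1.const_smul _) (m0.const_smul _) (by norm_num)).trans ?_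
    rw [eLpNorm_const_smul, eLpNorm_const_smul, enorm_neg, Real.enorm_of_nonneg ht0.le,
      Real.enorm_of_nonneg (sub_nonneg.2 ht1)]
    refine add_le_add ?_ le_rfl
    calc _ ≤ ENNReal.ofReal 1 * _ := by
          gcongr; linarith
      _ = _ := by rw [ENNReal.ofReal_one, one_mul]

/-- Existence of traces on sets where a trace bound holds. -/
theorem MemH1.exists_isTrace {D s : Set Plane} (hD : IsOpen D) (hc : Convex ℝ D)
    (hb : Bornology.IsBounded D) {g : Plane → ℝ} (hg : MemH1 D g) {A B : ℝ≥0∞} (hA : A ≠ ⊤)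
    (hB : B ≠ ⊤) (hAB : TraceBound D s A B) (hsb : Bornology.IsBounded s)
    (hs : (μH[1] : Measure Plane) s ≠ ⊤) : ∃ τ, IsTrace D s g τ := by
  obtain ⟨φ, h1, h2, h3⟩ := hg.exists_contDiff_tendsto hD hc hb
  let μ : Measure Plane := (μH[1] : Measure Plane).restrict s
  have hm : ∀ n, MemLp (φ n) 2 μ := fun n => memLp_restrict_of_continuous (h1 n).continuous hsb hs 2
  let β : ℕ → ℝ≥0∞ := fun n => eLpNorm (φ n - g) 2 (volume.restrict D) +
    ∑ i, eLpNorm (partialDeriv i (φ n) - weakPartial D i g) 2 (volume.restrict D)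
  have hβ : Tendsto β atTop (𝓝 0) := by
    have := h2.add (tendsto_finsetSum Finset.univ fun i _ => h3 i)
    rwa [Finset.sum_const_zero, add_zero] at this
  -- The trace bound on `φ n - φ m` makes the restrictions to `s` a Cauchy sequence in L²; the
  -- factor `2` counts the two partial derivatives.
  have hdiff : ∀ n m, eLpNorm (φ n - φ m) 2 μ ^ 2 ≤ (A + B * 2) * (β n + β m) ^ 2 := by
    intro n m
    have hsm : ContDiff ℝ ∞ (φ n + (-1 : ℝ) • φ m) := (h1 n).add (contDiff_const.smul (h1 m))
    have e : φ n - φ m = φ n + (-1 : ℝ) • φ m := by simp [sub_eq_add_neg]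
    have h := hAB _ hsm
    have tri : ∀ {f₁ f₂ k : Plane → ℝ}, AEStronglyMeasurable f₁ (volume.restrict D) →
        AEStronglyMeasurable f₂ (volume.restrict D) → AEStronglyMeasurable k (volume.restrict D) →
        eLpNorm (f₁ + (-1 : ℝ) • f₂) 2 (volume.restrict D) ≤
          eLpNorm (f₁ - k) 2 (volume.restrict D) + eLpNorm (f₂ - k) 2 (volume.restrict D) := by
      intro f₁ f₂ k a1 a2 a3
      have : f₁ + (-1 : ℝ) • f₂ = (f₁ - k) - (f₂ - k) := by
        funext x; simp [sub_eq_add_neg]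
      rw [this]
      exact eLpNorm_sub_le (a1.sub a3) (a2.sub a3) (by norm_num)
    have t1 : eLpNorm (φ n + (-1 : ℝ) • φ m) 2 (volume.restrict D) ≤ β n + β m :=
      (tri (h1 n).continuous.aestronglyMeasurable (h1 m).continuous.aestronglyMeasurable
        hg.1.1).trans (add_le_add le_self_add le_self_add)
    have t2 : ∀ i, eLpNorm (partialDeriv i (φ n + (-1 : ℝ) • φ m)) 2 (volume.restrict D) ≤
        β n + β m := by
      intro i
      rw [partialDeriv_add_smul (h1 n) (h1 m)]
      refine (tri (continuous_partialDeriv (h1 n) i).aestronglyMeasurable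
        (continuous_partialDeriv (h1 m) i).aestronglyMeasurable
        (hg.2 i).memLp_weakPartial.1).trans (add_le_add ?_ ?_)
      · exact (Finset.single_le_sum (f := fun i => eLpNorm (partialDeriv i (φ n) -
          weakPartial D i g) 2 (volume.restrict D)) (fun _ _ => zero_le)
          (Finset.mem_univ i)).trans le_add_self
      · exact (Finset.single_le_sum (f := fun i => eLpNorm (partialDeriv i (φ m) -
          weakPartial D i g) 2 (volume.restrict D)) (fun _ _ => zero_le)
          (Finset.mem_univ i)).trans le_add_self
    rw [e]
    calc _ ≤ A * (β n + β m) ^ 2 + B * ∑ _i : Fin 2, (β n + β m) ^ 2 := by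
          refine h.trans ?_
          gcongr with i
          exact t2 i
      _ = _ := by
          rw [Finset.sum_const, Finset.card_univ, Fintype.card_fin, nsmul_eq_mul]
          push_cast
          ring
  have hcauchy : CauchySeq fun n => (hm n).toLp (φ n) := by
    rw [EMetric.cauchySeq_iff]
    intro ε hε
    have hlim : Tendsto (fun q : ℕ × ℕ => (A + B * 2) * (β q.1 + β q.2) ^ 2) (atTop ×ˢ atTop)
        (𝓝 0) := by
      have h4 : Tendsto (fun q : ℕ × ℕ => β q.1 + β q.2) (atTop ×ˢ atTop) (𝓝 0) := by
        simpa using (hβ.comp tendsto_fst).add (hβ.comp tendsto_snd)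
      have h5 := ENNReal.Tendsto.const_mul (a := A + B * 2) (ENNReal.Tendsto.pow (n := 2) h4)
        (Or.inr (ENNReal.add_ne_top.2 ⟨hA, ENNReal.mul_ne_top hB (by norm_num)⟩))
      simpa using h5
    have hε2 : 0 < ε ^ 2 := by positivity
    rw [prod_atTop_atTop_eq] at hlim
    obtain ⟨N, hN⟩ := Filter.eventually_atTop.1 (hlim.eventually (gt_mem_nhds hε2))
    refine ⟨max N.1 N.2, fun m hm' n hn' => ?_⟩
    have := (hdiff m n).trans_lt (hN (m, n) ⟨(le_max_left _ _).trans hm',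
      (le_max_right _ _).trans hn'⟩)
    rw [Lp.edist_toLp_toLp]
    exact (ENNReal.pow_right_strictMono two_ne_zero).lt_iff_lt.1 this
  obtain ⟨τ, hτ⟩ := cauchySeq_tendsto_of_complete hcauchy
  refine ⟨τ, Lp.memLp τ, φ, h1, h2, h3, ?_⟩
  have := (Lp.tendsto_Lp_iff_tendsto_eLpNorm' _ _).1 hτ
  refine this.congr fun n => eLpNorm_congr_ae ?_
  filter_upwards [(hm n).coeFn_toLp] with x hx
  simp only [Pi.sub_apply, hx]

/-! ### Geometry of the elements -/

theorem IsTriangle.convex_isCompact {K : Set Plane} (h : IsTriangle K) :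
    Convex ℝ K ∧ IsCompact K ∧ 0 < Metric.diam K := by
  obtain ⟨p, hp, rfl⟩ := h
  have hcomp := (Set.finite_range p).isCompact_convexHull (𝕜 := ℝ)
  refine ⟨convex_convexHull ℝ _, hcomp, Metric.diam_pos ?_ hcomp.isBounded⟩
  exact ⟨p 0, subset_convexHull ℝ _ ⟨0, rfl⟩, p 1, subset_convexHull ℝ _ ⟨1, rfl⟩,
    hp.injective.ne (by decide)⟩

theorem IsRectangle.convex_isCompact {K : Set Plane} (h : IsRectangle K) :
    Convex ℝ K ∧ IsCompact K ∧ 0 < Metric.diam K := by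
  obtain ⟨p, e₁, e₂, h1, -, -, rfl⟩ := h
  have hcomp : IsCompact (convexHull ℝ {p, p + e₁, p + e₂, p + e₁ + e₂}) :=
    Set.Finite.isCompact_convexHull (𝕜 := ℝ) (Set.toFinite _)
  refine ⟨convex_convexHull ℝ _, hcomp, Metric.diam_pos ?_ hcomp.isBounded⟩
  exact ⟨p, subset_convexHull ℝ _ (by simp), p + e₁, subset_convexHull ℝ _ (by simp), by simpa⟩

theorem IsPrimaryPartition.convex_isCompact {Ω : Set Plane} {T : Finset (Set Plane)}
    (h : IsPrimaryPartition Ω T) {K : Set Plane} (hK : K ∈ T) :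
    Convex ℝ K ∧ IsCompact K ∧ 0 < Metric.diam K :=
  h.2.1.elim (fun h => (h K hK).convex_isCompact) fun h => (h K hK).convex_isCompact

/-- `inDiam` is a supremum, so a disc is taken whose diameter exceeds half of the lower bound; this
is the source of the `4`. -/
theorem exists_closedBall_subset_of_inDiam {K : Set Plane} {ϱ : ℝ} (hϱ : 0 < ϱ)
    (hK : 0 < Metric.diam K) (h : ϱ * Metric.diam K ≤ inDiam K) :
    ∃ c r, 0 < r ∧ ϱ * Metric.diam K / 4 ≤ r ∧ Metric.closedBall c r ⊆ K := by
  have hpos : 0 < ϱ * Metric.diam K := by positivity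
  have hne : {d | ∃ (c : Plane) (r : ℝ), 0 ≤ r ∧ d = 2 * r ∧
      Metric.closedBall c r ⊆ K}.Nonempty := by
    -- With no disc at all, `sSup` would take its default value `0`, contradicting the positive
    -- lower bound.
    by_contra hne
    rw [Set.not_nonempty_iff_eq_empty] at hne
    rw [inDiam, hne, Real.sSup_empty] at h
    linarith
  have hlt : ϱ * Metric.diam K / 2 < inDiam K := by linarith
  obtain ⟨d, ⟨c, r, -, rfl, hcr⟩, hd⟩ := exists_lt_of_lt_csSup hne hlt
  exact ⟨c, r, by linarith, by linarith, hcr⟩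

/-- Each point of the open triangle is a convex combination with positive weight on the interior
point `c`. -/
theorem openTriangle_subset_interior {K : Set Plane} (hc : Convex ℝ K) {c p e : Plane} {L : ℝ}
    (hcK : c ∈ interior K) (hK : ∀ s ∈ Set.Ioo 0 L, p + s • e ∈ K) :
    openTriangle c p e L ⊆ interior K := by
  rintro _ ⟨z, ⟨hz0, hz1⟩, rfl⟩
  have := hc.combo_interior_self_mem_interior hcK (hK _ hz0) (sub_pos.2 hz1.2) hz1.1.le
    (by ring)
  convert this using 1
  simp only [coneMap, sub_smul, one_smul, smul_sub, smul_add]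
  abel

theorem real_sq_add_sq_of_norm_eq_one {e : Plane} (he : ‖e‖ = 1) : e 0 ^ 2 + e 1 ^ 2 = 1 := by
  have := EuclideanSpace.real_norm_sq_eq e
  rw [Fin.sum_univ_two, he] at this
  linarith

theorem exists_norm_eq_one_segment {p q : Plane} (hpq : p ≠ q) :
    ∃ e : Plane, ‖e‖ = 1 ∧ q = p + dist p q • e := by
  have h : 0 < dist p q := dist_pos.2 hpq
  refine ⟨(dist p q)⁻¹ • (q - p), ?_, ?_⟩
  · rw [norm_smul, norm_inv, Real.norm_of_nonneg h.le, dist_comm, dist_eq_norm,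
      inv_mul_cancel₀]
    rw [norm_ne_zero_iff, sub_ne_zero]; exact hpq.symm
  · rw [smul_smul, mul_inv_cancel₀ h.ne', one_smul]; abel

/-- The vector `e` rotated by a right angle. -/
noncomputable def rot (e : Plane) : Plane := !₂[-e 1, e 0]

theorem norm_rot (e : Plane) : ‖rot e‖ = ‖e‖ := by
  rw [EuclideanSpace.norm_eq, EuclideanSpace.norm_eq]
  congr 1
  simp [rot, Fin.sum_univ_two, add_comm]

/-- Displacement along the unit normal changes the signed distance at unit rate; used to move an
apex away from the line. -/
theorem lineDist_add_smul_rot {e : Plane} (he : ‖e‖ = 1) (c p : Plane) (t : ℝ) :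
    lineDist (c + t • rot e) p e = lineDist c p e - t := by
  have := real_sq_add_sq_of_norm_eq_one he
  simp only [lineDist, rot, PiLp.add_apply, PiLp.smul_apply, smul_eq_mul, Matrix.cons_val_zero,
    Matrix.cons_val_one, Matrix.cons_val_fin_one]
  linear_combination (-t) * this

/-- The trace bound for a line segment in a convex set which contains a disc. -/
theorem traceBound_of_convex {K : Set Plane} (hc : Convex ℝ K) (hK : IsCompact K) {c₀ : Plane}
    {r : ℝ} (hr : 0 < r) (hball : Metric.closedBall c₀ r ⊆ K) {p q : Plane} (hpq : p ≠ q)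
    (hs : segment ℝ p q ⊆ K) :
    TraceBound (interior K) (segment ℝ p q) (ENNReal.ofReal (3 / (r / 2)))
      (ENNReal.ofReal (Metric.diam K ^ 2 / (r / 2))) := by
  obtain ⟨e, he, hq⟩ := exists_norm_eq_one_segment hpq
  set L := dist p q
  have hL : 0 ≤ L := dist_nonneg
  rw [hq] at hs ⊢
  have hmem : ∀ s ∈ Set.Ioo 0 L, p + s • e ∈ K := fun s h => hs (by
    rw [segment_eq_image_line p hL]; exact ⟨s, ⟨h.1.le, h.2.le⟩, rfl⟩)
  -- The segment may pass through the centre of the disc. Moving the apex by `r / 2` away from the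
  -- line keeps it in the disc and makes the height at least `r / 2`.
  obtain ⟨t, ht, htd⟩ : ∃ t : ℝ, |t| ≤ r / 2 ∧ r / 2 ≤ |lineDist c₀ p e - t| := by
    rcases le_total 0 (lineDist c₀ p e) with h | h
    · exact ⟨-(r / 2), by rw [abs_neg, abs_of_pos (by linarith)], by
        rw [abs_of_nonneg (by linarith)]; linarith⟩
    · exact ⟨r / 2, by rw [abs_of_pos (by linarith)], by
        rw [abs_of_nonpos (by linarith)]; linarith⟩
  set c := c₀ + t • rot e
  have hcc : dist c c₀ ≤ r / 2 := by
    rw [dist_eq_norm, add_sub_cancel_left, norm_smul, norm_rot, he, mul_one]; exact ht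
  have hcK : c ∈ interior K := by
    refine interior_mono hball (Metric.ball_subset_interior_closedBall ?_)
    rw [Metric.mem_ball]; linarith
  refine (TraceBound.of_triangle he hL (half_pos hr)
    (by rw [lineDist_add_smul_rot he]; exact htd) (fun s h => ?_)).mono_domain
    (openTriangle_subset_interior hc hcK hmem)
  rw [← dist_eq_norm]
  exact Metric.dist_le_diam_of_mem hK.isBounded (hmem s h) (interior_subset hcK)

/-! ### Maximal segments and the dual skeleton -/

/-- Two parameters in `[0, 1]` at distance at least one must be the two ends. -/
theorem segment_eq_of_dist_le {a b a' b' : Plane} (ha : a ∈ segment ℝ a' b')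
    (hb : b ∈ segment ℝ a' b') (hab : a ≠ b) (h : dist a' b' ≤ dist a b) :
    segment ℝ a' b' = segment ℝ a b := by
  rw [segment_eq_image'] at ha hb
  obtain ⟨s, hs, rfl⟩ := ha
  obtain ⟨t, ht, rfl⟩ := hb
  have hne : a' ≠ b' := by
    rintro rfl; simp at hab
  have hpos : 0 < ‖b' - a'‖ := norm_pos_iff.2 (sub_ne_zero.2 hne.symm)
  have e : dist (a' + s • (b' - a')) (a' + t • (b' - a')) = |s - t| * ‖b' - a'‖ := by
    rw [dist_add_left, dist_eq_norm, ← sub_smul, norm_smul, Real.norm_eq_abs]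
  rw [e, dist_comm, dist_eq_norm] at h
  have h1 : 1 ≤ |s - t| := by
    by_contra hlt
    push Not at hlt
    nlinarith
  rcases le_abs.1 h1 with h2 | h2
  · have hs1 : s = 1 := by linarith [hs.2, ht.1]
    have ht0 : t = 0 := by linarith [hs.2, ht.1]
    subst hs1 ht0
    rw [segment_symm]; simp
  · have ht1 : t = 1 := by linarith [ht.2, hs.1]
    have hs0 : s = 0 := by linarith [ht.2, hs.1]
    subst ht1 hs0
    simp

theorem mem_segment_iff_dist {x a b : Plane} :
    x ∈ segment ℝ a b ↔ dist a x + dist x b = dist a b := by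
  rw [mem_segment_iff_wbtw, dist_add_dist_eq_iff]

theorem isClosed_setOf_segment_subset {C : Set Plane} (hC : IsClosed C) :
    IsClosed {z : Plane × Plane | segment ℝ z.1 z.2 ⊆ C} := by
  have e : {z : Plane × Plane | segment ℝ z.1 z.2 ⊆ C} =
      ⋂ t ∈ Set.Icc (0 : ℝ) 1, (fun z : Plane × Plane => z.1 + t • (z.2 - z.1)) ⁻¹' C := by
    ext z
    simp only [Set.mem_ofPred_eq, segment_eq_image', Set.image_subset_iff, Set.mem_iInter]
    rfl
  rw [e]
  refine isClosed_biInter fun t _ => hC.preimage ?_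
  exact continuous_fst.add ((continuous_snd.sub continuous_fst).const_smul t)

theorem isClosed_setOf_mem_segment (x : Plane) :
    IsClosed {z : Plane × Plane | x ∈ segment ℝ z.1 z.2} := by
  simp only [mem_segment_iff_dist]
  exact isClosed_eq ((continuous_fst.dist continuous_const).add
    (continuous_const.dist continuous_snd)) (continuous_fst.dist continuous_snd)

/-- The pairs of end points of admissible segments form a compact set, on which the distance attains
its maximum. -/
theorem exists_longest_segment {C : Set Plane} (hC : IsCompact C) {p q : Plane}
    (hs : segment ℝ p q ⊆ C) :
    ∃ a b : Plane, segment ℝ a b ⊆ C ∧ p ∈ segment ℝ a b ∧ q ∈ segment ℝ a b ∧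
      ∀ a' b' : Plane, segment ℝ a' b' ⊆ C → p ∈ segment ℝ a' b' → q ∈ segment ℝ a' b' →
        dist a' b' ≤ dist a b := by
  have hM : IsCompact ((C ×ˢ C) ∩ ({z : Plane × Plane | segment ℝ z.1 z.2 ⊆ C} ∩
      ({z | p ∈ segment ℝ z.1 z.2} ∩ {z | q ∈ segment ℝ z.1 z.2}))) :=
    (hC.prod hC).inter_right ((isClosed_setOf_segment_subset hC.isClosed).inter
      ((isClosed_setOf_mem_segment p).inter (isClosed_setOf_mem_segment q)))
  have hdist : Continuous fun z : Plane × Plane => dist z.1 z.2 :=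
    continuous_fst.dist continuous_snd
  obtain ⟨z, hz, hmax⟩ := hM.exists_isMaxOn ⟨(p, q), ⟨hs (left_mem_segment ℝ p q),
    hs (right_mem_segment ℝ p q)⟩, hs, left_mem_segment ℝ p q, right_mem_segment ℝ p q⟩
    hdist.continuousOn
  refine ⟨z.1, z.2, hz.2.1, hz.2.2.1, hz.2.2.2, fun a' b' h1 h2 h3 => ?_⟩
  exact isMaxOn_iff.1 hmax (a', b') ⟨⟨h1 (left_mem_segment ℝ a' b'),
    h1 (right_mem_segment ℝ a' b')⟩, h1, h2, h3⟩

theorem exists_maximal_segment {C : Set Plane} (hC : IsCompact C) {p q : Plane} (hpq : p ≠ q)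
    (hs : segment ℝ p q ⊆ C) :
    ∃ a b : Plane, a ≠ b ∧ segment ℝ p q ⊆ segment ℝ a b ∧ segment ℝ a b ⊆ C ∧
      ∀ a' b' : Plane, segment ℝ a b ⊆ segment ℝ a' b' → segment ℝ a' b' ⊆ C →
        segment ℝ a' b' = segment ℝ a b := by
  obtain ⟨a, b, hab, hpa, hqa, hmax⟩ := exists_longest_segment hC hs
  have hne : a ≠ b := by
    rintro rfl
    rw [segment_same] at hpa hqa
    exact hpq (hpa.trans hqa.symm)
  exact ⟨a, b, hne, (convex_segment a b).segment_subset hpa hqa, hab, fun a' b' h5 h6 =>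
    segment_eq_of_dist_le (h5 (left_mem_segment ℝ a b)) (h5 (right_mem_segment ℝ a b)) hne
      (hmax a' b' h6 (h5 hpa) (h5 hqa))⟩

/-- A polygon is the closure of its interior because the underlying domain is the interior of its
closure; hence every point of a control volume is a limit of interior points. -/
theorem IsPolygon.facts {P : Set Plane} (h : IsPolygon P) :
    IsClosed P ∧ closure (interior P) = P ∧ Bornology.IsBounded P ∧
      ∃ S : Finset (Plane × Plane), frontier P = ⋃ p ∈ S, segment ℝ p.1 p.2 := by
  obtain ⟨G, ⟨hG, -, hb, hi, S, hS⟩, rfl⟩ := h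
  refine ⟨isClosed_closure, by rw [hi], hb.closure, S, ?_⟩
  rw [← hS, frontier, hi, closure_closure, hG.frontier_eq]

theorem measure_frontier_lt_top {P : Set Plane} (h : IsPolygon P) :
    (μH[1] : Measure Plane) (frontier P) < ⊤ := by
  obtain ⟨-, -, -, S, hS⟩ := h.facts
  rw [hS]
  refine measure_biUnion_lt_top S.finite_toSet fun p _ => ?_
  rw [hausdorffMeasure_segment]
  exact edist_lt_top _ _

/-- A skeleton point lies on the boundaries of two control volumes. If the boundary segments through
it share only that point, it belongs to a finite exceptional set; otherwise they share a piece of a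
line through it, which extends to a maximal segment, i.e. a gridline. -/
theorem dualSkeleton_subset {Ω : Set Plane} {Ts : Finset (Set Plane)} (hTs : IsDualPartition Ω Ts)
    {K : Set Plane} (hK : IsCompact K) (hKΩ : K ⊆ closure Ω) :
    ∃ F : Set Plane, F.Finite ∧ dualSkeleton Ts K ⊆ F ∪ ⋃ l ∈ dualGridlines Ts K, l := by
  classical
  choose! S hS using fun Ks (h : Ks ∈ Ts) => (hTs.2 Ks h).facts.2.2.2
  let E : Finset (Plane × Plane) := Ts.biUnion S
  let F : Set Plane := ⋃ p ∈ E, ⋃ q ∈ E, {x | x ∈ segment ℝ p.1 p.2 ∩ segment ℝ q.1 q.2 ∧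
    (segment ℝ p.1 p.2 ∩ segment ℝ q.1 q.2).Subsingleton}
  refine ⟨F, E.finite_toSet.biUnion fun p _ => E.finite_toSet.biUnion fun q _ =>
    Set.Subsingleton.finite fun x hx y hy => hx.2 hx.1 hy.1, ?_⟩
  rintro x ⟨hx, hxK⟩
  rw [Set.mem_union, or_iff_not_imp_left]
  intro hxF
  obtain ⟨K₁, hK1, hx1⟩ := Set.mem_iUnion₂.1 hx
  obtain ⟨hcl1, hint1, -⟩ := (hTs.2 K₁ hK1).facts
  -- another control volume contains `x`
  obtain ⟨K₂, hK2, hne, hx2⟩ : ∃ K₂ ∈ Ts, K₁ ≠ K₂ ∧ x ∈ K₂ := by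
    have hclosed : IsClosed (⋃ L ∈ Ts.erase K₁, L) :=
      isClosed_biUnion_finset fun L hL => (hTs.2 L (Finset.mem_of_mem_erase hL)).facts.1
    have hxcl : x ∈ closure (K₁ᶜ ∩ interior K) := by
      have h1 : x ∈ closure K₁ᶜ := by
        rw [frontier_eq_closure_inter_closure] at hx1; exact hx1.2
      rw [Set.inter_comm]
      exact isOpen_interior.inter_closure ⟨hxK, h1⟩
    have hsub : K₁ᶜ ∩ interior K ⊆ ⋃ L ∈ Ts.erase K₁, L := by
      rintro y ⟨hy1, hyK⟩
      have : y ∈ ⋃ L ∈ Ts, L := hTs.1.1 ▸ hKΩ (interior_subset hyK)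
      obtain ⟨L, hL, hyL⟩ := Set.mem_iUnion₂.1 this
      refine Set.mem_iUnion₂.2 ⟨L, Finset.mem_erase.2 ⟨?_, hL⟩, hyL⟩
      rintro rfl; exact hy1 hyL
    obtain ⟨L, hL, hxL⟩ := Set.mem_iUnion₂.1 (closure_minimal hsub hclosed hxcl)
    exact ⟨L, Finset.mem_of_mem_erase hL, (Finset.ne_of_mem_erase hL).symm, hxL⟩
  obtain ⟨hcl2, -⟩ := (hTs.2 K₂ hK2).facts
  have hx1' : x ∈ K₁ := hcl1.frontier_subset hx1
  -- Otherwise interior points of `K₁` near `x` would lie in the interior of `K₂`.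
  have hx2' : x ∈ frontier K₂ := by
    refine ⟨subset_closure hx2, fun hin => ?_⟩
    have hd := hTs.1.2 K₁ hK1 K₂ hK2 hne
    have : x ∈ closure (interior K₁) := by rw [hint1]; exact hx1'
    obtain ⟨y, hy2, hy1⟩ := mem_closure_iff.1 this _ isOpen_interior hin
    exact Set.disjoint_left.1 hd hy1 hy2
  rw [hS K₁ hK1] at hx1
  rw [hS K₂ hK2] at hx2'
  obtain ⟨s₁, hs1, hxs1⟩ := Set.mem_iUnion₂.1 hx1
  obtain ⟨s₂, hs2, hxs2⟩ := Set.mem_iUnion₂.1 hx2'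
  have hns : ¬(segment ℝ s₁.1 s₁.2 ∩ segment ℝ s₂.1 s₂.2).Subsingleton := fun hsub =>
    hxF (Set.mem_iUnion₂.2 ⟨s₁, Finset.mem_biUnion.2 ⟨K₁, hK1, hs1⟩, Set.mem_iUnion₂.2
      ⟨s₂, Finset.mem_biUnion.2 ⟨K₂, hK2, hs2⟩, ⟨hxs1, hxs2⟩, hsub⟩⟩)
  obtain ⟨y, hy, hyx⟩ : ∃ y ∈ segment ℝ s₁.1 s₁.2 ∩ segment ℝ s₂.1 s₂.2, y ≠ x := by
    by_contra hcon
    push Not at hcon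
    exact hns fun a ha b hb => (hcon a ha).trans (hcon b hb).symm
  -- a short piece of the common segment lies in `K`
  obtain ⟨ε, hε, hball⟩ := Metric.isOpen_iff.1 isOpen_interior x hxK
  have hyx0 : 0 < ‖y - x‖ := norm_pos_iff.2 (sub_ne_zero.2 hyx)
  let t : ℝ := min 1 (ε / 2 / ‖y - x‖)
  have ht0 : 0 < t := lt_min one_pos (by positivity)
  have ht1 : t ≤ 1 := min_le_left _ _
  have htε : t * ‖y - x‖ < ε := by
    have : t * ‖y - x‖ ≤ ε / 2 := by
      rw [← le_div_iff₀ hyx0]; exact min_le_right _ _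
    linarith
  let z := x + t • (y - x)
  have hzx : z ≠ x := by
    simp only [z, ne_eq, add_eq_left, smul_eq_zero, not_or]
    exact ⟨ht0.ne', sub_ne_zero.2 hyx⟩
  have hzseg : z ∈ segment ℝ x y := by
    rw [segment_eq_image']; exact ⟨t, ⟨ht0.le, ht1⟩, rfl⟩
  have hconv : Convex ℝ (segment ℝ s₁.1 s₁.2 ∩ segment ℝ s₂.1 s₂.2) :=
    (convex_segment _ _).inter (convex_segment _ _)
  have hsegI : segment ℝ x z ⊆ segment ℝ s₁.1 s₁.2 ∩ segment ℝ s₂.1 s₂.2 :=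
    hconv.segment_subset ⟨hxs1, hxs2⟩ (hconv.segment_subset ⟨hxs1, hxs2⟩ hy hzseg)
  have hzball : z ∈ Metric.ball x ε := by
    rw [Metric.mem_ball, dist_eq_norm, add_sub_cancel_left, norm_smul,
      Real.norm_of_nonneg ht0.le]
    exact htε
  have hsegK : segment ℝ x z ⊆ interior K :=
    ((convex_ball x ε).segment_subset (Metric.mem_ball_self hε) hzball).trans hball
  have hsegC : segment ℝ x z ⊆ K₁ ∩ K₂ ∩ K := by
    intro w hw
    refine ⟨⟨hcl1.frontier_subset ?_, hcl2.frontier_subset ?_⟩, interior_subset (hsegK hw)⟩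
    · rw [hS K₁ hK1]; exact Set.mem_iUnion₂.2 ⟨s₁, hs1, (hsegI hw).1⟩
    · rw [hS K₂ hK2]; exact Set.mem_iUnion₂.2 ⟨s₂, hs2, (hsegI hw).2⟩
  have hC : IsCompact (K₁ ∩ K₂ ∩ K) := hK.inter_left (hcl1.inter hcl2)
  obtain ⟨a, b, hab, h1, h2, h3⟩ := exists_maximal_segment hC hzx.symm hsegC
  have hxab : x ∈ segment ℝ a b := h1 (left_mem_segment ℝ x z)
  exact Set.mem_iUnion₂.2 ⟨segment ℝ a b, ⟨K₁, hK1, K₂, hK2, hne, a, b, hab, rfl, h2,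
    ⟨x, hxab, hxK⟩, h3⟩, hxab⟩

theorem measurableSet_dualSkeleton (Ts : Finset (Set Plane)) (K : Set Plane) :
    MeasurableSet (dualSkeleton Ts K) :=
  (Finset.measurableSet_biUnion _ fun _ _ => isClosed_frontier.measurableSet).inter
    isOpen_interior.measurableSet

theorem measure_dualSkeleton_lt_top {Ω : Set Plane} {Ts : Finset (Set Plane)}
    (hTs : IsDualPartition Ω Ts) (K : Set Plane) :
    (μH[1] : Measure Plane) (dualSkeleton Ts K) < ⊤ :=
  (measure_mono Set.inter_subset_left).trans_lt
    (measure_biUnion_lt_top Ts.finite_toSet fun Ks hKs => measure_frontier_lt_top (hTs.2 Ks hKs))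

/-! ### Outer normals -/

theorem IsOuterNormal.mem {P : Set Plane} {x ν : Plane} (h : IsOuterNormal P x ν) : x ∈ P := by
  obtain ⟨-, ε, hε, h⟩ := h
  have : x ∈ {y ∈ Metric.ball x ε | inner ℝ (y - x) ν ≤ 0} :=
    ⟨Metric.mem_ball_self hε, by simp⟩
  rw [← h] at this
  exact this.1

/-- For distinct unit vectors, a small step along `ν - ν'` stays in the half-plane of `ν'` but
leaves that of `ν`. -/
theorem IsOuterNormal.unique {P : Set Plane} {x ν ν' : Plane} (h : IsOuterNormal P x ν)
    (h' : IsOuterNormal P x ν') : ν = ν' := by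
  obtain ⟨hν, ε, hε, h⟩ := h
  obtain ⟨hν', ε', hε', h'⟩ := h'
  by_contra hne
  have hpos : 0 < ‖ν - ν'‖ := norm_pos_iff.2 (sub_ne_zero.2 hne)
  let δ : ℝ := min ε ε' / 2 / ‖ν - ν'‖
  have hmin : 0 < min ε ε' := lt_min hε hε'
  have hδ : 0 < δ := by positivity
  have hlt : inner ℝ ν ν' < 1 := by
    refine lt_of_le_of_ne ?_ fun he => hne ((inner_eq_one_iff_of_norm_eq_one hν hν').1 he)
    have := real_inner_le_norm ν ν'
    rwa [hν, hν', one_mul] at this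
  have hnorm : ‖δ • (ν - ν')‖ = min ε ε' / 2 := by
    rw [norm_smul, Real.norm_of_nonneg hδ.le]
    exact div_mul_cancel₀ _ hpos.ne'
  have hball : ∀ η, min ε ε' ≤ η → x + δ • (ν - ν') ∈ Metric.ball x η := by
    intro η hη
    rw [Metric.mem_ball, dist_eq_norm, add_sub_cancel_left, hnorm]
    linarith
  have hν2 : inner ℝ ν ν = (1 : ℝ) := by rw [real_inner_self_eq_norm_sq, hν]; norm_num
  have hν2' : inner ℝ ν' ν' = (1 : ℝ) := by rw [real_inner_self_eq_norm_sq, hν']; norm_num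
  have hin : x + δ • (ν - ν') ∈ {y ∈ Metric.ball x ε' | inner ℝ (y - x) ν' ≤ 0} := by
    refine ⟨hball _ (min_le_right _ _), ?_⟩
    rw [add_sub_cancel_left, inner_smul_left, inner_sub_left, hν2']
    exact mul_nonpos_of_nonneg_of_nonpos hδ.le (by linarith)
  rw [← h'] at hin
  have hin2 : x + δ • (ν - ν') ∈ P ∩ Metric.ball x ε := ⟨hin.1, hball _ (min_le_left _ _)⟩
  rw [h] at hin2
  have h3 := hin2.2
  rw [add_sub_cancel_left, inner_smul_left, inner_sub_left, hν2, real_inner_comm] at h3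
  have : 0 < δ * (1 - inner ℝ ν ν') := mul_pos hδ (by linarith)
  simp only [conj_trivial] at h3
  linarith

theorem isOuterNormal_outerNormal {P : Set Plane} {x : Plane} (h : ∃ ν, IsOuterNormal P x ν) :
    IsOuterNormal P x (outerNormal P x) := by
  rw [outerNormal, dif_pos h]; exact h.choose_spec

theorem exists_isOuterNormal_of_ne {P : Set Plane} {x : Plane} (h : outerNormal P x ≠ 0) :
    ∃ ν, IsOuterNormal P x ν := by
  by_contra hn
  exact h (by rw [outerNormal, dif_neg hn])

theorem norm_outerNormal_le (P : Set Plane) (x : Plane) : ‖outerNormal P x‖ ≤ 1 := by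
  by_cases h : ∃ ν, IsOuterNormal P x ν
  · exact (isOuterNormal_outerNormal h).1.le
  · rw [outerNormal, dif_neg h]; simp

theorem isOpen_half_disc (x ν : Plane) (ε : ℝ) :
    IsOpen {y ∈ Metric.ball x ε | inner ℝ (y - x) ν < (0 : ℝ)} := by
  have hc : Continuous fun y : Plane => inner ℝ (y - x) ν :=
    (continuous_id.sub continuous_const).inner continuous_const
  exact Metric.isOpen_ball.inter (isOpen_lt hc continuous_const)

/-- A point inside the half-plane is an interior point, a point outside does not belong to the
set. -/
theorem inner_eq_zero_of_mem_frontier {P : Set Plane} {x ν : Plane} {ε : ℝ}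
    (h : P ∩ Metric.ball x ε = {y ∈ Metric.ball x ε | inner ℝ (y - x) ν ≤ 0}) {y : Plane}
    (hy : y ∈ Metric.ball x ε) (hP : IsClosed P) (hyP : y ∈ frontier P) :
    inner ℝ (y - x) ν = (0 : ℝ) := by
  have h1 : y ∈ P ∩ Metric.ball x ε := ⟨hP.frontier_subset hyP, hy⟩
  rw [h] at h1
  refine le_antisymm h1.2 (not_lt.1 fun hlt => hyP.2 ?_)
  have hopen : IsOpen {y ∈ Metric.ball x ε | inner ℝ (y - x) ν < (0 : ℝ)} :=
    isOpen_half_disc x ν ε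
  refine mem_interior.2 ⟨_, fun z hz => ?_, hopen, ⟨hy, hlt⟩⟩
  have : z ∈ {y ∈ Metric.ball x ε | inner ℝ (y - x) ν ≤ 0} := ⟨hz.1, hz.2.le⟩
  rw [← h] at this
  exact this.1

theorem IsOuterNormal.mem_frontier {P : Set Plane} {x ν : Plane} (h : IsOuterNormal P x ν) :
    x ∈ frontier P := by
  refine ⟨subset_closure h.mem, fun hin => ?_⟩
  obtain ⟨hν, ε, hε, h⟩ := h
  obtain ⟨δ, hδ, hball⟩ := Metric.isOpen_iff.1 isOpen_interior x hin
  have hmin : 0 < min ε δ := lt_min hε hδ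
  have hb : ∀ η, min ε δ ≤ η → x + (min ε δ / 2) • ν ∈ Metric.ball x η := by
    intro η hη
    rw [Metric.mem_ball, dist_eq_norm, add_sub_cancel_left, norm_smul, hν,
      Real.norm_of_nonneg (by positivity)]
    linarith
  have : x + (min ε δ / 2) • ν ∈ P ∩ Metric.ball x ε :=
    ⟨interior_subset (hball (hb _ (min_le_right _ _))), hb _ (min_le_left _ _)⟩
  rw [h] at this
  have h3 := this.2
  rw [add_sub_cancel_left, inner_smul_left, real_inner_self_eq_norm_sq, hν] at h3
  simp only [conj_trivial] at h3
  linarith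

/-- Outer normals are locally constant along the boundary. -/
theorem IsOuterNormal.eventually {P : Set Plane} (hP : IsClosed P) {x ν : Plane}
    (h : IsOuterNormal P x ν) :
    ∃ ε > 0, ∀ y ∈ frontier P ∩ Metric.ball x ε, IsOuterNormal P y ν := by
  obtain ⟨hν, ε, hε, h⟩ := h
  refine ⟨ε, hε, fun y hy => ⟨hν, ε - dist y x,
    sub_pos.2 (Metric.mem_ball.1 hy.2), ?_⟩⟩
  have h0 := inner_eq_zero_of_mem_frontier h hy.2 hP hy.1
  have hsub : Metric.ball y (ε - dist y x) ⊆ Metric.ball x ε :=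
    Metric.ball_subset_ball' (by linarith)
  have hiff : ∀ z, inner ℝ (z - y) ν = inner ℝ (z - x) ν := by
    intro z
    have : z - y = (z - x) - (y - x) := by abel
    rw [this, inner_sub_left, h0, sub_zero]
  ext z
  have hz : z ∈ P ∩ Metric.ball x ε ↔ z ∈ {y ∈ Metric.ball x ε | inner ℝ (y - x) ν ≤ 0} := by
    rw [h]
  constructor
  · rintro ⟨h1, h2⟩
    exact ⟨h2, by rw [hiff]; exact (hz.1 ⟨h1, hsub h2⟩).2⟩
  · rintro ⟨h1, h2⟩
    rw [hiff] at h2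
    exact ⟨(hz.2 ⟨hsub h1, h2⟩).1, h1⟩

/-- The points with a normal form a relatively open part of the frontier, on which the normal is
locally constant; off this Borel set it is `0`. -/
theorem measurable_outerNormal {P : Set Plane} (hP : IsClosed P) : Measurable (outerNormal P) := by
  classical
  let N : Set Plane := {x | ∃ ν, IsOuterNormal P x ν}
  have hloc : ∀ x ∈ N, ∃ ε > 0, ∀ y ∈ frontier P ∩ Metric.ball x ε,
      y ∈ N ∧ outerNormal P y = outerNormal P x := by
    intro x hx
    obtain ⟨ε, hε, h⟩ := (isOuterNormal_outerNormal hx).eventually hP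
    exact ⟨ε, hε, fun y hy => ⟨⟨_, h y hy⟩, (isOuterNormal_outerNormal ⟨_, h y hy⟩).unique (h y hy)⟩⟩
  choose! ε hε hloc using hloc
  have hN : N = frontier P ∩ ⋃ x ∈ N, Metric.ball x (ε x) := by
    ext y
    constructor
    · rintro hy
      obtain ⟨ν, hν⟩ := id hy
      exact ⟨hν.mem_frontier, Set.mem_iUnion₂.2 ⟨y, hy, Metric.mem_ball_self (hε y hy)⟩⟩
    · rintro ⟨h1, h2⟩
      obtain ⟨x, hx, hy⟩ := Set.mem_iUnion₂.1 h2
      exact (hloc x hx y ⟨h1, hy⟩).1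
  have hNm : MeasurableSet N := by
    rw [hN]
    exact isClosed_frontier.measurableSet.inter
      (isOpen_biUnion fun _ _ => Metric.isOpen_ball).measurableSet
  have hcont : ContinuousOn (outerNormal P) N := by
    intro x hx
    refine ContinuousWithinAt.congr_of_eventuallyEq continuousWithinAt_const ?_ rfl
    filter_upwards [self_mem_nhdsWithin, mem_nhdsWithin_of_mem_nhds
      (Metric.ball_mem_nhds x (hε x hx))] with y hyN hy
    obtain ⟨ν, hν⟩ := hyN
    exact (hloc x hx y ⟨hν.mem_frontier, hy⟩).2
  have hpw := hcont.measurable_piecewise (g := fun _ => (0 : Plane)) continuousOn_const hNm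
  convert hpw using 1
  funext x
  by_cases hx : x ∈ N
  · rw [Set.piecewise_eq_of_mem _ _ _ hx]
  · rw [Set.piecewise_eq_of_notMem _ _ _ hx, outerNormal,
      dif_neg (show ¬∃ ν, IsOuterNormal P x ν from hx)]

/-! ### Traces of smooth functions from inside a control volume -/

/-- The triangle has as base the diameter of the disc of radius `δ` along the boundary line and as
apex the point `x - δν`. It lies in the half disc on the side of `P`, has height `δ`, and rays of
length at most `2δ`. -/
theorem traceBound_half_disc {P U : Set Plane} {x ν : Plane} (hν : ‖ν‖ = 1)
    {δ ε : ℝ} (hδ : 0 < δ) (hδε : δ < ε)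
    (h : P ∩ Metric.ball x ε = {y ∈ Metric.ball x ε | inner ℝ (y - x) ν ≤ 0})
    (hball : Metric.ball x ε ⊆ interior U) :
    TraceBound (interior U ∩ interior P) {y ∈ Metric.ball x δ | inner ℝ (y - x) ν = 0}
      (ENNReal.ofReal (3 / δ)) (ENNReal.ofReal ((2 * δ) ^ 2 / δ)) := by
  let e := rot ν
  have he : ‖e‖ = 1 := by rw [norm_rot, hν]
  have hν2 := real_sq_add_sq_of_norm_eq_one hν
  have e0 : e 0 = -ν 1 := rfl
  have e1 : e 1 = ν 0 := rfl
  let p := x + (-δ) • e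
  let c := x + (-δ) • ν
  have hinner : ∀ y : Plane, inner ℝ (y - x) ν = (y 0 - x 0) * ν 0 + (y 1 - x 1) * ν 1 := by
    intro y
    rw [PiLp.inner_apply, Fin.sum_univ_two]
    simp [mul_comm]
  have hdist : |lineDist c p e| = δ := by
    have : lineDist c p e = -δ := by
      simp only [lineDist, p, c, PiLp.add_apply, PiLp.smul_apply, smul_eq_mul, e0, e1]
      linear_combination (-δ) * hν2
    rw [this, abs_neg, abs_of_pos hδ]
  have hcx : ‖c - x‖ ≤ δ := by
    simp only [c, add_sub_cancel_left, norm_smul, hν, mul_one, norm_neg]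
    rw [Real.norm_of_nonneg hδ.le]
  have hpx : ∀ s ∈ Set.Ioo 0 (2 * δ), ‖p + s • e - x‖ ≤ δ := by
    intro s hs
    have : p + s • e - x = (s - δ) • e := by
      simp only [p, sub_smul, neg_smul]; abel
    rw [this, norm_smul, he, mul_one, Real.norm_eq_abs, abs_le]
    constructor <;> linarith [hs.1, hs.2]
  have hbound := TraceBound.of_triangle (c := c) (p := p) (e := e) (L := 2 * δ) (H := 2 * δ) he
    (by positivity) hδ hdist.ge (fun s hs => by
      have : p + s • e - c = (p + s • e - x) - (c - x) := by abel
      rw [this]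
      linarith [norm_sub_le (p + s • e - x) (c - x), hpx s hs])
  refine (hbound.mono_domain ?_).mono_set ?_
  · have hopen : IsOpen {y ∈ Metric.ball x ε | inner ℝ (y - x) ν < (0 : ℝ)} :=
      isOpen_half_disc x ν ε
    have hsubP : {y ∈ Metric.ball x ε | inner ℝ (y - x) ν < (0 : ℝ)} ⊆ P := by
      intro z hz
      have : z ∈ {y ∈ Metric.ball x ε | inner ℝ (y - x) ν ≤ 0} := ⟨hz.1, hz.2.le⟩
      rw [← h] at this
      exact this.1
    have hsub : openTriangle c p e (2 * δ) ⊆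
        {y ∈ Metric.ball x ε | inner ℝ (y - x) ν < (0 : ℝ)} := by
      rintro _ ⟨z, ⟨hz0, hz1⟩, rfl⟩
      constructor
      · have hconv := (convex_closedBall x δ) (x := c) (y := p + z 0 • e)
          (by rw [Metric.mem_closedBall, dist_eq_norm]; exact hcx)
          (by rw [Metric.mem_closedBall, dist_eq_norm]; exact hpx _ hz0)
          (sub_nonneg.2 hz1.2.le) hz1.1.le (by ring)
        have heq : coneMap c p e z = (1 - z 1) • c + z 1 • (p + z 0 • e) := by
          simp only [coneMap, sub_smul, one_smul, smul_sub, smul_add]; abel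
        rw [heq]
        exact Metric.closedBall_subset_ball hδε hconv
      · rw [hinner]
        simp only [coneMap, p, c, PiLp.add_apply, PiLp.smul_apply, PiLp.sub_apply, smul_eq_mul,
          e0, e1]
        have : -δ * (1 - z 1) < 0 := by nlinarith [hz1.2]
        refine lt_of_eq_of_lt ?_ this
        linear_combination (-δ * (1 - z 1)) * hν2
    exact Set.subset_inter (hsub.trans fun y hy => hball hy.1)
      (interior_maximal hsubP hopen |>.trans' hsub)
  · rintro y ⟨hy, hy0⟩
    rw [hinner] at hy0
    rw [segment_eq_image_line p (by positivity)]
    let t := (y 0 - x 0) * e 0 + (y 1 - x 1) * e 1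
    have hyt : y = x + t • e := by
      ext i
      fin_cases i
      · simp only [PiLp.add_apply, PiLp.smul_apply, smul_eq_mul, t, Fin.zero_eta, e0, e1]
        linear_combination (-(y 0 - x 0)) * hν2 + ν 0 * hy0
      · simp only [PiLp.add_apply, PiLp.smul_apply, smul_eq_mul, t, Fin.mk_one, e0, e1]
        linear_combination (-(y 1 - x 1)) * hν2 + ν 1 * hy0
    have ht : |t| < δ := by
      rw [Metric.mem_ball, dist_eq_norm, hyt, add_sub_cancel_left, norm_smul, he, mul_one,
        Real.norm_eq_abs] at hy
      exact hy
    rw [abs_lt] at ht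
    refine ⟨t + δ, ⟨by linarith, by linarith⟩, ?_⟩
    simp only [p]
    rw [add_assoc, ← add_smul, neg_add_cancel_comm_assoc, ← hyt]

theorem isTrace_of_contDiff {D s : Set Plane} (hD : IsOpen D) (hb : Bornology.IsBounded D)
    (hsb : Bornology.IsBounded s) (hs : (μH[1] : Measure Plane) s ≠ ⊤) {φ v : Plane → ℝ}
    (hφ : ContDiff ℝ ∞ φ) (hv : v =ᵐ[volume.restrict D] φ) : IsTrace D s v φ := by
  have m := memH1_of_contDiff hφ (D := D) hb
  refine IsTrace.congr hD ?_ m hv.symm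
  refine ⟨memLp_restrict_of_continuous hφ.continuous hsb hs 2, fun _ => φ, fun _ => hφ, by simp,
    fun i => ?_, by simp⟩
  have : eLpNorm (partialDeriv i φ - weakPartial D i φ) 2 (volume.restrict D) = 0 := by
    rw [eLpNorm_congr_ae ((ae_eq_refl (partialDeriv i φ)).sub (weakPartial_of_contDiff hφ hD hb i))]
    simp
  simp [this]

/-- Where the control volume has a normal, the inner trace of a smooth function is that
function. -/
theorem innerTrace_eq_of_contDiff {K P : Set Plane} (hK : Bornology.IsBounded K)
    (hP : IsPolygon P) {φ v : Plane → ℝ} (hφ : ContDiff ℝ ∞ φ)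
    (hv : v =ᵐ[volume.restrict (interior K ∩ interior P)] φ) :
    ∀ᵐ x ∂(μH[1] : Measure Plane).restrict (frontier P ∩ interior K),
      outerNormal P x ≠ 0 → innerTrace K P v x = φ x := by
  set D := interior K ∩ interior P
  set s := frontier P ∩ interior K
  have hPcl := hP.facts.1
  have hD : IsOpen D := isOpen_interior.inter isOpen_interior
  have hDb : Bornology.IsBounded D := hK.subset (Set.inter_subset_left.trans interior_subset)
  have hsb : Bornology.IsBounded s := hK.subset (Set.inter_subset_right.trans interior_subset)
  have hsm : MeasurableSet s := isClosed_frontier.measurableSet.inter isOpen_interior.measurableSet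
  have hs : (μH[1] : Measure Plane) s ≠ ⊤ :=
    ((measure_mono Set.inter_subset_left).trans_lt (measure_frontier_lt_top hP)).ne
  have mv : MemH1 D v := (memH1_of_contDiff hφ hDb).congr hv.symm
  have t1 : IsTrace D s v φ := isTrace_of_contDiff hD hDb hsb hs hφ hv
  have t2 : IsTrace D s v (innerTrace K P v) := isTrace_traceOn ⟨φ, t1⟩
  rw [ae_restrict_iff' hsm, ae_iff]
  -- The exceptional set is shown to be null near each of its points, so only the local half-disc
  -- trace bound is needed, not one for all of `K ∩ K*`.
  refine measure_null_of_locally_null _ fun x hx => ?_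
  simp only [Classical.not_imp, Set.mem_ofPred_eq] at hx
  obtain ⟨hxs, hxn, -⟩ := hx
  obtain ⟨ν, hν, ε₁, hε₁, h⟩ := exists_isOuterNormal_of_ne hxn
  obtain ⟨ε₂, hε₂, hball⟩ := Metric.isOpen_iff.1 isOpen_interior x hxs.2
  let ε := min ε₁ ε₂
  have hε : 0 < ε := lt_min hε₁ hε₂
  have hε' : P ∩ Metric.ball x ε = {y ∈ Metric.ball x ε | inner ℝ (y - x) ν ≤ 0} := by
    have hsub : Metric.ball x ε ⊆ Metric.ball x ε₁ := Metric.ball_subset_ball (min_le_left _ _)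
    ext y
    have hy : y ∈ P ∩ Metric.ball x ε₁ ↔ y ∈ {y ∈ Metric.ball x ε₁ | inner ℝ (y - x) ν ≤ 0} := by
      rw [h]
    exact ⟨fun k => ⟨k.2, (hy.1 ⟨k.1, hsub k.2⟩).2⟩, fun k => ⟨(hy.2 ⟨hsub k.1, k.2⟩).1, k.1⟩⟩
  have htb := traceBound_half_disc (U := K) hν (half_pos hε)
    (half_lt_self hε) hε' ((Metric.ball_subset_ball (min_le_right _ _)).trans hball)
  have hsub : s ∩ Metric.ball x (ε / 2) ⊆ {y ∈ Metric.ball x (ε / 2) | inner ℝ (y - x) ν = 0} := by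
    rintro y ⟨hys, hy⟩
    exact ⟨hy, inner_eq_zero_of_mem_frontier hε'
      (Metric.ball_subset_ball (by linarith) hy) hPcl hys.1⟩
  have hae := (t2.mono Set.inter_subset_left).ae_unique hD (t1.mono Set.inter_subset_left) mv
    (htb.mono_set hsub) (by simp) (by simp)
  rw [Filter.EventuallyEq, ae_restrict_iff' (hsm.inter measurableSet_ball), ae_iff] at hae
  refine ⟨_, Filter.inter_mem self_mem_nhdsWithin (mem_nhdsWithin_of_mem_nhds
    (Metric.ball_mem_nhds x (half_pos hε))), measure_mono_null ?_ hae⟩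
  rintro y ⟨hy, hyb⟩
  simp only [Classical.not_imp, Set.mem_ofPred_eq] at hy ⊢
  exact ⟨⟨hy.1, hyb⟩, hy.2.2⟩

theorem contDiff_eval_mvPolynomial (p : MvPolynomial (Fin 2) ℝ) :
    ContDiff ℝ ∞ fun x : Plane => MvPolynomial.eval (fun i => x i) p := by
  induction p using MvPolynomial.induction_on with
  | C c => simpa using contDiff_const
  | add p q hp hq => simpa using hp.add hq
  | mul_X p i hp =>
    simp only [map_mul, MvPolynomial.eval_X]
    exact hp.mul (EuclideanSpace.proj i : Plane →L[ℝ] ℝ).contDiff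

/-! ### Symmetry of second weak derivatives, quadratic functionals -/

theorem partialDeriv_comm {φ : Plane → ℝ} (hφ : ContDiff ℝ ∞ φ) (i j : Fin 2) (x : Plane) :
    partialDeriv i (partialDeriv j φ) x = partialDeriv j (partialDeriv i φ) x := by
  have hd : DifferentiableAt ℝ (fderiv ℝ φ) x :=
    ((hφ.fderiv_right (m := 1) (by norm_cast)).differentiable (by simp)) x
  have e : ∀ i j, partialDeriv i (partialDeriv j φ) x =
      fderiv ℝ (fderiv ℝ φ) x (EuclideanSpace.single i 1) (EuclideanSpace.single j 1) := by
    intro i j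
    unfold partialDeriv
    rw [fderiv_clm_apply hd (by fun_prop)]
    simp
  rw [e, e]
  exact (hφ.contDiffAt.isSymmSndFDerivAt (by simpa using WithTop.coe_le_coe.2 (le_top (a := (2 : ℕ∞))))) _ _

theorem IsTestFunction.partialDeriv {D : Set Plane} {φ : Plane → ℝ} (h : IsTestFunction D φ)
    (i : Fin 2) : IsTestFunction D (partialDeriv i φ) := by
  refine ⟨contDiff_partialDeriv h.1 i, h.hasCompactSupport_partialDeriv i, ?_⟩
  exact (tsupport_fderiv_apply_subset ℝ _).trans h.2.2

/-- Both derivatives are moved to the test function, where they commute classically. -/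
theorem MemH2.weakPartial_comm {D : Set Plane} (hD : IsOpen D) {g : Plane → ℝ} (h : MemH2 D g)
    (i j : Fin 2) :
    weakPartial D i (weakPartial D j g) =ᵐ[volume.restrict D]
      weakPartial D j (weakPartial D i g) := by
  have h1 := ((h.2 j).2 i).isWeakPartial
  have h2 := ((h.2 i).2 j).isWeakPartial
  refine (IsWeakPartial.weakPartial_ae_eq hD (fun φ hφ => ?_) ((h.2 i).2 j).memLp_weakPartial)
  have a1 := (h.1.2 j).isWeakPartial _ (hφ.partialDeriv i)
  have a2 := (h.1.2 i).isWeakPartial _ (hφ.partialDeriv j)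
  have a3 := h2 φ hφ
  simp only [partialDeriv_comm hφ.1 j i] at a1
  rw [a2] at a1
  rw [← a3]
  linarith

theorem eLpNorm_sq_eq_ofReal_integral {α : Type*} [MeasurableSpace α] {μ : Measure α}
    {f : α → ℝ} (hf : MemLp f 2 μ) : eLpNorm f 2 μ ^ 2 = ENNReal.ofReal (∫ x, f x ^ 2 ∂μ) := by
  rw [eLpNorm_two_sq, ofReal_integral_eq_lintegral_ofReal hf.integrable_sq
    (ae_of_all _ fun x => sq_nonneg _)]

theorem IsTrace.integral_sq_le {D s : Set Plane} {g τ : Plane → ℝ} {A B : ℝ} (hA : 0 ≤ A)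
    (hB : 0 ≤ B) (h : IsTrace D s g τ) (hg : MemH1 D g)
    (hAB : TraceBound D s (ENNReal.ofReal A) (ENNReal.ofReal B)) :
    ∫ x in s, τ x ^ 2 ∂(μH[1] : Measure Plane) ≤
      A * (∫ x in D, g x ^ 2) + B * ∑ i, ∫ x in D, weakPartial D i g x ^ 2 := by
  have hb := h.bound hg hAB ENNReal.ofReal_ne_top ENNReal.ofReal_ne_top
  have n1 : 0 ≤ ∫ x in D, g x ^ 2 := integral_nonneg fun x => sq_nonneg _
  have n2 : ∀ i, 0 ≤ ∫ x in D, weakPartial D i g x ^ 2 := fun i =>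
    integral_nonneg fun x => sq_nonneg _
  rw [eLpNorm_sq_eq_ofReal_integral h.1, eLpNorm_sq_eq_ofReal_integral hg.1] at hb
  simp only [fun i => eLpNorm_sq_eq_ofReal_integral (hg.2 i).memLp_weakPartial] at hb
  rw [← ENNReal.ofReal_sum_of_nonneg fun i _ => n2 i, ← ENNReal.ofReal_mul hA,
    ← ENNReal.ofReal_mul hB, ← ENNReal.ofReal_add (mul_nonneg hA n1)
      (mul_nonneg hB (Finset.sum_nonneg fun i _ => n2 i))] at hb
  exact (ENNReal.ofReal_le_ofReal_iff (add_nonneg (mul_nonneg hA n1)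
    (mul_nonneg hB (Finset.sum_nonneg fun i _ => n2 i)))).1 hb

theorem MemH1.semi1Sq_eq {D : Set Plane} {g : Plane → ℝ} (h : MemH1 D g) :
    semi1Sq D g = ∑ i, ∫ x in D, weakPartial D i g x ^ 2 := by
  rw [semi1Sq, integral_finsetSum _ fun i _ => (h.2 i).memLp_weakPartial.integrable_sq]

theorem MemH2.semi2Sq_eq {D : Set Plane} {g : Plane → ℝ} (h : MemH2 D g) :
    semi2Sq D g = (∫ x in D, weakPartial D 0 (weakPartial D 0 g) x ^ 2) +
      (∫ x in D, weakPartial D 1 (weakPartial D 0 g) x ^ 2) +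
      ∫ x in D, weakPartial D 1 (weakPartial D 1 g) x ^ 2 := by
  have hi := fun i j => ((h.2 i).2 j).memLp_weakPartial.integrable_sq
  have hi2 : Integrable (fun x => weakPartial D 0 (weakPartial D 0 g) x ^ 2 +
      weakPartial D 1 (weakPartial D 0 g) x ^ 2) (volume.restrict D) := (hi 0 0).add (hi 0 1)
  rw [semi2Sq, integral_add hi2 (hi 1 1), integral_add (hi 0 0) (hi 0 1)]

/-- The double sum counts the mixed derivative twice while `semi2Sq` counts it once; hence the
factor `2`. -/
theorem MemH2.sum_sum_le_semi2Sq {D : Set Plane} (hD : IsOpen D) {g : Plane → ℝ}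
    (h : MemH2 D g) :
    ∑ i, ∑ j, ∫ x in D, weakPartial D j (weakPartial D i g) x ^ 2 ≤ 2 * semi2Sq D g := by
  have e : ∫ x in D, weakPartial D 0 (weakPartial D 1 g) x ^ 2 =
      ∫ x in D, weakPartial D 1 (weakPartial D 0 g) x ^ 2 :=
    integral_congr_ae (by
      filter_upwards [h.weakPartial_comm hD 0 1] with x hx
      rw [hx])
  rw [h.semi2Sq_eq]
  simp only [Fin.sum_univ_two, e]
  have n : ∀ i, 0 ≤ ∫ x in D, weakPartial D i (weakPartial D i g) x ^ 2 := fun i =>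
    integral_nonneg fun x => sq_nonneg _
  linarith [n 0, n 1]

theorem semi1Sq_nonneg (D : Set Plane) (g : Plane → ℝ) : 0 ≤ semi1Sq D g :=
  integral_nonneg fun _ => Finset.sum_nonneg fun _ _ => sq_nonneg _

theorem semi2Sq_nonneg (D : Set Plane) (g : Plane → ℝ) : 0 ≤ semi2Sq D g :=
  integral_nonneg fun x => by dsimp only [Pi.zero_apply]; positivity

/-! ### Admissible meshes -/

/-- A primary and a dual partition with at most `N` gridlines in each element and shape
regularity constant `ϱ`. -/
structure AdmissibleMesh (Ω : Set Plane) (T Ts : Finset (Set Plane)) (N : ℕ) (ϱ : ℝ) : Prop where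
  domain : IsPolygonalDomain Ω
  primary : IsPrimaryPartition Ω T
  dual : IsDualPartition Ω Ts
  encard_le : ∀ K ∈ T, (dualGridlines Ts K).encard ≤ (N : ℕ∞)
  pos : 0 < ϱ
  regular : ∀ K ∈ T, ϱ * Metric.diam K ≤ inDiam K

theorem hausdorffMeasure_one_finite {F : Set Plane} (hF : F.Finite) :
    (μH[1] : Measure Plane) F = 0 := by
  rw [← Set.biUnion_of_singleton F]
  refine (measure_biUnion_null_iff hF.countable).2 fun x _ => ?_
  rw [← segment_same ℝ x, hausdorffMeasure_segment, edist_self]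

namespace AdmissibleMesh

variable {Ω : Set Plane} {T Ts : Finset (Set Plane)} {N : ℕ} {ϱ : ℝ} {K Ks l : Set Plane}

theorem subset_closure (m : AdmissibleMesh Ω T Ts N ϱ) (hK : K ∈ T) :
    K ⊆ closure Ω := by
  rw [m.primary.1.1]; exact Set.subset_biUnion_of_mem (u := id) hK

theorem interior_subset_domain (m : AdmissibleMesh Ω T Ts N ϱ) (hK : K ∈ T) :
    interior K ⊆ Ω := by
  have := interior_mono (m.subset_closure hK)
  rwa [m.domain.2.2.2.1] at this

theorem finite_dualGridlines (m : AdmissibleMesh Ω T Ts N ϱ) (hK : K ∈ T) :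
    (dualGridlines Ts K).Finite :=
  Set.finite_of_encard_le_coe (m.encard_le K hK)

theorem exists_closedBall (m : AdmissibleMesh Ω T Ts N ϱ) (hK : K ∈ T) :
    ∃ c r, 0 < r ∧ ϱ * Metric.diam K / 4 ≤ r ∧
    Metric.closedBall c r ⊆ K :=
  exists_closedBall_subset_of_inDiam m.pos (m.primary.convex_isCompact hK).2.2 (m.regular K hK)

theorem isBounded (m : AdmissibleMesh Ω T Ts N ϱ) (hK : K ∈ T) :
    Bornology.IsBounded K := (m.primary.convex_isCompact hK).2.1.isBounded

theorem isBounded_dualSkeleton (m : AdmissibleMesh Ω T Ts N ϱ) (hK : K ∈ T) :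
    Bornology.IsBounded (dualSkeleton Ts K) :=
  (m.isBounded hK).subset (Set.inter_subset_right.trans interior_subset)

/-- Only finiteness of the constants matters here: the bound is for existence and uniqueness of
traces, and the scaled constants are obtained separately on each gridline. -/
theorem exists_traceBound_dualSkeleton (m : AdmissibleMesh Ω T Ts N ϱ) (hK : K ∈ T) :
    ∃ A B : ℝ≥0∞, A ≠ ⊤ ∧ B ≠ ⊤ ∧
    TraceBound (interior K) (dualSkeleton Ts K) A B := by
  obtain ⟨hc, hcomp, -⟩ := m.primary.convex_isCompact hK
  obtain ⟨F, hF, hsub⟩ := dualSkeleton_subset m.dual hcomp (m.subset_closure hK)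
  obtain ⟨c, r, hr, -, hball⟩ := m.exists_closedBall hK
  have hfin := m.finite_dualGridlines hK
  obtain ⟨A, B, hA, hB, h⟩ := TraceBound.biUnion_finset (D := interior K) hfin.toFinset
    (fun l : Set Plane => l) (fun l hl => by
      rw [Set.Finite.mem_toFinset] at hl
      obtain ⟨K₁, -, K₂, -, -, p, q, hpq, rfl, hl, -⟩ := hl
      exact ⟨_, _, ENNReal.ofReal_ne_top, ENNReal.ofReal_ne_top,
        traceBound_of_convex hc hcomp hr hball hpq fun x hx => (hl hx).2⟩)
  refine ⟨0 + A, 0 + B, by simpa, by simpa, ((TraceBound.of_null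
    (hausdorffMeasure_one_finite hF)).union h).mono_set ?_⟩
  simpa using hsub

theorem isTrace_gradTrace (m : AdmissibleMesh Ω T Ts N ϱ) (hK : K ∈ T)
    {w : Plane → ℝ} (hw : MemH2 (interior K) w) (i : Fin 2) :
    IsTrace (interior K) (dualSkeleton Ts K) (weakPartial (interior K) i w)
      (fun x => gradTrace Ts K w x i) := by
  obtain ⟨hc, hcomp, -⟩ := m.primary.convex_isCompact hK
  obtain ⟨A, B, hA, hB, hAB⟩ := m.exists_traceBound_dualSkeleton hK
  exact isTrace_traceOn ((hw.2 i).exists_isTrace isOpen_interior hc.interior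
    ((m.isBounded hK).subset interior_subset) hA hB hAB (m.isBounded_dualSkeleton hK)
    (measure_dualSkeleton_lt_top m.dual K).ne)

/-- `gradTrace` is a chosen function, so its linearity is the uniqueness of traces applied to the
combination. -/
theorem gradTrace_add_smul (m : AdmissibleMesh Ω T Ts N ϱ) (hK : K ∈ T)
    {w w₁ w₂ : Plane → ℝ} {c : ℝ} (h1 : MemH2 (interior K) w₁)
    (h2 : MemH2 (interior K) w₂) (e : w =ᵐ[volume.restrict (interior K)] w₁ + c • w₂) :
    ∀ᵐ x ∂(μH[1] : Measure Plane).restrict (dualSkeleton Ts K), ∀ i,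
      gradTrace Ts K w x i = gradTrace Ts K w₁ x i + c * gradTrace Ts K w₂ x i := by
  obtain ⟨A, B, hA, hB, hAB⟩ := m.exists_traceBound_dualSkeleton hK
  have hD := isOpen_interior (s := K)
  have hw : MemH2 (interior K) w := (h1.add_smul hD h2 c).congr hD e.symm
  rw [ae_all_iff]
  intro i
  have t0 := m.isTrace_gradTrace hK hw i
  have t1 := m.isTrace_gradTrace hK h1 i
  have t2 := m.isTrace_gradTrace hK h2 i
  have t3 := t1.add_smul hD t2 (h1.2 i) (h2.2 i) c
  have ew : weakPartial (interior K) i w =ᵐ[volume.restrict (interior K)]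
      weakPartial (interior K) i w₁ + c • weakPartial (interior K) i w₂ :=
    (((h1.1.add_smul h2.1 c).2 i).weakPartial_congr hD e.symm).trans
      (h1.1.weakPartial_add_smul hD h2.1 c i)
  have t4 := t3.congr hD ((h1.2 i).add_smul (h2.2 i) c) ew.symm
  filter_upwards [t0.ae_unique hD t4 (hw.2 i) hAB hA hB] with x hx
  rw [hx]
  simp

end AdmissibleMesh

/-! ### Traces of the gradient on the gridlines -/

theorem memLp_gradTrace (Ts : Finset (Set Plane)) (K : Set Plane) (w : Plane → ℝ) (i : Fin 2) : MemLp (fun x => gradTrace Ts K w x i) 2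
    ((μH[1] : Measure Plane).restrict (dualSkeleton Ts K)) :=
  memLp_traceOn _ _ _

/-- A gridline lies in the skeleton up to its end points. -/
theorem dualGridline_ae_le_dualSkeleton {Ω : Set Plane} {Ts : Finset (Set Plane)}
    (hTs : IsDualPartition Ω Ts) {K l : Set Plane} (hc : Convex ℝ K) (hl : l ∈ dualGridlines Ts K) :
    l ≤ᵐ[(μH[1] : Measure Plane)] dualSkeleton Ts K := by
  obtain ⟨K₁, hK1, K₂, hK2, hne, p, q, hpq, rfl, hsub, ⟨y, hy, hyK⟩, -⟩ := hl
  rw [ae_le_set]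
  refine measure_mono_null (t := {p, q}) ?_ (hausdorffMeasure_one_finite (Set.toFinite _))
  rintro x ⟨hx, hxs⟩
  by_contra hxpq
  simp only [Set.mem_insert_iff, Set.mem_singleton_iff, not_or] at hxpq
  have hpK : p ∈ K := (hsub (left_mem_segment ℝ p q)).2
  have hqK : q ∈ K := (hsub (right_mem_segment ℝ p q)).2
  have hxK : x ∈ interior K := by
    have hopen : x ∈ openSegment ℝ p q := by
      rw [← insert_endpoints_openSegment] at hx
      rcases hx with h | h | h
      · exact absurd h hxpq.1
      · exact absurd h hxpq.2
      · exact h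
    have hline : ∀ {a b : Plane}, a ∈ interior K → b ∈ K → x ∈ openSegment ℝ a b →
        x ∈ interior K := fun ha hb hx => hc.openSegment_interior_self_subset_interior ha hb hx
    rw [segment_eq_image'] at hy
    rw [openSegment_eq_image'] at hopen
    obtain ⟨s, hs, rfl⟩ := hy
    obtain ⟨t, ht, rfl⟩ := hopen
    -- `y` is a point of the segment interior to `K`. Any other `x` strictly between the end points
    -- lies strictly between `y` and one of them, hence is interior by convexity.
    rcases lt_trichotomy s t with hst | rfl | hst
    · refine hline hyK hqK ?_
      rw [openSegment_eq_image']
      have h1 : 0 < 1 - s := by linarith [ht.2]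
      refine ⟨(t - s) / (1 - s), ⟨div_pos (by linarith) h1, (div_lt_one h1).2 (by linarith [ht.2])⟩,
        ?_⟩
      have : q - (p + s • (q - p)) = (1 - s) • (q - p) := by
        rw [sub_smul, one_smul]; abel
      dsimp only
      rw [this, smul_smul, div_mul_cancel₀ _ h1.ne', add_assoc, ← add_smul]
      congr 2; ring
    · exact hyK
    · refine hline hyK hpK ?_
      rw [openSegment_eq_image']
      have h1 : 0 < s := ht.1.trans hst
      refine ⟨(s - t) / s, ⟨div_pos (by linarith) h1, (div_lt_one h1).2 (by linarith [ht.1])⟩, ?_⟩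
      have : p - (p + s • (q - p)) = (-s) • (q - p) := by
        rw [neg_smul]; abel
      dsimp only
      rw [this, smul_smul, add_assoc, ← add_smul]
      congr 2; field_simp; ring
  refine hxs ⟨Set.mem_iUnion₂.2 ⟨K₁, hK1, ?_⟩, hxK⟩
  have hx12 := (hsub hx).1
  refine ⟨_root_.subset_closure hx12.1, fun hin => ?_⟩
  have : x ∈ closure (interior K₂) := by rw [(hTs.2 K₂ hK2).facts.2.1]; exact hx12.2
  obtain ⟨z, hz1, hz2⟩ := mem_closure_iff.1 this _ isOpen_interior hin
  exact Set.disjoint_left.1 (hTs.1.2 K₁ hK1 K₂ hK2 hne) hz1 hz2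

/-- Inclusion up to a null set is needed because the end points of a gridline may lie on the
boundary of `K`, outside the skeleton. -/
theorem IsTrace.mono_ae {D s s' : Set Plane} {g τ : Plane → ℝ} (h : IsTrace D s g τ)
    (hs : s' ≤ᵐ[(μH[1] : Measure Plane)] s) : IsTrace D s' g τ := by
  obtain ⟨hτ, φ, h1, h2, h3, h4⟩ := h
  have hle := Measure.restrict_mono' hs (le_refl (μH[1] : Measure Plane))
  exact ⟨hτ.mono_measure hle, φ, h1, h2, h3,
    tendsto_of_tendsto_of_tendsto_of_le_of_le tendsto_const_nhds h4 (fun _ => zero_le)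
      fun n => eLpNorm_mono_measure _ hle⟩

/-- The scaled trace inequality for the gradient on a gridline. -/
theorem AdmissibleMesh.gradTrace_gridline_le {Ω : Set Plane} {T Ts : Finset (Set Plane)} {N : ℕ}
    {ϱ : ℝ} (m : AdmissibleMesh Ω T Ts N ϱ) {K l : Set Plane} (hK : K ∈ T)
    (hl : l ∈ dualGridlines Ts K) {w : Plane → ℝ} (hw : MemH2 (interior K) w) :
    (μH[1] : Measure Plane).real l *
      ∑ i, ∫ x in l, gradTrace Ts K w x i ^ 2 ∂(μH[1] : Measure Plane) ≤
      24 / ϱ * (semi1Sq (interior K) w + Metric.diam K ^ 2 * semi2Sq (interior K) w) := by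
  obtain ⟨hc, hcomp, hdiam⟩ := m.primary.convex_isCompact hK
  obtain ⟨c, r, hr, hrd, hball⟩ := m.exists_closedBall hK
  have hϱ := m.pos
  have hae := dualGridline_ae_le_dualSkeleton m.dual hc hl
  obtain ⟨K₁, -, K₂, -, -, p, q, hpq, rfl, hsub, -⟩ := hl
  have hsK : segment ℝ p q ⊆ K := fun x hx => (hsub hx).2
  have htb := traceBound_of_convex hc hcomp hr hball hpq hsK
  set h := Metric.diam K
  have hlen : (μH[1] : Measure Plane).real (segment ℝ p q) ≤ h := by
    rw [measureReal_def, hausdorffMeasure_segment, ← dist_edist]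
    exact Metric.dist_le_diam_of_mem hcomp.isBounded (hsK (left_mem_segment ℝ p q))
      (hsK (right_mem_segment ℝ p q))
  have hi : ∀ i, ∫ x in segment ℝ p q, gradTrace Ts K w x i ^ 2 ∂(μH[1] : Measure Plane) ≤
      3 / (r / 2) * (∫ x in interior K, weakPartial (interior K) i w x ^ 2) +
      h ^ 2 / (r / 2) * ∑ j, ∫ x in interior K,
        weakPartial (interior K) j (weakPartial (interior K) i w) x ^ 2 := fun i =>
    ((m.isTrace_gradTrace hK hw i).mono_ae hae).integral_sq_le (by positivity) (by positivity)
      (hw.2 i) htb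
  have hsum := Finset.sum_le_sum fun i (_ : i ∈ Finset.univ) => hi i
  rw [Finset.sum_add_distrib, ← Finset.mul_sum, ← Finset.mul_sum, ← hw.1.semi1Sq_eq] at hsum
  have h2 := hw.sum_sum_le_semi2Sq isOpen_interior
  have n0 : 0 ≤ ∑ i, ∫ x in segment ℝ p q, gradTrace Ts K w x i ^ 2 ∂(μH[1] : Measure Plane) :=
    Finset.sum_nonneg fun i _ => integral_nonneg fun x => sq_nonneg _
  have n1 := semi1Sq_nonneg (interior K) w
  have n2 := semi2Sq_nonneg (interior K) w
  -- Shape regularity, `r ≥ ϱ h / 4`. The trace constants `3/(r/2)` and `h²/(r/2)`, the latter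
  -- doubled by the mixed derivative, then give `24 / ϱ`.
  have hhr : h / r ≤ 4 / ϱ := by
    rw [div_le_div_iff₀ hr hϱ]; linarith
  calc _ ≤ h * (3 / (r / 2) * semi1Sq (interior K) w +
        h ^ 2 / (r / 2) * (2 * semi2Sq (interior K) w)) :=
        mul_le_mul hlen (hsum.trans (by gcongr)) n0 hdiam.le
    _ = h / r * (6 * semi1Sq (interior K) w + 4 * (h ^ 2 * semi2Sq (interior K) w)) := by
        field_simp; ring
    _ ≤ 4 / ϱ * (6 * semi1Sq (interior K) w + 6 * (h ^ 2 * semi2Sq (interior K) w)) := by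
        gcongr; norm_num
    _ = _ := by ring

/-! ### Coefficients -/

/-- Coefficients that are continuous on `Ω` and bounded by `M`. -/
structure BoundedCoeff (Ω : Set Plane) (a : Plane → Matrix (Fin 2) (Fin 2) ℝ) (b : Plane → ℝ)
    (M : ℝ) : Prop where
  pos : 0 < M
  cont_a : ∀ i j, ContinuousOn (fun x => a x i j) Ω
  cont_b : ContinuousOn b Ω
  a_le : ∀ x ∈ Ω, ∀ i j, |a x i j| ≤ M
  b_le : ∀ x ∈ Ω, |b x| ≤ M

/-- A continuous function exceeding its essential supremum would do so on an open set of positive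
measure. The bound must hold pointwise since the coefficients are also integrated over gridlines,
which have area zero. -/
theorem exists_forall_abs_le_of_memLp_top {Ω : Set Plane} (hΩ : IsOpen Ω) {f : Plane → ℝ}
    (hc : ContinuousOn f Ω) (hf : MemLp f ⊤ (volume.restrict Ω)) :
    ∃ M, ∀ x ∈ Ω, |f x| ≤ M := by
  have hfin := hf.2
  rw [eLpNorm_exponent_top] at hfin
  have hae := ae_le_eLpNormEssSup (f := f) (μ := volume.restrict Ω)
  refine ⟨(eLpNormEssSup f (volume.restrict Ω)).toReal, fun x hx => ?_⟩
  by_contra hlt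
  push Not at hlt
  set M := (eLpNormEssSup f (volume.restrict Ω)).toReal
  have hopen : IsOpen (Ω ∩ (fun x => |f x|) ⁻¹' Set.Ioi M) :=
    hc.abs.isOpen_inter_preimage hΩ isOpen_Ioi
  have hpos := hopen.measure_pos volume ⟨x, hx, hlt⟩
  rw [ae_restrict_iff' hΩ.measurableSet, ae_iff] at hae
  refine hpos.ne' (measure_mono_null ?_ hae)
  rintro y ⟨hy, hyM⟩
  simp only [Classical.not_imp, Set.mem_ofPred_eq, not_le]
  refine ⟨hy, ?_⟩
  rw [← ENNReal.ofReal_toReal hfin.ne, ← ofReal_norm, Real.norm_eq_abs]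
  exact (ENNReal.ofReal_lt_ofReal_iff ((ENNReal.toReal_nonneg).trans_lt hyM)).2 hyM

theorem IsEllipticData.exists_boundedCoeff {Ω : Set Plane} (hΩ : IsPolygonalDomain Ω)
    {a : Plane → Matrix (Fin 2) (Fin 2) ℝ} {b : Plane → ℝ} (h : IsEllipticData Ω a b) :
    ∃ M, BoundedCoeff Ω a b M := by
  obtain ⟨-, ha, -, hb, -⟩ := h
  choose A hA using fun i j =>
    exists_forall_abs_le_of_memLp_top hΩ.1 (ha i j).1 (ha i j).2.1
  obtain ⟨B, hB⟩ := hΩ.2.2.1.isCompact_closure.exists_bound_of_continuousOn hb.continuousOn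
  refine ⟨1 + ∑ i, ∑ j, |A i j| + |B|, by positivity, fun i j => (ha i j).1,
    hb.continuousOn.mono subset_closure, fun x hx i j => ?_, fun x hx => ?_⟩
  · have h1 : |A i j| ≤ ∑ i, ∑ j, |A i j| :=
      (Finset.single_le_sum (f := fun j => |A i j|) (fun _ _ => abs_nonneg _)
        (Finset.mem_univ j)).trans
        (Finset.single_le_sum (f := fun i => ∑ j, |A i j|)
          (fun _ _ => Finset.sum_nonneg fun _ _ => abs_nonneg _) (Finset.mem_univ i))
    linarith [hA i j x hx, le_abs_self (A i j), abs_nonneg B]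
  · have h1 : 0 ≤ ∑ i, ∑ j, |A i j| :=
      Finset.sum_nonneg fun _ _ => Finset.sum_nonneg fun _ _ => abs_nonneg _
    have := hB x (subset_closure hx)
    rw [Real.norm_eq_abs] at this
    linarith [le_abs_self B]

theorem integrable_coeff_mul {Ω s : Set Plane} {μ : Measure Plane} (hs : MeasurableSet s)
    (hsΩ : s ⊆ Ω) {α : Plane → ℝ} {M : ℝ} (hα : ContinuousOn α Ω) (hM : ∀ x ∈ Ω, |α x| ≤ M)
    {f g : Plane → ℝ} (hf : MemLp f 2 (μ.restrict s)) (hg : MemLp g 2 (μ.restrict s)) :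
    Integrable (fun x => α x * (f x * g x)) (μ.restrict s) :=
  (hf.integrable_mul hg).bdd_mul ((hα.mono hsΩ).aestronglyMeasurable hs)
    (ae_restrict_of_forall_mem hs fun x hx => hM x (hsΩ hx))

/-- The bilinear form of a matrix. -/
def matrixForm (A : Matrix (Fin 2) (Fin 2) ℝ) (g h : Fin 2 → ℝ) : ℝ :=
  ∑ i, ∑ j, A i j * (g i * h j)

theorem dotProduct_mulVec_eq_matrixForm (A : Matrix (Fin 2) (Fin 2) ℝ) (g h : Fin 2 → ℝ) :
    g ⬝ᵥ A.mulVec h = matrixForm A g h := by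
  simp only [dotProduct, Matrix.mulVec, matrixForm, Fin.sum_univ_two]; ring

theorem mulVec_dotProduct_eq_matrixForm (A : Matrix (Fin 2) (Fin 2) ℝ) (g n : Fin 2 → ℝ) (τ : ℝ) :
    τ * (A.mulVec g ⬝ᵥ n) = matrixForm A (fun i => τ * n i) g := by
  simp only [dotProduct, Matrix.mulVec, matrixForm, Fin.sum_univ_two]; ring

/-- Young's inequality on each entry; summing over the other index contributes a factor `2`, which
cancels the `1/2`. The weight `t` stays free to be adapted to the length of a gridline. -/
theorem abs_matrixForm_le {A : Matrix (Fin 2) (Fin 2) ℝ} {M t : ℝ} (hA : ∀ i j, |A i j| ≤ M)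
    (ht : 0 < t) (g h : Fin 2 → ℝ) :
    |matrixForm A g h| ≤ M * (t * ∑ i, g i ^ 2 + (∑ i, h i ^ 2) / t) := by
  have hM : 0 ≤ M := (abs_nonneg _).trans (hA 0 0)
  have key : ∀ i j, |A i j * (g i * h j)| ≤ M * ((t * g i ^ 2 + h j ^ 2 / t) / 2) := by
    intro i j
    rw [abs_mul]
    refine mul_le_mul (hA i j) ?_ (abs_nonneg _) hM
    have h1 : t * g i ^ 2 + h j ^ 2 / t = ((t * g i) ^ 2 + h j ^ 2) / t := by field_simp
    rw [h1, div_div, le_div_iff₀ (by positivity), ← abs_of_pos (mul_pos ht two_pos), ← abs_mul,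
      abs_le]
    constructor <;> nlinarith [sq_nonneg (t * g i - h j), sq_nonneg (t * g i + h j)]
  calc |matrixForm A g h| ≤ ∑ i, ∑ j, |A i j * (g i * h j)| :=
        (Finset.abs_sum_le_sum_abs _ _).trans
          (Finset.sum_le_sum fun i _ => Finset.abs_sum_le_sum_abs _ _)
    _ ≤ ∑ i, ∑ j, M * ((t * g i ^ 2 + h j ^ 2 / t) / 2) :=
        Finset.sum_le_sum fun i _ => Finset.sum_le_sum fun j _ => key i j
    _ = _ := by simp only [Fin.sum_univ_two]; ring

theorem abs_mul_mul_le {β M t : ℝ} (hβ : |β| ≤ M) (ht : 0 < t) (w v : ℝ) :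
    |β * w * v| ≤ M * (t * w ^ 2 + v ^ 2 / t) := by
  have hM : 0 ≤ M := (abs_nonneg _).trans hβ
  rw [mul_assoc, abs_mul]
  refine mul_le_mul hβ ?_ (abs_nonneg _) hM
  have h1 : t * w ^ 2 + v ^ 2 / t = ((t * w) ^ 2 + v ^ 2) / t := by field_simp
  rw [h1, le_div_iff₀ ht, ← abs_of_pos ht, ← abs_mul, abs_of_pos ht, abs_le]
  constructor <;> nlinarith [sq_nonneg (t * w - v), sq_nonneg (t * w + v)]

theorem BoundedCoeff.integrable_matrixForm {Ω s : Set Plane}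
    {a : Plane → Matrix (Fin 2) (Fin 2) ℝ} {b : Plane → ℝ} {M : ℝ} (hab : BoundedCoeff Ω a b M)
    {μ : Measure Plane} (hs : MeasurableSet s) (hsΩ : s ⊆ Ω) {g h : Plane → Fin 2 → ℝ}
    (hg : ∀ i, MemLp (fun x => g x i) 2 (μ.restrict s))
    (hh : ∀ i, MemLp (fun x => h x i) 2 (μ.restrict s)) :
    Integrable (fun x => matrixForm (a x) (g x) (h x)) (μ.restrict s) := by
  unfold matrixForm
  exact integrable_finsetSum _ fun i _ => integrable_finsetSum _ fun j _ =>
    integrable_coeff_mul hs hsΩ (hab.cont_a i j) (fun x hx => hab.a_le x hx i j) (hg i) (hh j)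

theorem BoundedCoeff.integrable_mul_mul {Ω s : Set Plane}
    {a : Plane → Matrix (Fin 2) (Fin 2) ℝ} {b : Plane → ℝ} {M : ℝ} (hab : BoundedCoeff Ω a b M)
    {μ : Measure Plane} (hs : MeasurableSet s) (hsΩ : s ⊆ Ω) {w v : Plane → ℝ}
    (hw : MemLp w 2 (μ.restrict s)) (hv : MemLp v 2 (μ.restrict s)) :
    Integrable (fun x => b x * w x * v x) (μ.restrict s) := by
  simp only [mul_assoc]
  exact integrable_coeff_mul hs hsΩ hab.cont_b hab.b_le hw hv

/-! ### The two parts of the discrete form -/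

/-- The contribution of `K ∩ K*` to the discrete form. -/
noncomputable def volumePart (a : Plane → Matrix (Fin 2) (Fin 2) ℝ) (b : Plane → ℝ)
    (K Ks : Set Plane) (w v : Plane → ℝ) : ℝ :=
  ∫ x in interior K ∩ interior Ks,
    (matrixForm (a x) (weakGrad (interior K) w x) (weakGrad (interior K ∩ interior Ks) v x) +
      b x * w x * v x)

/-- The contribution of `∂K* ∩ int K` to the discrete form. -/
noncomputable def boundaryPart (a : Plane → Matrix (Fin 2) (Fin 2) ℝ) (Ts : Finset (Set Plane))
    (K Ks : Set Plane) (w v : Plane → ℝ) : ℝ :=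
  ∫ x in frontier Ks ∩ interior K,
    matrixForm (a x) (fun i => innerTrace K Ks v x * outerNormal Ks x i) (gradTrace Ts K w x)
      ∂(μH[1] : Measure Plane)

theorem form_eq (a : Plane → Matrix (Fin 2) (Fin 2) ℝ) (b : Plane → ℝ) (T Ts : Finset (Set Plane))
    (w v : Plane → ℝ) : form a b T Ts w v =
      ∑ K ∈ T, ∑ Ks ∈ Ts, (volumePart a b K Ks w v - boundaryPart a Ts K Ks w v) := by
  simp only [form, volumePart, boundaryPart, dotProduct_mulVec_eq_matrixForm,
    mulVec_dotProduct_eq_matrixForm]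

/-- `v` agrees with a smooth function on each `K ∩ K*`. -/
def IsPiecewiseSmooth (T Ts : Finset (Set Plane)) (v : Plane → ℝ) : Prop :=
  ∀ K ∈ T, ∀ Ks ∈ Ts, ∃ φ : Plane → ℝ, ContDiff ℝ ∞ φ ∧
    v =ᵐ[volume.restrict (interior K ∩ interior Ks)] φ

theorem IsPiecewisePolynomial.isPiecewiseSmooth {T Ts : Finset (Set Plane)} {v : Plane → ℝ}
    (h : IsPiecewisePolynomial T Ts v) : IsPiecewiseSmooth T Ts v := fun K hK Ks hKs =>
  let ⟨p, hp⟩ := h K hK Ks hKs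
  ⟨_, contDiff_eval_mvPolynomial p, hp⟩

theorem memLp_innerTrace_mul_outerNormal {K Ks : Set Plane} (hKs : IsClosed Ks) (v : Plane → ℝ)
    (i : Fin 2) : MemLp (fun x => innerTrace K Ks v x * outerNormal Ks x i) 2
      ((μH[1] : Measure Plane).restrict (frontier Ks ∩ interior K)) := by
  have h1 : MemLp (innerTrace K Ks v) 2
    ((μH[1] : Measure Plane).restrict (frontier Ks ∩ interior K)) := memLp_traceOn _ _ _
  have hm : Measurable fun x => outerNormal Ks x i :=
    (EuclideanSpace.proj i : Plane →L[ℝ] ℝ).continuous.measurable.comp (measurable_outerNormal hKs)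
  refine h1.mono (h1.1.mul hm.aestronglyMeasurable) (ae_of_all _ fun x => ?_)
  rw [norm_mul]
  refine mul_le_of_le_one_right (norm_nonneg _) ?_
  exact (PiLp.norm_apply_le (outerNormal Ks x) i).trans (norm_outerNormal_le Ks x)

theorem outerNormal_eq_zero_of_notMem_frontier {Ks : Set Plane} {x : Plane}
    (hx : x ∉ frontier Ks) : outerNormal Ks x = 0 := by
  by_contra hne
  obtain ⟨ν, hν⟩ := exists_isOuterNormal_of_ne hne
  exact hx hν.mem_frontier

theorem frontier_inter_subset_dualSkeleton {Ts : Finset (Set Plane)} {Ks : Set Plane}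
    (hKs : Ks ∈ Ts) (K : Set Plane) : frontier Ks ∩ interior K ⊆ dualSkeleton Ts K :=
  Set.inter_subset_inter_left _ (Set.subset_biUnion_of_mem (u := fun Ks => frontier Ks) hKs)

/-- The normal vanishes off the frontier of the control volume, so the product is its own extension
by zero to the whole skeleton. -/
theorem memLp_innerTrace_mul_outerNormal_dualSkeleton {Ts : Finset (Set Plane)} {K Ks : Set Plane}
    (hKs : Ks ∈ Ts) (hcl : IsClosed Ks) (v : Plane → ℝ) (i : Fin 2) :
    MemLp (fun x => innerTrace K Ks v x * outerNormal Ks x i) 2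
      ((μH[1] : Measure Plane).restrict (dualSkeleton Ts K)) := by
  have hs : MeasurableSet (frontier Ks ∩ interior K) :=
    isClosed_frontier.measurableSet.inter isOpen_interior.measurableSet
  have h1 := memLp_innerTrace_mul_outerNormal (K := K) hcl v i
  rw [← Measure.restrict_restrict_of_subset (frontier_inter_subset_dualSkeleton hKs K),
    ← memLp_indicator_iff_restrict hs] at h1
  refine (memLp_congr_ae ?_).1 h1
  filter_upwards [ae_restrict_mem (measurableSet_dualSkeleton Ts K)] with x hx
  by_cases hxf : x ∈ frontier Ks ∩ interior K
  · rw [Set.indicator_of_mem hxf]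
  · rw [Set.indicator_of_notMem hxf, outerNormal_eq_zero_of_notMem_frontier fun h =>
      hxf ⟨h, hx.2⟩]
    simp

section Linear

variable {Ω : Set Plane} {T Ts : Finset (Set Plane)} {N : ℕ} {ϱ : ℝ} {K Ks : Set Plane}
  {a : Plane → Matrix (Fin 2) (Fin 2) ℝ} {b : Plane → ℝ} {M : ℝ}

theorem AdmissibleMesh.memH1_of_isPiecewiseSmooth (m : AdmissibleMesh Ω T Ts N ϱ) (hK : K ∈ T)
    (hKs : Ks ∈ Ts) {v : Plane → ℝ} (hv : IsPiecewiseSmooth T Ts v) :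
    MemH1 (interior K ∩ interior Ks) v := by
  obtain ⟨φ, hφ, e⟩ := hv K hK Ks hKs
  exact (memH1_of_contDiff hφ ((m.isBounded hK).subset
    (Set.inter_subset_left.trans interior_subset))).congr e.symm

theorem AdmissibleMesh.integrable_volumePart (m : AdmissibleMesh Ω T Ts N ϱ)
    (hab : BoundedCoeff Ω a b M) (hK : K ∈ T) (hKs : Ks ∈ Ts) {w v : Plane → ℝ}
    (hw : MemH2 (interior K) w) (hv : IsPiecewiseSmooth T Ts v) :
    Integrable (fun x => matrixForm (a x) (weakGrad (interior K) w x)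
      (weakGrad (interior K ∩ interior Ks) v x) + b x * w x * v x)
      (volume.restrict (interior K ∩ interior Ks)) := by
  have hD : MeasurableSet (interior K ∩ interior Ks) :=
    (isOpen_interior.inter isOpen_interior).measurableSet
  have hDΩ : interior K ∩ interior Ks ⊆ Ω :=
    Set.inter_subset_left.trans (m.interior_subset_domain hK)
  have hv1 := m.memH1_of_isPiecewiseSmooth hK hKs hv
  have hle := Measure.restrict_mono (Set.inter_subset_left (s := interior K) (t := interior Ks))
    (le_refl (volume : Measure Plane))
  exact (hab.integrable_matrixForm hD hDΩ
    (fun i => (hw.1.2 i).memLp_weakPartial.mono_measure hle)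
    fun i => (hv1.2 i).memLp_weakPartial).add
    (hab.integrable_mul_mul hD hDΩ (hw.1.1.mono_measure hle) hv1.1)

theorem AdmissibleMesh.integrable_boundaryPart (m : AdmissibleMesh Ω T Ts N ϱ)
    (hab : BoundedCoeff Ω a b M) (hK : K ∈ T) (hKs : Ks ∈ Ts) (w v : Plane → ℝ) :
    Integrable (fun x => matrixForm (a x)
      (fun i => innerTrace K Ks v x * outerNormal Ks x i) (gradTrace Ts K w x))
      ((μH[1] : Measure Plane).restrict (dualSkeleton Ts K)) :=
  hab.integrable_matrixForm (measurableSet_dualSkeleton Ts K)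
    (Set.inter_subset_right.trans (m.interior_subset_domain hK))
    (memLp_innerTrace_mul_outerNormal_dualSkeleton hKs (m.dual.2 Ks hKs).facts.1 v)
    (fun i => memLp_gradTrace Ts K w i)

theorem integral_eq_add_mul {α : Type*} [MeasurableSpace α] {μ : Measure α} {f f₁ f₂ : α → ℝ}
    {c : ℝ} (h1 : Integrable f₁ μ) (h2 : Integrable f₂ μ)
    (e : ∀ᵐ x ∂μ, f x = f₁ x + c * f₂ x) : ∫ x, f x ∂μ = ∫ x, f₁ x ∂μ + c * ∫ x, f₂ x ∂μ := by
  rw [integral_congr_ae e, integral_add h1 (h2.const_mul c), integral_const_mul]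

theorem AdmissibleMesh.volumePart_add_smul_left (m : AdmissibleMesh Ω T Ts N ϱ)
    (hab : BoundedCoeff Ω a b M) (hK : K ∈ T) (hKs : Ks ∈ Ts) {w w₁ w₂ v : Plane → ℝ} {c : ℝ}
    (h1 : MemH2 (interior K) w₁) (h2 : MemH2 (interior K) w₂) (hv : IsPiecewiseSmooth T Ts v)
    (e : w =ᵐ[volume.restrict (interior K)] w₁ + c • w₂) :
    volumePart a b K Ks w v = volumePart a b K Ks w₁ v + c * volumePart a b K Ks w₂ v := by
  have hD := isOpen_interior (s := K)
  have hle := Measure.restrict_mono (Set.inter_subset_left (s := interior K) (t := interior Ks))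
    (le_refl (volume : Measure Plane))
  have eg : ∀ i, weakPartial (interior K) i w =ᵐ[volume.restrict (interior K)]
      weakPartial (interior K) i w₁ + c • weakPartial (interior K) i w₂ := fun i =>
    (((h1.1.add_smul h2.1 c).2 i).weakPartial_congr hD e.symm).trans
      (h1.1.weakPartial_add_smul hD h2.1 c i)
  refine integral_eq_add_mul (m.integrable_volumePart hab hK hKs h1 hv)
    (m.integrable_volumePart hab hK hKs h2 hv) ?_
  filter_upwards [ae_mono hle e, ae_mono hle (eg 0), ae_mono hle (eg 1)] with x k k0 k1
  simp only [matrixForm, weakGrad, Fin.sum_univ_two, k, k0, k1, Pi.add_apply, Pi.smul_apply,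
    smul_eq_mul]
  ring

theorem AdmissibleMesh.boundaryPart_add_smul_left (m : AdmissibleMesh Ω T Ts N ϱ)
    (hab : BoundedCoeff Ω a b M) (hK : K ∈ T) (hKs : Ks ∈ Ts) {w w₁ w₂ v : Plane → ℝ} {c : ℝ}
    (h1 : MemH2 (interior K) w₁) (h2 : MemH2 (interior K) w₂)
    (e : w =ᵐ[volume.restrict (interior K)] w₁ + c • w₂) :
    boundaryPart a Ts K Ks w v = boundaryPart a Ts K Ks w₁ v + c * boundaryPart a Ts K Ks w₂ v := by
  have hle := Measure.restrict_mono (frontier_inter_subset_dualSkeleton hKs K)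
    (le_refl (μH[1] : Measure Plane))
  refine integral_eq_add_mul ((m.integrable_boundaryPart hab hK hKs w₁ v).mono_measure hle)
    ((m.integrable_boundaryPart hab hK hKs w₂ v).mono_measure hle) ?_
  filter_upwards [ae_mono hle (m.gradTrace_add_smul hK h1 h2 e)] with x k
  simp only [matrixForm, Fin.sum_univ_two, k]
  ring

theorem AdmissibleMesh.volumePart_add_smul_right (m : AdmissibleMesh Ω T Ts N ϱ)
    (hab : BoundedCoeff Ω a b M) (hK : K ∈ T) (hKs : Ks ∈ Ts) {w v v₁ v₂ : Plane → ℝ} {c : ℝ}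
    (hw : MemH2 (interior K) w) (h1 : IsPiecewiseSmooth T Ts v₁)
    (h2 : IsPiecewiseSmooth T Ts v₂)
    (e : v =ᵐ[volume.restrict (interior K ∩ interior Ks)] v₁ + c • v₂) :
    volumePart a b K Ks w v = volumePart a b K Ks w v₁ + c * volumePart a b K Ks w v₂ := by
  have hD := (isOpen_interior (s := K)).inter (isOpen_interior (s := Ks))
  have k1 := m.memH1_of_isPiecewiseSmooth hK hKs h1
  have k2 := m.memH1_of_isPiecewiseSmooth hK hKs h2
  have eg : ∀ i, weakPartial (interior K ∩ interior Ks) i v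
      =ᵐ[volume.restrict (interior K ∩ interior Ks)]
      weakPartial (interior K ∩ interior Ks) i v₁ +
        c • weakPartial (interior K ∩ interior Ks) i v₂ := fun i =>
    (((k1.add_smul k2 c).2 i).weakPartial_congr hD e.symm).trans
      (k1.weakPartial_add_smul hD k2 c i)
  refine integral_eq_add_mul (m.integrable_volumePart hab hK hKs hw h1)
    (m.integrable_volumePart hab hK hKs hw h2) ?_
  filter_upwards [e, eg 0, eg 1] with x k k0 k1
  simp only [matrixForm, weakGrad, Fin.sum_univ_two, k, k0, k1, Pi.add_apply, Pi.smul_apply,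
    smul_eq_mul]
  ring

/-- Where a normal exists, the inner traces are almost everywhere the smooth functions themselves
and hence linear; where none exists, the factor `outerNormal` is zero. -/
theorem AdmissibleMesh.boundaryPart_add_smul_right (m : AdmissibleMesh Ω T Ts N ϱ)
    (hab : BoundedCoeff Ω a b M) (hK : K ∈ T) (hKs : Ks ∈ Ts) {w v v₁ v₂ : Plane → ℝ} {c : ℝ}
    (h1 : IsPiecewiseSmooth T Ts v₁) (h2 : IsPiecewiseSmooth T Ts v₂)
    (e : v =ᵐ[volume.restrict (interior K ∩ interior Ks)] v₁ + c • v₂) :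
    boundaryPart a Ts K Ks w v = boundaryPart a Ts K Ks w v₁ + c * boundaryPart a Ts K Ks w v₂ := by
  have hle := Measure.restrict_mono (frontier_inter_subset_dualSkeleton hKs K)
    (le_refl (μH[1] : Measure Plane))
  obtain ⟨φ₁, hφ1, e1⟩ := h1 K hK Ks hKs
  obtain ⟨φ₂, hφ2, e2⟩ := h2 K hK Ks hKs
  have hKb := m.isBounded hK
  have hP := m.dual.2 Ks hKs
  have e3 : v =ᵐ[volume.restrict (interior K ∩ interior Ks)] φ₁ + c • φ₂ := by
    filter_upwards [e, e1, e2] with x k k1 k2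
    simp only [k, Pi.add_apply, Pi.smul_apply, k1, k2]
  have hφ3 : ContDiff ℝ ∞ (φ₁ + c • φ₂) := hφ1.add (contDiff_const.smul hφ2)
  refine integral_eq_add_mul ((m.integrable_boundaryPart hab hK hKs w v₁).mono_measure hle)
    ((m.integrable_boundaryPart hab hK hKs w v₂).mono_measure hle) ?_
  filter_upwards [innerTrace_eq_of_contDiff hKb hP hφ1 e1, innerTrace_eq_of_contDiff hKb hP hφ2 e2,
    innerTrace_eq_of_contDiff hKb hP hφ3 e3] with x k1 k2 k3
  by_cases hx : outerNormal Ks x = 0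
  · simp [matrixForm, hx]
  · simp only [matrixForm, Fin.sum_univ_two, k1 hx, k2 hx, k3 hx, Pi.add_apply, Pi.smul_apply,
      smul_eq_mul]
    ring

/-- Linearity of the discrete form in the first argument. -/
theorem AdmissibleMesh.form_add_smul_left (m : AdmissibleMesh Ω T Ts N ϱ)
    (hab : BoundedCoeff Ω a b M) {w w₁ w₂ v : Plane → ℝ} {c : ℝ}
    (h1 : MemBrokenH2 T w₁) (h2 : MemBrokenH2 T w₂) (hv : IsPiecewiseSmooth T Ts v)
    (e : w =ᵐ[volume.restrict Ω] w₁ + c • w₂) :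
    form a b T Ts w v = form a b T Ts w₁ v + c * form a b T Ts w₂ v := by
  simp only [form_eq, Finset.mul_sum, ← Finset.sum_add_distrib]
  refine Finset.sum_congr rfl fun K hK => Finset.sum_congr rfl fun Ks hKs => ?_
  have eK := ae_mono (Measure.restrict_mono (m.interior_subset_domain hK) le_rfl) e
  rw [m.volumePart_add_smul_left hab hK hKs (h1 K hK) (h2 K hK) hv eK,
    m.boundaryPart_add_smul_left hab hK hKs (h1 K hK) (h2 K hK) eK]
  ring

/-- Linearity of the discrete form in the second argument. -/
theorem AdmissibleMesh.form_add_smul_right (m : AdmissibleMesh Ω T Ts N ϱ)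
    (hab : BoundedCoeff Ω a b M) {w v v₁ v₂ : Plane → ℝ} {c : ℝ} (hw : MemBrokenH2 T w)
    (h1 : IsPiecewiseSmooth T Ts v₁) (h2 : IsPiecewiseSmooth T Ts v₂)
    (e : v =ᵐ[volume.restrict Ω] v₁ + c • v₂) :
    form a b T Ts w v = form a b T Ts w v₁ + c * form a b T Ts w v₂ := by
  simp only [form_eq, Finset.mul_sum, ← Finset.sum_add_distrib]
  refine Finset.sum_congr rfl fun K hK => Finset.sum_congr rfl fun Ks hKs => ?_
  have eK := ae_mono (Measure.restrict_mono
    (Set.inter_subset_left.trans (m.interior_subset_domain hK) :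
      interior K ∩ interior Ks ⊆ Ω) le_rfl) e
  rw [m.volumePart_add_smul_right hab hK hKs (hw K hK) h1 h2 eK,
    m.boundaryPart_add_smul_right hab hK hKs h1 h2 eK]
  ring

end Linear

/-! ### Boundedness of the discrete form -/

theorem sum_setIntegral_le {β : Type*} {F : Finset β} {s : β → Set Plane} {A : Set Plane}
    (hs : ∀ j ∈ F, MeasurableSet (s j)) (hd : ∀ i ∈ F, ∀ j ∈ F, i ≠ j → Disjoint (s i) (s j))
    (hA : ∀ j ∈ F, s j ⊆ A) {f : Plane → ℝ} (hf : ∀ x, 0 ≤ f x) (hi : IntegrableOn f A) :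
    ∑ j ∈ F, ∫ x in s j, f x ≤ ∫ x in A, f x := by
  rw [← integral_biUnion_finset F hs (fun i hi j hj hij => hd i hi j hj hij)
    fun j hj => hi.mono_set (hA j hj)]
  exact setIntegral_mono_set hi (ae_of_all _ hf) (Set.iUnion₂_subset hA).eventuallyLE

section Bounds

variable {Ω : Set Plane} {T Ts : Finset (Set Plane)} {N : ℕ} {ϱ : ℝ} {K Ks : Set Plane}
  {a : Plane → Matrix (Fin 2) (Fin 2) ℝ} {b : Plane → ℝ} {M : ℝ}

theorem AdmissibleMesh.abs_volumePart_le (m : AdmissibleMesh Ω T Ts N ϱ)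
    (hab : BoundedCoeff Ω a b M) (hK : K ∈ T) (hKs : Ks ∈ Ts) {w v : Plane → ℝ}
    (hw : MemH2 (interior K) w) (hv : IsPiecewiseSmooth T Ts v) {t : ℝ} (ht : 0 < t) :
    |volumePart a b K Ks w v| ≤
      M * (t * ((∫ x in interior K ∩ interior Ks, ∑ i, weakPartial (interior K) i w x ^ 2) +
          ∫ x in interior K ∩ interior Ks, w x ^ 2) +
        (semi1Sq (interior K ∩ interior Ks) v +
          ∫ x in interior K ∩ interior Ks, v x ^ 2) / t) := by
  have hle := Measure.restrict_mono (Set.inter_subset_left (s := interior K) (t := interior Ks))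
    (le_refl (volume : Measure Plane))
  have hD : MeasurableSet (interior K ∩ interior Ks) :=
    (isOpen_interior.inter isOpen_interior).measurableSet
  have hv1 := m.memH1_of_isPiecewiseSmooth hK hKs hv
  have i1 : Integrable (fun x => ∑ i, weakPartial (interior K) i w x ^ 2)
      (volume.restrict (interior K ∩ interior Ks)) := integrable_finsetSum _ fun i _ =>
    ((hw.1.2 i).memLp_weakPartial.mono_measure hle).integrable_sq
  have i2 : Integrable (fun x => w x ^ 2) (volume.restrict (interior K ∩ interior Ks)) :=
    (hw.1.1.mono_measure hle).integrable_sq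
  have i3 : Integrable (fun x => ∑ i, weakPartial (interior K ∩ interior Ks) i v x ^ 2)
      (volume.restrict (interior K ∩ interior Ks)) := integrable_finsetSum _ fun i _ =>
    (hv1.2 i).memLp_weakPartial.integrable_sq
  have i4 : Integrable (fun x => v x ^ 2) (volume.restrict (interior K ∩ interior Ks)) :=
    hv1.1.integrable_sq
  have i12 : Integrable (fun x => t * (∑ i, weakPartial (interior K) i w x ^ 2 + w x ^ 2))
    (volume.restrict (interior K ∩ interior Ks)) := (i1.add i2).const_mul t
  have i34 : Integrable (fun x => (∑ i, weakPartial (interior K ∩ interior Ks) i v x ^ 2 +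
    v x ^ 2) / t) (volume.restrict (interior K ∩ interior Ks)) := (i3.add i4).div_const t
  have hbound : ∀ᵐ x ∂volume.restrict (interior K ∩ interior Ks),
      ‖matrixForm (a x) (weakGrad (interior K) w x) (weakGrad (interior K ∩ interior Ks) v x) +
        b x * w x * v x‖ ≤ M * (t * (∑ i, weakPartial (interior K) i w x ^ 2 + w x ^ 2) +
        (∑ i, weakPartial (interior K ∩ interior Ks) i v x ^ 2 + v x ^ 2) / t) := by
    refine ae_restrict_of_forall_mem hD fun x hx => ?_
    have hxΩ := m.interior_subset_domain hK hx.1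
    have h1 := abs_matrixForm_le (fun i j => hab.a_le x hxΩ i j) ht (weakGrad (interior K) w x)
      (weakGrad (interior K ∩ interior Ks) v x)
    have h2 := abs_mul_mul_le (hab.b_le x hxΩ) ht (w x) (v x)
    rw [Real.norm_eq_abs]
    refine (abs_add_le _ _).trans ((add_le_add h1 h2).trans (le_of_eq ?_))
    simp only [weakGrad]
    ring
  have := norm_integral_le_of_norm_le ((i12.add i34).const_mul M) hbound
  rw [Real.norm_eq_abs] at this
  refine this.trans (le_of_eq ?_)
  simp only [Pi.add_apply]
  rw [integral_const_mul, integral_add i12 i34, integral_const_mul, integral_div,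
    integral_add i1 i2, integral_add i3 i4, semi1Sq]

theorem AdmissibleMesh.sum_abs_volumePart_le (m : AdmissibleMesh Ω T Ts N ϱ)
    (hab : BoundedCoeff Ω a b M) (hK : K ∈ T) {w v : Plane → ℝ} (hw : MemH2 (interior K) w)
    (hv : IsPiecewiseSmooth T Ts v) (hv2 : MemLp v 2 (volume.restrict Ω)) {t : ℝ} (ht : 0 < t) :
    ∑ Ks ∈ Ts, |volumePart a b K Ks w v| ≤
      M * (t * (semi1Sq (interior K) w + ∫ x in interior K, w x ^ 2) +
        (∑ Ks ∈ Ts, semi1Sq (interior K ∩ interior Ks) v + ∫ x in interior K, v x ^ 2) / t) := by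
  have hs : ∀ Ks ∈ Ts, MeasurableSet (interior K ∩ interior Ks) := fun _ _ =>
    (isOpen_interior.inter isOpen_interior).measurableSet
  have hd : ∀ K₁ ∈ Ts, ∀ K₂ ∈ Ts, K₁ ≠ K₂ →
      Disjoint (interior K ∩ interior K₁) (interior K ∩ interior K₂) := fun K₁ h1 K₂ h2 hne =>
    (m.dual.1.2 K₁ h1 K₂ h2 hne).mono Set.inter_subset_right Set.inter_subset_right
  have hA : ∀ Ks ∈ Ts, interior K ∩ interior Ks ⊆ interior K := fun _ _ => Set.inter_subset_left
  have s1 := sum_setIntegral_le hs hd hA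
    (f := fun x => ∑ i, weakPartial (interior K) i w x ^ 2)
    (fun x => Finset.sum_nonneg fun i _ => sq_nonneg _)
    (integrable_finsetSum _ fun i _ => (hw.1.2 i).memLp_weakPartial.integrable_sq)
  have s2 := sum_setIntegral_le hs hd hA (f := fun x => w x ^ 2) (fun x => sq_nonneg _)
    hw.1.1.integrable_sq
  have s3 := sum_setIntegral_le hs hd hA (f := fun x => v x ^ 2) (fun x => sq_nonneg _)
    (hv2.integrable_sq.mono_measure
      (Measure.restrict_mono (m.interior_subset_domain hK) le_rfl))
  refine (Finset.sum_le_sum fun Ks hKs => m.abs_volumePart_le hab hK hKs hw hv ht).trans ?_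
  rw [← Finset.mul_sum, Finset.sum_add_distrib, ← Finset.mul_sum, ← Finset.sum_div,
    Finset.sum_add_distrib, Finset.sum_add_distrib]
  have hM := hab.pos.le
  unfold semi1Sq at *
  gcongr

/-! ### Jumps across the gridlines and the boundary terms -/

theorem restrict_biUnion_finset_le {β : Type*} (F : Finset β) (s : β → Set Plane)
    (μ : Measure Plane) : μ.restrict (⋃ j ∈ F, s j) ≤ ∑ j ∈ F, μ.restrict (s j) := by
  classical
  induction F using Finset.induction_on with
  | empty => simp
  | insert j F hj ih =>
    rw [Finset.set_biUnion_insert, Finset.sum_insert hj]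
    exact (Measure.restrict_union_le _ _).trans (by gcongr)

/-- The squared jump contribution of a gridline. -/
noncomputable def jumpSq (Ts : Finset (Set Plane)) (K : Set Plane) (v : Plane → ℝ)
    (l : Set Plane) : ℝ :=
  ((μH[1] : Measure Plane).real l)⁻¹ * ∫ x in l, ‖jump Ts K v x‖ ^ 2 ∂(μH[1] : Measure Plane)

theorem jump_apply (Ts : Finset (Set Plane)) (K : Set Plane) (v : Plane → ℝ) (x : Plane)
    (i : Fin 2) : jump Ts K v x i = ∑ Ks ∈ Ts, innerTrace K Ks v x * outerNormal Ks x i := by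
  simp [jump]

/-- Each integrand extends by zero to the skeleton of `K`, since the normal vanishes off its
frontier; summing over the control volumes assembles the vector-valued jump. -/
theorem AdmissibleMesh.sum_boundaryPart_eq (m : AdmissibleMesh Ω T Ts N ϱ)
    (hab : BoundedCoeff Ω a b M) (hK : K ∈ T) (w v : Plane → ℝ) :
    ∑ Ks ∈ Ts, boundaryPart a Ts K Ks w v = ∫ x in dualSkeleton Ts K,
      matrixForm (a x) (fun i => jump Ts K v x i) (gradTrace Ts K w x)
        ∂(μH[1] : Measure Plane) := by
  have e1 : ∀ Ks ∈ Ts, boundaryPart a Ts K Ks w v = ∫ x in dualSkeleton Ts K,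
      matrixForm (a x) (fun i => innerTrace K Ks v x * outerNormal Ks x i) (gradTrace Ts K w x)
        ∂(μH[1] : Measure Plane) := by
    intro Ks hKs
    refine (setIntegral_eq_of_subset_of_forall_sdiff_eq_zero (measurableSet_dualSkeleton Ts K)
      (frontier_inter_subset_dualSkeleton hKs K) fun x hx => ?_).symm
    rw [outerNormal_eq_zero_of_notMem_frontier fun h => hx.2 ⟨h, hx.1.2⟩]
    simp [matrixForm]
  rw [Finset.sum_congr rfl e1,
    ← integral_finsetSum _ fun Ks hKs => m.integrable_boundaryPart hab hK hKs w v]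
  congr 1; funext x
  simp only [matrixForm, jump_apply, Fin.sum_univ_two, Finset.sum_mul, Finset.mul_sum,
    ← Finset.sum_add_distrib]

theorem AdmissibleMesh.memLp_jump (m : AdmissibleMesh Ω T Ts N ϱ) (K : Set Plane)
    (v : Plane → ℝ) (i : Fin 2) : MemLp (fun x => jump Ts K v x i) 2
      ((μH[1] : Measure Plane).restrict (dualSkeleton Ts K)) := by
  simp only [jump_apply]
  exact memLp_finsetSum _ fun Ks hKs =>
    memLp_innerTrace_mul_outerNormal_dualSkeleton hKs (m.dual.2 Ks hKs).facts.1 v i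

/-- On each gridline, Young's inequality puts `|l|⁻¹` on the jump, as in the test norm, and `|l|` on
the gradient, as in the scaled trace inequality. The gradient bound is the same for all gridlines of
`K`, so their number enters as `N`. -/
theorem AdmissibleMesh.abs_sum_boundaryPart_le (m : AdmissibleMesh Ω T Ts N ϱ)
    (hab : BoundedCoeff Ω a b M) (hK : K ∈ T) {w : Plane → ℝ} (hw : MemH2 (interior K) w)
    (v : Plane → ℝ) {t : ℝ} (ht : 0 < t) :
    |∑ Ks ∈ Ts, boundaryPart a Ts K Ks w v| ≤
      M * (t * (24 * N / ϱ * (semi1Sq (interior K) w +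
          Metric.diam K ^ 2 * semi2Sq (interior K) w)) +
        (∑ᶠ l ∈ dualGridlines Ts K, jumpSq Ts K v l) / t) := by
  obtain ⟨hc, hcomp, -⟩ := m.primary.convex_isCompact hK
  have hfin := m.finite_dualGridlines hK
  set G := hfin.toFinset
  let μ : Measure Plane := μH[1]
  let f : Plane → ℝ := fun x => matrixForm (a x) (fun i => jump Ts K v x i) (gradTrace Ts K w x)
  have hskm := measurableSet_dualSkeleton Ts K
  have hskΩ : dualSkeleton Ts K ⊆ Ω := Set.inter_subset_right.trans (m.interior_subset_domain hK)
  have hfi : Integrable f (μ.restrict (dualSkeleton Ts K)) :=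
    hab.integrable_matrixForm hskm hskΩ (fun i => m.memLp_jump K v i)
      fun i => memLp_gradTrace Ts K w i
  have hl : ∀ l ∈ G, μ.restrict l ≤ μ.restrict (dualSkeleton Ts K) := fun l hl =>
    Measure.restrict_mono' (dualGridline_ae_le_dualSkeleton m.dual hc
      ((Set.Finite.mem_toFinset _).1 hl)) le_rfl
  obtain ⟨F, hF, hsub⟩ := dualSkeleton_subset m.dual hcomp (m.subset_closure hK)
  -- Domination suffices for an upper bound, so no disjointness of the gridlines is required.
  have hle : μ.restrict (dualSkeleton Ts K) ≤ ∑ l ∈ G, μ.restrict l := by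
    refine (Measure.restrict_mono' ?_ le_rfl).trans (restrict_biUnion_finset_le G (fun l => l) μ)
    rw [ae_le_set]
    refine measure_mono_null ?_ (hausdorffMeasure_one_finite hF)
    rintro x ⟨hx, hxl⟩
    rcases hsub hx with h | h
    · exact h
    · exact absurd (by simpa [G] using h) hxl
  have hline : ∀ l ∈ G, ∫ x in l, |f x| ∂μ ≤
      M * (t * (24 / ϱ * (semi1Sq (interior K) w +
        Metric.diam K ^ 2 * semi2Sq (interior K) w)) + jumpSq Ts K v l / t) := by
    intro l hlG
    have hlD : l ∈ dualGridlines Ts K := (Set.Finite.mem_toFinset _).1 hlG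
    have hpos : 0 < μ.real l := by
      obtain ⟨K₁, -, K₂, -, -, p, q, hpq, rfl, -⟩ := hlD
      rw [measureReal_def, hausdorffMeasure_segment, ← dist_edist]
      exact dist_pos.2 hpq
    have hgr := m.gradTrace_gridline_le hK hlD hw
    have j1 : ∀ i, Integrable (fun x => gradTrace Ts K w x i ^ 2) (μ.restrict l) := fun i =>
      ((memLp_gradTrace Ts K w i).mono_measure (hl l hlG)).integrable_sq
    have j2 : ∀ i, Integrable (fun x => jump Ts K v x i ^ 2) (μ.restrict l) := fun i =>
      ((m.memLp_jump K v i).mono_measure (hl l hlG)).integrable_sq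
    have j3 : Integrable (fun x => ∑ i, gradTrace Ts K w x i ^ 2) (μ.restrict l) :=
      integrable_finsetSum _ fun i _ => j1 i
    have j4 : Integrable (fun x => ∑ i, jump Ts K v x i ^ 2) (μ.restrict l) :=
      integrable_finsetSum _ fun i _ => j2 i
    have j34 : Integrable (fun x => M * ((t * μ.real l)⁻¹ * ∑ i, jump Ts K v x i ^ 2 +
        (t * μ.real l) * ∑ i, gradTrace Ts K w x i ^ 2)) (μ.restrict l) :=
      ((j4.const_mul _).add (j3.const_mul _)).const_mul M
    have hmono : ∫ x in l, |f x| ∂μ ≤ ∫ x in l, M * ((t * μ.real l)⁻¹ * ∑ i, jump Ts K v x i ^ 2 +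
        (t * μ.real l) * ∑ i, gradTrace Ts K w x i ^ 2) ∂μ := by
      refine integral_mono_ae (hfi.mono_measure (hl l hlG)).abs j34 ?_
      refine ae_mono (hl l hlG) (ae_restrict_of_forall_mem hskm fun x hx => ?_)
      -- The Young weight is `(t |l|)⁻¹` on the jump, hence `t |l|` on the gradient.
      have := abs_matrixForm_le (fun i j => hab.a_le x (hskΩ hx) i j)
        (inv_pos.2 (mul_pos ht hpos)) (fun i => jump Ts K v x i) (gradTrace Ts K w x)
      refine this.trans (le_of_eq ?_)
      rw [div_inv_eq_mul, mul_comm (∑ i, gradTrace Ts K w x i ^ 2)]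
    refine hmono.trans ?_
    rw [integral_const_mul, integral_add (j4.const_mul _) (j3.const_mul _), integral_const_mul,
      integral_const_mul, integral_finsetSum (f := fun i x => gradTrace Ts K w x i ^ 2) _
        fun i _ => j1 i]
    have ej : ∫ x in l, ‖jump Ts K v x‖ ^ 2 ∂μ = ∫ x in l, ∑ i, jump Ts K v x i ^ 2 ∂μ := by
      congr 1; funext x
      exact EuclideanSpace.real_norm_sq_eq _
    have hM := hab.pos.le
    rw [jumpSq, ej]
    refine mul_le_mul_of_nonneg_left ?_ hM
    rw [add_comm]
    refine add_le_add ?_ (le_of_eq ?_)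
    · rw [mul_assoc]
      exact mul_le_mul_of_nonneg_left hgr ht.le
    · change (t * μ.real l)⁻¹ * _ = (μ.real l)⁻¹ * _ / t
      rw [mul_inv]
      ring
  rw [m.sum_boundaryPart_eq hab hK]
  have hfl : ∀ l ∈ G, Integrable f (μ.restrict l) := fun l h => hfi.mono_measure (hl l h)
  have n0 : 0 ≤ semi1Sq (interior K) w + Metric.diam K ^ 2 * semi2Sq (interior K) w :=
    add_nonneg (semi1Sq_nonneg _ _) (mul_nonneg (sq_nonneg _) (semi2Sq_nonneg _ _))
  have hcard : (G.card : ℝ) ≤ N := by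
    have h1 := m.encard_le K hK
    rw [← hfin.coe_toFinset, Set.encard_coe_eq_coe_finsetCard] at h1
    exact_mod_cast h1
  calc |∫ x in dualSkeleton Ts K, f x ∂μ| ≤ ∫ x in dualSkeleton Ts K, |f x| ∂μ :=
        abs_integral_le_integral_abs
    _ ≤ ∫ x, |f x| ∂(∑ l ∈ G, μ.restrict l) :=
        integral_mono_measure hle (ae_of_all _ fun x => abs_nonneg _)
          (integrable_finsetSum_measure.2 fun l h => (hfl l h).abs)
    _ = ∑ l ∈ G, ∫ x in l, |f x| ∂μ := integral_finsetSum_measure fun l h => (hfl l h).abs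
    _ ≤ ∑ l ∈ G, M * (t * (24 / ϱ * (semi1Sq (interior K) w +
        Metric.diam K ^ 2 * semi2Sq (interior K) w)) + jumpSq Ts K v l / t) :=
        Finset.sum_le_sum hline
    _ = M * (t * (24 * G.card / ϱ * (semi1Sq (interior K) w +
          Metric.diam K ^ 2 * semi2Sq (interior K) w)) +
        (∑ᶠ l ∈ dualGridlines Ts K, jumpSq Ts K v l) / t) := by
        rw [finsum_mem_eq_finite_toFinset_sum _ hfin, ← Finset.mul_sum, Finset.sum_add_distrib,
          Finset.sum_const, ← Finset.sum_div, nsmul_eq_mul]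
        ring
    _ ≤ _ := by
        have := m.pos
        have hM := hab.pos.le
        gcongr

/-- The quadratic functional that bounds the first argument of the discrete form. -/
noncomputable def trialSq (Ω : Set Plane) (T : Finset (Set Plane)) (h : ℝ) (w : Plane → ℝ) : ℝ :=
  (∫ x in Ω, w x ^ 2) + ∑ K ∈ T, semi1Sq (interior K) w + h ^ 2 * ∑ K ∈ T, semi2Sq (interior K) w

theorem jumpSq_nonneg (Ts : Finset (Set Plane)) (K : Set Plane) (v : Plane → ℝ) (l : Set Plane) :
    0 ≤ jumpSq Ts K v l :=
  mul_nonneg (inv_nonneg.2 measureReal_nonneg) (integral_nonneg fun _ => by positivity)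

theorem testNorm_sq (T Ts : Finset (Set Plane)) (v : Plane → ℝ) :
    testNorm T Ts v ^ 2 = ∑ K ∈ T, (∑ Ks ∈ Ts, semi1Sq (interior K ∩ interior Ks) v +
      ∑ᶠ l ∈ dualGridlines Ts K, jumpSq Ts K v l) :=
  Real.sq_sqrt (Finset.sum_nonneg fun _ _ => add_nonneg
    (Finset.sum_nonneg fun _ _ => semi1Sq_nonneg _ _)
    (finsum_nonneg fun _ => finsum_nonneg fun _ => jumpSq_nonneg _ _ _ _))

/-- With a common `t` on all elements the local bounds simply add up; disjointness of the interiors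
turns the local L² terms into integrals over `Ω`. -/
theorem AdmissibleMesh.abs_form_le_add (m : AdmissibleMesh Ω T Ts N ϱ)
    (hab : BoundedCoeff Ω a b M) {w v : Plane → ℝ} (hw : MemBrokenH2 T w)
    (hw2 : MemLp w 2 (volume.restrict Ω)) (hv : IsPiecewiseSmooth T Ts v)
    (hv2 : MemLp v 2 (volume.restrict Ω)) {h : ℝ} (hh : ∀ K ∈ T, Metric.diam K ≤ h)
    {t : ℝ} (ht : 0 < t) :
    |form a b T Ts w v| ≤ M * (1 + 24 * N / ϱ) * (t * trialSq Ω T h w +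
      (testNorm T Ts v ^ 2 + ∫ x in Ω, v x ^ 2) / t) := by
  have hϱ := m.pos
  have hM := hab.pos.le
  have hcN : 0 ≤ 24 * (N : ℝ) / ϱ := by positivity
  have hs : ∀ K ∈ T, MeasurableSet (interior K) := fun _ _ => isOpen_interior.measurableSet
  have hd : ∀ K ∈ T, ∀ L ∈ T, K ≠ L → Disjoint (interior K) (interior L) := m.primary.1.2
  have hA : ∀ K ∈ T, interior K ⊆ Ω := fun K hK => m.interior_subset_domain hK
  have sw := sum_setIntegral_le (s := fun K => interior K) hs hd hA (f := fun x => w x ^ 2)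
    (fun x => sq_nonneg _) hw2.integrable_sq
  have sv := sum_setIntegral_le (s := fun K => interior K) hs hd hA (f := fun x => v x ^ 2)
    (fun x => sq_nonneg _) hv2.integrable_sq
  have key : ∀ K ∈ T, |∑ Ks ∈ Ts, (volumePart a b K Ks w v - boundaryPart a Ts K Ks w v)| ≤
      M * (t * (semi1Sq (interior K) w + ∫ x in interior K, w x ^ 2) +
        (∑ Ks ∈ Ts, semi1Sq (interior K ∩ interior Ks) v + ∫ x in interior K, v x ^ 2) / t) +
      M * (t * (24 * N / ϱ * (semi1Sq (interior K) w + h ^ 2 * semi2Sq (interior K) w)) +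
        (∑ᶠ l ∈ dualGridlines Ts K, jumpSq Ts K v l) / t) := by
    intro K hK
    have h2 := m.abs_sum_boundaryPart_le hab hK (hw K hK) v ht
    have h3 : Metric.diam K ^ 2 * semi2Sq (interior K) w ≤ h ^ 2 * semi2Sq (interior K) w :=
      mul_le_mul_of_nonneg_right (pow_le_pow_left₀ Metric.diam_nonneg (hh K hK) 2)
        (semi2Sq_nonneg _ _)
    rw [Finset.sum_sub_distrib]
    refine (abs_sub _ _).trans (add_le_add ((Finset.abs_sum_le_sum_abs _ _).trans
      (m.sum_abs_volumePart_le hab hK (hw K hK) hv hv2 ht)) (h2.trans ?_))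
    gcongr
  rw [form_eq, testNorm_sq, trialSq]
  refine (Finset.abs_sum_le_sum_abs _ _).trans ((Finset.sum_le_sum key).trans ?_)
  simp only [Finset.sum_add_distrib, ← Finset.mul_sum, ← Finset.sum_div]
  set S1 := ∑ K ∈ T, semi1Sq (interior K) w
  set S2 := ∑ K ∈ T, semi2Sq (interior K) w
  set W := ∫ x in Ω, w x ^ 2
  set V := ∫ x in Ω, v x ^ 2
  set V1 := ∑ K ∈ T, ∑ Ks ∈ Ts, semi1Sq (interior K ∩ interior Ks) v
  set J := ∑ K ∈ T, ∑ᶠ l ∈ dualGridlines Ts K, jumpSq Ts K v l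
  have nS1 : 0 ≤ S1 := Finset.sum_nonneg fun _ _ => semi1Sq_nonneg _ _
  have nS2 : 0 ≤ h ^ 2 * S2 :=
    mul_nonneg (sq_nonneg _) (Finset.sum_nonneg fun _ _ => semi2Sq_nonneg _ _)
  have nW : 0 ≤ W := integral_nonneg fun _ => sq_nonneg _
  have nV : 0 ≤ V := integral_nonneg fun _ => sq_nonneg _
  have nV1 : 0 ≤ V1 :=
    Finset.sum_nonneg fun _ _ => Finset.sum_nonneg fun _ _ => semi1Sq_nonneg _ _
  have nJ : 0 ≤ J := Finset.sum_nonneg fun _ _ =>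
    finsum_nonneg fun _ => finsum_nonneg fun _ => jumpSq_nonneg _ _ _ _
  calc _ ≤ M * (t * (S1 + W) + (V1 + V) / t) +
        M * (t * (24 * N / ϱ * (S1 + h ^ 2 * S2)) + J / t) := by gcongr
    _ = M * (t * (S1 + W) + t * (24 * N / ϱ * (S1 + h ^ 2 * S2)) + (V1 + J + V) / t) := by ring
    -- Nonnegative terms are added so that the expression factors with the single constant `M * (1 +
    -- 24 * N / ϱ)`.
    _ ≤ M * (t * (S1 + W) + t * (24 * N / ϱ * (S1 + h ^ 2 * S2)) + (V1 + J + V) / t) +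
        M * (t * (h ^ 2 * S2) + 24 * N / ϱ * (t * W) + 24 * N / ϱ * ((V1 + J + V) / t)) := by
        have : 0 ≤ (V1 + J + V) / t := by positivity
        have : 0 ≤ t * (h ^ 2 * S2) := mul_nonneg ht.le nS2
        have : 0 ≤ M * (t * (h ^ 2 * S2) + 24 * N / ϱ * (t * W) +
          24 * N / ϱ * ((V1 + J + V) / t)) := by positivity
        linarith
    _ = _ := by ring

/-- The optimal weight is `t = y / x`. Replacing it by `(y + δ) / (x + δ)` covers vanishing `x` or
`y` at the cost of an arbitrarily small error. -/
theorem le_of_forall_add_div_le {F C x y : ℝ} (hC : 0 ≤ C) (hx : 0 ≤ x) (hy : 0 ≤ y)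
    (h : ∀ t > 0, F ≤ C * (t * x ^ 2 + y ^ 2 / t)) : F ≤ 2 * C * (x * y) := by
  refine le_of_forall_pos_le_add fun ε hε => ?_
  have hden : 0 < C * (x + y) + 1 := by positivity
  set δ := ε / (C * (x + y) + 1)
  have hδ : 0 < δ := by positivity
  have h1 := h ((y + δ) / (x + δ)) (by positivity)
  have e1 : (y + δ) / (x + δ) * x ^ 2 ≤ (y + δ) * x := by
    rw [div_mul_eq_mul_div, div_le_iff₀ (by positivity)]
    have : 0 ≤ (y + δ) * x * δ := by positivity
    nlinarith
  have e2 : y ^ 2 / ((y + δ) / (x + δ)) ≤ y * (x + δ) := by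
    rw [div_div_eq_mul_div, div_le_iff₀ (by positivity)]
    have : 0 ≤ y * (x + δ) * δ := by positivity
    nlinarith
  calc F ≤ C * ((y + δ) * x + y * (x + δ)) := h1.trans (by gcongr)
    _ = 2 * C * (x * y) + C * (x + y) * δ := by ring
    _ ≤ 2 * C * (x * y) + (C * (x + y) + 1) * δ := by gcongr; linarith
    _ = 2 * C * (x * y) + ε := by
        rw [mul_div_cancel₀ _ hden.ne']

/-- Boundedness of the discrete form. -/
theorem AdmissibleMesh.abs_form_le (m : AdmissibleMesh Ω T Ts N ϱ)
    (hab : BoundedCoeff Ω a b M) {w v : Plane → ℝ} (hw : MemBrokenH2 T w)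
    (hw2 : MemLp w 2 (volume.restrict Ω)) (hv : IsPiecewiseSmooth T Ts v)
    (hv2 : MemLp v 2 (volume.restrict Ω)) {h : ℝ} (h0 : 0 ≤ h)
    (hh : ∀ K ∈ T, Metric.diam K ≤ h) :
    |form a b T Ts w v| ≤ 2 * (M * (1 + 24 * N / ϱ)) *
      ((√(∫ x in Ω, w x ^ 2) + broken1 T w + h * broken2 T w) *
        (testNorm T Ts v + √(∫ x in Ω, v x ^ 2))) := by
  have hϱ := m.pos
  have hM := hab.pos.le
  have nw : 0 ≤ ∫ x in Ω, w x ^ 2 := integral_nonneg fun _ => sq_nonneg _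
  have nv : 0 ≤ ∫ x in Ω, v x ^ 2 := integral_nonneg fun _ => sq_nonneg _
  have b1 : 0 ≤ broken1 T w := Real.sqrt_nonneg _
  have b2 : 0 ≤ h * broken2 T w := mul_nonneg h0 (Real.sqrt_nonneg _)
  have b3 : 0 ≤ testNorm T Ts v := Real.sqrt_nonneg _
  have e1 : broken1 T w ^ 2 = ∑ K ∈ T, semi1Sq (interior K) w :=
    Real.sq_sqrt (Finset.sum_nonneg fun _ _ => semi1Sq_nonneg _ _)
  have e2 : (h * broken2 T w) ^ 2 = h ^ 2 * ∑ K ∈ T, semi2Sq (interior K) w := by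
    rw [mul_pow, broken2, Real.sq_sqrt (Finset.sum_nonneg fun _ _ => semi2Sq_nonneg _ _)]
  have hX : trialSq Ω T h w ≤ (√(∫ x in Ω, w x ^ 2) + broken1 T w + h * broken2 T w) ^ 2 := by
    rw [trialSq, ← e1, ← e2]
    have := Real.sq_sqrt nw
    nlinarith [mul_nonneg (Real.sqrt_nonneg (∫ x in Ω, w x ^ 2)) b1,
      mul_nonneg (Real.sqrt_nonneg (∫ x in Ω, w x ^ 2)) b2, mul_nonneg b1 b2]
  have hY : testNorm T Ts v ^ 2 + ∫ x in Ω, v x ^ 2 ≤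
      (testNorm T Ts v + √(∫ x in Ω, v x ^ 2)) ^ 2 := by
    have := Real.sq_sqrt nv
    nlinarith [mul_nonneg b3 (Real.sqrt_nonneg (∫ x in Ω, v x ^ 2))]
  refine le_of_forall_add_div_le (by positivity) (by positivity) (by positivity) fun t ht => ?_
  refine (m.abs_form_le_add hab hw hw2 hv hv2 hh ht).trans ?_
  gcongr

end Bounds

/-! ### The discrete problem: solvability and Strang's estimate -/

section Discrete

variable {Ω : Set Plane} {T Ts : Finset (Set Plane)} {N : ℕ} {ϱ M : ℝ}
  {a : Plane → Matrix (Fin 2) (Fin 2) ℝ} {b : Plane → ℝ}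

theorem ae_eq_add_smul (f g : L2 Ω) (c : ℝ) :
    ((f + c • g : L2 Ω) : Plane → ℝ) =ᵐ[volume.restrict Ω] (f : Plane → ℝ) + c • (g : Plane → ℝ) := by
  filter_upwards [Lp.coeFn_add f (c • g), Lp.coeFn_smul c g] with x h1 h2
  rw [h1, Pi.add_apply, h2, Pi.add_apply]

theorem norm_eq_sqrt_integral (f : L2 Ω) : ‖f‖ = √(∫ x in Ω, f x ^ 2) := by
  have h := eLpNorm_sq_eq_ofReal_integral (Lp.memLp f)
  have n : 0 ≤ ∫ x in Ω, f x ^ 2 := integral_nonneg fun _ => sq_nonneg _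
  rw [eq_comm, Real.sqrt_eq_iff_eq_sq n (norm_nonneg _), Lp.norm_def, ← ENNReal.toReal_pow, h,
    ENNReal.toReal_ofReal n]

theorem pairing_add_smul (f v₁ v₂ : L2 Ω) (c : ℝ) :
    pairing Ω f (v₁ + c • v₂ : L2 Ω) = pairing Ω f v₁ + c * pairing Ω f v₂ := by
  have i1 := integrable_mul_of_memLp_two (Lp.memLp f) (Lp.memLp v₁)
  have i2 := integrable_mul_of_memLp_two (Lp.memLp f) (Lp.memLp v₂)
  unfold pairing
  rw [← integral_const_mul, ← integral_add i1 (i2.const_mul c)]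
  refine integral_congr_ae ?_
  filter_upwards [ae_eq_add_smul v₁ v₂ c] with x h
  rw [h, Pi.add_apply, Pi.smul_apply, smul_eq_mul]
  ring

theorem broken1_nonneg (T : Finset (Set Plane)) (w : Plane → ℝ) : 0 ≤ broken1 T w :=
  Real.sqrt_nonneg _

theorem broken2_nonneg (T : Finset (Set Plane)) (w : Plane → ℝ) : 0 ≤ broken2 T w :=
  Real.sqrt_nonneg _

theorem broken1_sq (T : Finset (Set Plane)) (w : Plane → ℝ) :
    broken1 T w ^ 2 = ∑ K ∈ T, semi1Sq (interior K) w :=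
  Real.sq_sqrt (Finset.sum_nonneg fun _ _ => semi1Sq_nonneg _ _)

theorem MemH1.semi1Sq_add_smul_le {D : Set Plane} (hD : IsOpen D) {g g₁ g₂ : Plane → ℝ}
    (h1 : MemH1 D g₁) (h2 : MemH1 D g₂) {c : ℝ}
    (e : g =ᵐ[volume.restrict D] g₁ + c • g₂) :
    semi1Sq D g ≤ 2 * (semi1Sq D g₁ + c ^ 2 * semi1Sq D g₂) := by
  have h12 := h1.add_smul h2 c
  have h : MemH1 D g := h12.congr e.symm
  rw [h.semi1Sq_eq, h1.semi1Sq_eq, h2.semi1Sq_eq, Finset.mul_sum, ← Finset.sum_add_distrib,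
    Finset.mul_sum]
  refine Finset.sum_le_sum fun i _ => ?_
  have j1 := (h1.2 i).memLp_weakPartial.integrable_sq
  have j2 := (h2.2 i).memLp_weakPartial.integrable_sq
  rw [← integral_const_mul, ← integral_add j1 (j2.const_mul _), ← integral_const_mul]
  refine integral_mono_ae (h.2 i).memLp_weakPartial.integrable_sq
    ((j1.add (j2.const_mul _)).const_mul 2) ?_
  filter_upwards [(h12.2 i).weakPartial_congr hD e.symm, h1.weakPartial_add_smul hD h2 c i]
    with x p q
  rw [p, q, Pi.add_apply, Pi.smul_apply, smul_eq_mul]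
  nlinarith [sq_nonneg (weakPartial D i g₁ x - c * weakPartial D i g₂ x)]

theorem AdmissibleMesh.ae_restrict_interior (m : AdmissibleMesh Ω T Ts N ϱ)
    {K : Set Plane} (hK : K ∈ T) {f g : Plane → ℝ}
    (e : f =ᵐ[volume.restrict Ω] g) : f =ᵐ[volume.restrict (interior K)] g :=
  ae_restrict_of_ae_restrict_of_subset (m.interior_subset_domain hK) e

theorem AdmissibleMesh.memBrokenH2_add_smul (m : AdmissibleMesh Ω T Ts N ϱ)
    {w₁ w₂ : L2 Ω} (h1 : MemBrokenH2 T w₁)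
    (h2 : MemBrokenH2 T w₂) (c : ℝ) : MemBrokenH2 T (w₁ + c • w₂ : L2 Ω) := fun K hK =>
  ((h1 K hK).add_smul isOpen_interior (h2 K hK) c).congr isOpen_interior
    (m.ae_restrict_interior hK (ae_eq_add_smul w₁ w₂ c)).symm

/-- A crude triangle inequality obtained from `(p + q)² ≤ 2(p² + q²)`; the factor `2` only enlarges
the final constant. -/
theorem AdmissibleMesh.broken1_add_smul_le (m : AdmissibleMesh Ω T Ts N ϱ)
    {w₁ w₂ : L2 Ω} (h1 : MemBrokenH2 T w₁)
    (h2 : MemBrokenH2 T w₂) (c : ℝ) : broken1 T (w₁ + c • w₂ : L2 Ω) ≤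
      2 * (broken1 T w₁ + |c| * broken1 T w₂) := by
  have n1 := broken1_nonneg T w₁
  have n2 := broken1_nonneg T w₂
  refine (sq_le_sq₀ (broken1_nonneg _ _) (by positivity)).1 ?_
  have := Finset.sum_le_sum fun K (hK : K ∈ T) =>
    (h1 K hK).1.semi1Sq_add_smul_le isOpen_interior (h2 K hK).1
      (m.ae_restrict_interior hK (ae_eq_add_smul w₁ w₂ c))
  rw [← Finset.mul_sum, Finset.sum_add_distrib, ← Finset.mul_sum, ← broken1_sq, ← broken1_sq,
    ← broken1_sq] at this
  have hc := sq_abs c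
  have : 0 ≤ broken1 T w₁ * (|c| * broken1 T w₂) := by positivity
  nlinarith [sq_nonneg (broken1 T w₁), sq_nonneg (|c| * broken1 T w₂)]

theorem AdmissibleMesh.memBrokenH2_of_memH2 (m : AdmissibleMesh Ω T Ts N ϱ)
    {u : Plane → ℝ} (h : MemH2 Ω u) : MemBrokenH2 T u :=
  fun _ hK => h.mono m.domain.1 isOpen_interior (m.interior_subset_domain hK)

/-- The quantity by which the best approximation of the solution is measured. -/
noncomputable def trialNorm (T : Finset (Set Plane)) (h : ℝ) (w : L2 Ω) : ℝ :=
  ‖w‖ + broken1 T w + h * broken2 T w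

/-- A finite volume scheme on one mesh, with the constants on which its stability depends. -/
structure StableScheme (Ω : Set Plane) (a : Plane → Matrix (Fin 2) (Fin 2) ℝ) (b : Plane → ℝ)
    (T Ts : Finset (Set Plane)) (U V : Submodule ℝ (L2 Ω)) (P : U →ₗ[ℝ] V)
    (N : ℕ) (ϱ M C₁ C₂ σ : ℝ) : Prop where
  mesh : AdmissibleMesh Ω T Ts N ϱ
  coeff : BoundedCoeff Ω a b M
  trial : ∀ w ∈ U, MemBrokenH2 T w
  test : ∀ v ∈ V, IsPiecewiseSmooth T Ts v
  injective : Function.Injective P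
  surjective : Function.Surjective P
  pos₁ : 0 < C₁
  pos₂ : 0 < C₂
  pos : 0 < σ
  testNorm_le : ∀ v : U, testNorm T Ts (P v : L2 Ω) ≤ C₁ * broken1 T (v : L2 Ω)
  norm_le : ∀ v : U, ‖(P v : L2 Ω)‖ ≤ C₂ * broken1 T (v : L2 Ω)
  coercive : ∀ w : U,
    σ * broken1 T (w : L2 Ω) ^ 2 ≤ form a b T Ts (w : L2 Ω) (P w : L2 Ω)

namespace StableScheme

variable {U V : Submodule ℝ (L2 Ω)} {P : U →ₗ[ℝ] V} {C₁ C₂ σ h : ℝ}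

theorem form_add_smul_left (s : StableScheme Ω a b T Ts U V P N ϱ M C₁ C₂ σ) {w₁ w₂ : L2 Ω}
    (h1 : MemBrokenH2 T w₁) (h2 : MemBrokenH2 T w₂) (v : V) (c : ℝ) :
    form a b T Ts (w₁ + c • w₂ : L2 Ω) (v : L2 Ω) =
      form a b T Ts w₁ (v : L2 Ω) + c * form a b T Ts w₂ (v : L2 Ω) :=
  s.mesh.form_add_smul_left s.coeff h1 h2 (s.test v v.2) (ae_eq_add_smul w₁ w₂ c)

theorem form_sub_left (s : StableScheme Ω a b T Ts U V P N ϱ M C₁ C₂ σ) {w₁ w₂ : L2 Ω}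
    (h1 : MemBrokenH2 T w₁) (h2 : MemBrokenH2 T w₂) (v : V) :
    form a b T Ts (w₁ - w₂ : L2 Ω) (v : L2 Ω) =
      form a b T Ts w₁ (v : L2 Ω) - form a b T Ts w₂ (v : L2 Ω) := by
  rw [show w₁ - w₂ = w₁ + (-1 : ℝ) • w₂ by rw [neg_one_smul, sub_eq_add_neg],
    s.form_add_smul_left h1 h2]
  ring

theorem form_add_smul_right (s : StableScheme Ω a b T Ts U V P N ϱ M C₁ C₂ σ) {w : L2 Ω}
    (hw : MemBrokenH2 T w) (v₁ v₂ : V) (c : ℝ) :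
    form a b T Ts w (v₁ + c • v₂ : L2 Ω) =
      form a b T Ts w (v₁ : L2 Ω) + c * form a b T Ts w (v₂ : L2 Ω) :=
  s.mesh.form_add_smul_right s.coeff hw (s.test v₁ v₁.2) (s.test v₂ v₂.2)
    (ae_eq_add_smul (v₁ : L2 Ω) v₂ c)

theorem memBrokenH2_sub (s : StableScheme Ω a b T Ts U V P N ϱ M C₁ C₂ σ) {w₁ w₂ : L2 Ω}
    (h1 : MemBrokenH2 T w₁) (h2 : MemBrokenH2 T w₂) : MemBrokenH2 T (w₁ - w₂ : L2 Ω) := by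
  rw [show w₁ - w₂ = w₁ + (-1 : ℝ) • w₂ by rw [neg_one_smul, sub_eq_add_neg]]
  exact s.mesh.memBrokenH2_add_smul h1 h2 _

theorem form_add_left (s : StableScheme Ω a b T Ts U V P N ϱ M C₁ C₂ σ) {w₁ w₂ : L2 Ω}
    (h1 : MemBrokenH2 T w₁) (h2 : MemBrokenH2 T w₂) (v : V) :
    form a b T Ts (w₁ + w₂ : L2 Ω) (v : L2 Ω) =
      form a b T Ts w₁ (v : L2 Ω) + form a b T Ts w₂ (v : L2 Ω) := by
  simpa using s.form_add_smul_left h1 h2 v 1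

theorem form_smul_left (s : StableScheme Ω a b T Ts U V P N ϱ M C₁ C₂ σ) {w : L2 Ω}
    (hw : MemBrokenH2 T w) (v : V) (c : ℝ) :
    form a b T Ts (c • w : L2 Ω) (v : L2 Ω) = c * form a b T Ts w (v : L2 Ω) := by
  -- Homogeneity follows from the combined linearity statement without evaluating the form at zero.
  rw [show c • w = w + (c - 1) • w by rw [sub_smul, one_smul, add_sub_cancel],
    s.form_add_smul_left hw hw]
  ring

theorem form_add_right (s : StableScheme Ω a b T Ts U V P N ϱ M C₁ C₂ σ) {w : L2 Ω}
    (hw : MemBrokenH2 T w) (v₁ v₂ : V) :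
    form a b T Ts w (v₁ + v₂ : L2 Ω) =
      form a b T Ts w (v₁ : L2 Ω) + form a b T Ts w (v₂ : L2 Ω) := by
  simpa using s.form_add_smul_right hw v₁ v₂ 1

theorem form_smul_right (s : StableScheme Ω a b T Ts U V P N ϱ M C₁ C₂ σ) {w : L2 Ω}
    (hw : MemBrokenH2 T w) (v : V) (c : ℝ) :
    form a b T Ts w (c • (v : L2 Ω) : L2 Ω) = c * form a b T Ts w (v : L2 Ω) := by
  rw [show c • (v : L2 Ω) = v + (c - 1) • (v : L2 Ω) by rw [sub_smul, one_smul, add_sub_cancel],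
    s.form_add_smul_right hw]
  ring

/-- The discrete form as a bilinear map. -/
noncomputable def bilin (s : StableScheme Ω a b T Ts U V P N ϱ M C₁ C₂ σ) : U →ₗ[ℝ] V →ₗ[ℝ] ℝ :=
  LinearMap.mk₂ ℝ (fun w v => form a b T Ts (w : L2 Ω) (v : L2 Ω))
    (fun w₁ w₂ v => s.form_add_left (s.trial _ w₁.2) (s.trial _ w₂.2) v)
    (fun c w v => s.form_smul_left (s.trial _ w.2) v c)
    (fun w v₁ v₂ => s.form_add_right (s.trial _ w.2) v₁ v₂)
    (fun c w v => s.form_smul_right (s.trial _ w.2) v c)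

/-- Testing with `P w`, coercivity yields only `broken1 T w = 0`; the L² bound on `P w` turns this
into `P w = 0`, and injectivity of `P` gives `w = 0`. -/
theorem injective_bilin (s : StableScheme Ω a b T Ts U V P N ϱ M C₁ C₂ σ) :
    Function.Injective s.bilin := by
  refine (injective_iff_map_eq_zero _).2 fun w hw => ?_
  have h1 : form a b T Ts (w : L2 Ω) (P w : L2 Ω) = 0 := LinearMap.congr_fun hw (P w)
  have h2 := s.coercive w
  have h3 : broken1 T (w : L2 Ω) = 0 := by
    have := s.pos
    have : broken1 T (w : L2 Ω) ^ 2 ≤ 0 := by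
      by_contra! h
      have := mul_pos s.pos h
      linarith
    exact pow_eq_zero_iff two_ne_zero |>.1 (this.antisymm (sq_nonneg _))
  have h4 := s.norm_le w
  rw [h3, mul_zero, norm_le_zero_iff, ZeroMemClass.coe_eq_zero] at h4
  exact (map_eq_zero_iff P s.injective).1 h4

/-- The form is an injective map from `U` to the dual of `V`, two spaces of equal finite dimension,
hence bijective. -/
theorem existsUnique_isFVMSolution [FiniteDimensional ℝ U] [FiniteDimensional ℝ V]
    (s : StableScheme Ω a b T Ts U V P N ϱ M C₁ C₂ σ) (f : L2 Ω) :
    ∃! uT : L2 Ω, uT ∈ U ∧ IsFVMSolution Ω a b T Ts V f uT := by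
  have hd : Module.finrank ℝ U = Module.finrank ℝ (V →ₗ[ℝ] ℝ) := by
    rw [(LinearEquiv.ofBijective P ⟨s.injective, s.surjective⟩).finrank_eq]
    exact Subspace.dual_finrank_eq.symm
  have hs := (LinearMap.injective_iff_surjective_of_finrank_eq_finrank hd).1 s.injective_bilin
  let F : V →ₗ[ℝ] ℝ :=
    { toFun := fun v => pairing Ω f (v : L2 Ω)
      map_add' := fun v₁ v₂ => by simpa using pairing_add_smul f (v₁ : L2 Ω) v₂ 1
      map_smul' := fun c v => by
        have := pairing_add_smul f (v : L2 Ω) v (c - 1)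
        rw [sub_smul, one_smul, add_sub_cancel] at this
        rw [Submodule.coe_smul, this, RingHom.id_apply, smul_eq_mul]
        ring }
  obtain ⟨w, hw⟩ := hs F
  refine ⟨w, ⟨w.2, fun v hv => LinearMap.congr_fun hw ⟨v, hv⟩⟩, fun w' hw' => ?_⟩
  refine congrArg Subtype.val (s.injective_bilin (a₁ := ⟨w', hw'.1⟩) (a₂ := w) ?_)
  rw [hw]
  exact LinearMap.ext fun v => hw'.2 v v.2

theorem form_sub_eq_nonconformingError (s : StableScheme Ω a b T Ts U V P N ϱ M C₁ C₂ σ)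
    {f u uT : L2 Ω} (hu : MemBrokenH2 T u) (hT : uT ∈ U) (h : IsFVMSolution Ω a b T Ts V f uT)
    (v : V) : form a b T Ts (u - uT : L2 Ω) (v : L2 Ω) =
      nonconformingError Ω a b T Ts f u (v : L2 Ω) := by
  rw [s.form_sub_left hu (s.trial _ hT), h v v.2, nonconformingError]

theorem abs_form_le (s : StableScheme Ω a b T Ts U V P N ϱ M C₁ C₂ σ) (h0 : 0 ≤ h)
    (hh : ∀ K ∈ T, Metric.diam K ≤ h) {w : L2 Ω} (hw : MemBrokenH2 T w) (v : U) :
    |form a b T Ts w (P v : L2 Ω)| ≤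
      2 * (M * (1 + 24 * N / ϱ)) * (C₁ + C₂) * trialNorm T h w * broken1 T (v : L2 Ω) := by
  have hϱ := s.mesh.pos
  have hM := s.coeff.pos.le
  have h1 := s.mesh.abs_form_le s.coeff hw (Lp.memLp w) (s.test _ (P v).2)
    (Lp.memLp (P v : L2 Ω)) h0 hh
  rw [← norm_eq_sqrt_integral, ← norm_eq_sqrt_integral] at h1
  refine h1.trans ?_
  have n1 := broken1_nonneg T w
  have n2 := broken2_nonneg T w
  calc _ ≤ 2 * (M * (1 + 24 * N / ϱ)) * (trialNorm T h w *
        (C₁ * broken1 T (v : L2 Ω) + C₂ * broken1 T (v : L2 Ω))) := by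
        unfold trialNorm
        gcongr
        · exact s.testNorm_le v
        · exact s.norm_le v
    _ = _ := by ring

theorem trialNorm_nonneg (h0 : 0 ≤ h) (w : L2 Ω) : 0 ≤ trialNorm T h w :=
  add_nonneg (add_nonneg (norm_nonneg _) (broken1_nonneg _ _))
    (mul_nonneg h0 (broken2_nonneg _ _))

theorem bddAbove_range (s : StableScheme Ω a b T Ts U V P N ϱ M C₁ C₂ σ) (h0 : 0 ≤ h)
    (hh : ∀ K ∈ T, Metric.diam K ≤ h) {w : L2 Ω} (hw : MemBrokenH2 T w) :
    BddAbove (Set.range fun v : U =>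
      form a b T Ts w (P v : L2 Ω) / broken1 T (v : L2 Ω)) := by
  have hϱ := s.mesh.pos
  have hM := s.coeff.pos.le
  have n1 := s.pos₁
  have n2 := s.pos₂
  have n3 := trialNorm_nonneg (T := T) h0 w
  refine ⟨2 * (M * (1 + 24 * N / ϱ)) * (C₁ + C₂) * trialNorm T h w, ?_⟩
  rintro _ ⟨v, rfl⟩
  -- Where the seminorm vanishes, the quotient is `0` by convention and lies below the nonnegative
  -- bound.
  exact div_le_of_le_mul₀ (broken1_nonneg _ _) (by positivity)
    ((le_abs_self _).trans (s.abs_form_le h0 hh hw v))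

theorem form_le_iSup_mul (s : StableScheme Ω a b T Ts U V P N ϱ M C₁ C₂ σ) (h0 : 0 ≤ h)
    (hh : ∀ K ∈ T, Metric.diam K ≤ h) {w : L2 Ω} (hw : MemBrokenH2 T w) (v : U) :
    form a b T Ts w (P v : L2 Ω) ≤
      (⨆ v : U, form a b T Ts w (P v : L2 Ω) / broken1 T (v : L2 Ω)) * broken1 T (v : L2 Ω) := by
  rcases (broken1_nonneg T (v : L2 Ω)).eq_or_lt with e | e
  -- For vanishing seminorm of `v` the supremum says nothing, but boundedness makes the form
  -- nonpositive.
  · have := (le_abs_self _).trans (s.abs_form_le h0 hh hw v)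
    rwa [← e, mul_zero] at this ⊢
  · rw [← div_le_iff₀ e]
    exact le_ciSup (s.bddAbove_range h0 hh hw) v

theorem iSup_nonneg (s : StableScheme Ω a b T Ts U V P N ϱ M C₁ C₂ σ) (h0 : 0 ≤ h)
    (hh : ∀ K ∈ T, Metric.diam K ≤ h) {w : L2 Ω} (hw : MemBrokenH2 T w) :
    0 ≤ ⨆ v : U, form a b T Ts w (P v : L2 Ω) / broken1 T (v : L2 Ω) := by
  refine le_ciSup_of_le (s.bddAbove_range h0 hh hw) 0 ?_
  have : form a b T Ts w (P 0 : L2 Ω) = 0 := by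
    simpa using s.form_smul_right hw (P 0) 0
  rw [this, zero_div]

/-- Strang's second lemma for the scheme. -/
theorem broken1_sub_le (s : StableScheme Ω a b T Ts U V P N ϱ M C₁ C₂ σ) (h0 : 0 ≤ h)
    (hh : ∀ K ∈ T, Metric.diam K ≤ h) {u uT : L2 Ω} (hu : MemBrokenH2 T u) (hT : uT ∈ U)
    (w : U) :
    broken1 T (u - uT : L2 Ω) ≤
      2 * (1 + (2 * (M * (1 + 24 * N / ϱ)) * (C₁ + C₂) + 1) / σ) *
        (trialNorm T h (u - (w : L2 Ω)) +
          ⨆ v : U, form a b T Ts (u - uT : L2 Ω) (P v : L2 Ω) / broken1 T (v : L2 Ω)) := by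
  have hϱ := s.mesh.pos
  have hM := s.coeff.pos.le
  have n1 := s.pos₁
  have n2 := s.pos₂
  have hσ := s.pos
  have hw := s.trial _ w.2
  have huT := s.memBrokenH2_sub hu (s.trial _ hT)
  have huw := s.memBrokenH2_sub hu hw
  set S := ⨆ v : U, form a b T Ts (u - uT : L2 Ω) (P v : L2 Ω) / broken1 T (v : L2 Ω)
  set X := trialNorm T h (u - (w : L2 Ω))
  set Q := 2 * (M * (1 + 24 * N / ϱ)) * (C₁ + C₂)
  have nQ : 0 ≤ Q := by positivity
  have nX : 0 ≤ X := trialNorm_nonneg h0 _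
  have nS : 0 ≤ S := s.iSup_nonneg h0 hh huT
  have hX : broken1 T (u - (w : L2 Ω) : L2 Ω) ≤ X := by
    have := norm_nonneg (u - (w : L2 Ω))
    have := mul_nonneg h0 (broken2_nonneg T (u - (w : L2 Ω) : L2 Ω))
    simp only [X, trialNorm]
    linarith
  let d : U := w - ⟨uT, hT⟩
  have hd : (d : L2 Ω) = w - uT := rfl
  -- The exact solution is inserted: `w - u_T = (u - u_T) - (u - w)`.
  have e : form a b T Ts (d : L2 Ω) (P d : L2 Ω) =
      form a b T Ts (u - uT : L2 Ω) (P d : L2 Ω) -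
        form a b T Ts (u - (w : L2 Ω) : L2 Ω) (P d : L2 Ω) := by
    rw [← s.form_sub_left huT huw, sub_sub_sub_cancel_left, hd]
  have hc := s.coercive d
  have h1 := s.form_le_iSup_mul h0 hh huT d
  have h2 := (neg_le_abs _).trans (s.abs_form_le h0 hh huw d)
  have hD : broken1 T (d : L2 Ω) ≤ (Q * X + S) / σ := by
    rw [le_div_iff₀ hσ]
    rcases (broken1_nonneg T (d : L2 Ω)).eq_or_lt with e0 | e0
    · rw [← e0, zero_mul]; positivity
    · refine le_of_mul_le_mul_right ?_ e0
      calc _ = σ * broken1 T (d : L2 Ω) ^ 2 := by ring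
        _ ≤ S * broken1 T (d : L2 Ω) + Q * X * broken1 T (d : L2 Ω) := by linarith
        _ = _ := by ring
  have h3 := s.mesh.broken1_add_smul_le huw (s.trial _ d.2) 1
  rw [one_smul, hd, sub_add_sub_cancel, abs_one, one_mul, ← hd] at h3
  calc _ ≤ 2 * (X + (Q * X + S) / σ) := h3.trans (by gcongr)
    -- Padding with nonnegative terms, so that `X` and `S` share one constant.
    _ ≤ 2 * (X + (Q * X + S) / σ) + 2 * (S + (X + Q * S) / σ) := by
        have : 0 ≤ (X + Q * S) / σ := by positivity
        linarith
    _ = _ := by ring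

end StableScheme

end Discrete

/-! ### Mesh size of the family and the final theorem -/

/-- The diameters are bounded by that of `closure Ω`, so the supremum defining the mesh size is not
a default value. -/
theorem diam_le_meshSize {ι : Type*} {Ω : Set Plane} (hΩ : Bornology.IsBounded Ω)
    {T : ι → Finset (Set Plane)} (hT : ∀ i, IsPrimaryPartition Ω (T i)) (i : ι) {K : Set Plane}
    (hK : K ∈ T i) : Metric.diam K ≤ meshSize T := by
  refine le_csSup ⟨Metric.diam (closure Ω), ?_⟩ ⟨i, K, hK, rfl⟩
  rintro _ ⟨j, L, hL, rfl⟩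
  refine Metric.diam_mono ?_ hΩ.closure
  rw [(hT j).1.1]
  exact Set.subset_biUnion_of_mem (u := id) hL

theorem meshSize_nonneg {ι : Type*} (T : ι → Finset (Set Plane)) : 0 ≤ meshSize T :=
  Real.sSup_nonneg (by rintro _ ⟨_, _, _, rfl⟩; exact Metric.diam_nonneg)

end FVM

theorem theorem2p1
    (Ω : Set Plane) (hΩ : IsPolygonalDomain Ω)
    (a : Plane → Matrix (Fin 2) (Fin 2) ℝ) (b : Plane → ℝ) (hab : IsEllipticData Ω a b)
    -- the family of primary partitions, with the associated dual partitions
    {ι : Type*} (T Ts : ι → Finset (Set Plane))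
    (hT : ∀ i, IsPrimaryPartition Ω (T i)) (hTs : ∀ i, IsDualPartition Ω (Ts i))
    (hlines : ∃ N : ℕ, ∀ i, ∀ K ∈ T i, (dualGridlines (Ts i) K).encard ≤ (N : ℕ∞))
    -- trial spaces, test spaces, and the mappings between them
    (U V : ι → Submodule ℝ (L2 Ω))
    (hUfin : ∀ i, FiniteDimensional ℝ (U i)) (hVfin : ∀ i, FiniteDimensional ℝ (V i))
    (hdim : ∀ i, Module.finrank ℝ (V i) = Module.finrank ℝ (U i))
    (hU : ∀ i, ∀ w ∈ U i, MemBrokenH2 (T i) w)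
    (hV : ∀ i, ∀ v ∈ V i, IsPiecewisePolynomial (T i) (Ts i) v)
    (Pi : ∀ i, U i →ₗ[ℝ] V i) (hPi : ∀ i, Function.Surjective (Pi i))
    -- regularity, the two discrete norm bounds, and uniform ellipticity
    (hreg : IsRegularFamily T)
    (hbound1 : ∃ C : ℝ, 0 < C ∧ ∀ i, ∀ v : U i,
      testNorm (T i) (Ts i) (Pi i v : L2 Ω) ≤ C * broken1 (T i) (v : L2 Ω))
    (hbound2 : ∃ C : ℝ, 0 < C ∧ ∀ i, ∀ v : U i,
      ‖(Pi i v : L2 Ω)‖ ≤ C * broken1 (T i) (v : L2 Ω))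
    (hell : ∃ σ : ℝ, 0 < σ ∧ ∀ i, ∀ w : U i,
      σ * broken1 (T i) (w : L2 Ω) ^ 2 ≤ form a b (T i) (Ts i) (w : L2 Ω) (Pi i w : L2 Ω)) :
    (∀ f : L2 Ω, ∀ i, ∃! uT : L2 Ω,
      uT ∈ U i ∧ IsFVMSolution Ω a b (T i) (Ts i) (V i) f uT) ∧
    ∃ C : ℝ, 0 < C ∧ ∀ f u : L2 Ω, IsSolution Ω a b f u →
      ∀ i, ∀ uT ∈ U i, IsFVMSolution Ω a b (T i) (Ts i) (V i) f uT →
        (∀ v : U i, form a b (T i) (Ts i) (u - uT : L2 Ω) (Pi i v : L2 Ω) =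
          nonconformingError Ω a b (T i) (Ts i) f u (Pi i v : L2 Ω)) ∧
        BddAbove (Set.range fun v : U i =>
          nonconformingError Ω a b (T i) (Ts i) f u (Pi i v : L2 Ω) /
            broken1 (T i) (v : L2 Ω)) ∧
        broken1 (T i) (u - uT : L2 Ω) ≤
          C * ((⨅ w : U i, (‖u - (w : L2 Ω)‖ + broken1 (T i) (u - (w : L2 Ω) : L2 Ω) +
              meshSize T * broken2 (T i) (u - (w : L2 Ω) : L2 Ω))) +
            ⨆ v : U i, nonconformingError Ω a b (T i) (Ts i) f u (Pi i v : L2 Ω) /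
              broken1 (T i) (v : L2 Ω)) := by
  obtain ⟨N, hN⟩ := hlines
  obtain ⟨ϱ, hϱ, hr⟩ := hreg
  obtain ⟨M, hM⟩ := hab.exists_boundedCoeff hΩ
  obtain ⟨C₁, hC₁, hb₁⟩ := hbound1
  obtain ⟨C₂, hC₂, hb₂⟩ := hbound2
  obtain ⟨σ, hσ, hell⟩ := hell
  have s : ∀ i, StableScheme Ω a b (T i) (Ts i) (U i) (V i) (Pi i) N ϱ M C₁ C₂ σ := fun i =>
    { mesh := ⟨hΩ, hT i, hTs i, hN i, hϱ, hr i⟩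
      coeff := hM
      trial := hU i
      test := fun v hv => (hV i v hv).isPiecewiseSmooth
      -- Surjectivity between spaces of the same finite dimension.
      injective := (LinearMap.injective_iff_surjective_of_finrank_eq_finrank (hdim i).symm).2
        (hPi i)
      surjective := hPi i
      pos₁ := hC₁
      pos₂ := hC₂
      pos := hσ
      testNorm_le := hb₁ i
      norm_le := hb₂ i
      coercive := hell i }
  refine ⟨fun f i => (s i).existsUnique_isFVMSolution f,
    2 * (1 + (2 * (M * (1 + 24 * N / ϱ)) * (C₁ + C₂) + 1) / σ), ?_,
    fun f u hu i uT huT hsol => ?_⟩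
  · have := hM.pos
    positivity
  have h0 := meshSize_nonneg T
  have hh : ∀ K ∈ T i, Metric.diam K ≤ meshSize T := fun K hK =>
    diam_le_meshSize hΩ.2.2.1 hT i hK
  have hu2 := (s i).mesh.memBrokenH2_of_memH2 hu.2.1
  have huT2 := (s i).memBrokenH2_sub hu2 (hU i _ huT)
  have hE := fun v : U i =>
    (s i).form_sub_eq_nonconformingError hu2 huT hsol (Pi i v)
  have hbdd := (s i).bddAbove_range h0 hh huT2
  have hle := (s i).broken1_sub_le h0 hh hu2 huT
  simp only [hE] at hbdd hle
  refine ⟨hE, hbdd, ?_⟩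
  have hC : 0 < 2 * (1 + (2 * (M * (1 + 24 * N / ϱ)) * (C₁ + C₂) + 1) / σ) := by
    have := hM.pos
    positivity
  -- The infimum is isolated on the right, so that it suffices to compare with every single `w`.
  rw [← div_le_iff₀' hC, ← sub_le_iff_le_add]
  refine le_ciInf fun w => ?_
  rw [sub_le_iff_le_add, div_le_iff₀' hC]
  exact hle w
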